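/- Let $(\Omega,\mathcal F,\mathbb P)$ be a complete probability space, let $p,\lambda>0$, $\alpha>r>0$ and $\delta>r$, and let $Y_t=\sum_{i=1}^{N(t)}U_i$, where $N$ is a Poisson process of rate $\lambda$ and the claim sizes $U_i\ge 0$ are i.i.d. with distribution $F$, independent of $N$. Put $c(x)=p+rx$ for $x\ge 0$ and $c(x)=p+\alpha x$ for $x<0$. Let $(\mathcal F_t)$ be the filtration generated by $Y$ and augmented by the null sets. A dividend strategy is a predictable, nondecreasing, left-continuous process $L$ with $L_0=0$. For the initial reserve $x$, its reserve process $R$ solves $$R_t=x+\int_0^t c(R_s)\,ds-Y_t-L_t ,\qquad t\ge 0,$$ and $T=\inf\{t\ge 0: R_t\le -p/\alpha\}$ is the time of ruin. $L$ is admissible for $x$ if $L_{t+}-L_t\le\max(R_t+p/\alpha,0)$ for all $t\le T$, that is, a lump sum dividend never exceeds the excess of the reserve over the critical value $-p/\alpha$. Let $$V_L(x)=\mathbb E\Big[\int_{[0,T]}e^{-\delta s}\,dL_s\Big],\qquad V(x)=\sup_{L\text{ admissible for }x}V_L(x),$$ (where a jump of $L$ at $s$ contributes the mass $L_{s+}-L_s$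 at $s$, and $[0,T]$ is $[0,\infty)$ if $T=\infty$), $$\mathcal G_V(x)=c(x)-(\lambda+\delta)V(x)+\lambda\int_{[0,x+p/\alpha]}V(x-y)\,dF(y),$$ $\mathcal A=\{x\ge -p/\alpha:\mathcal G_V(x)=0\}$, $\mathcal B=\{x\ge -p/\alpha: V'(x)\text{ exists},\ V'(x)=1\text{ and }\mathcal G_V(x)<0\}$, and $\mathcal C=[-p/\alpha,\infty)\setminus(\mathcal A\cup\mathcal B)$. **Theorem.** Suppose $\alpha>\lambda+\delta$. Then $V(x)<\infty$ for all $x\in\mathbb R$, and $$\Big(-\frac p\alpha,0\Big)\subset\mathcal C .$$ Moreover it is optimal to pay no dividends while the reserve is negative: for every $x\ge -p/\alpha$ there is a strategy $L^*$, admissible for $x$, with $V_{L^*}(x)=V(x)$, which almost surely obeys the following band rule up to ruin - on the set of times $s$ with $R_s\in\mathcal A$, $dL^*_s=c(R_s)\,ds$; - at each time $t$ with $R_t\in\mathcal B$, the lump sum $L^*_{t+}-L^*_t=R_t-\inf\{y:(y,R_t]\subset\mathcal B\}$ is paid; - on the set of times $s$ with $R_s\in\mathcal C$, $dL^*_s=0$;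 and for which almost surely the measure $dL^*$ gives no mass to $\{s\in[0,T]: R_s<0\}$. -/

import Mathlib

open MeasureTheory ProbabilityTheory Set Filter Topology
open scoped NNReal ENNReal

noncomputable section

/-- The data of the risk model on a probability space `(Ω, P)`: premium rate `p`, Poisson intensity
`lam`, credit interest `r`, debit interest `α`, discount `δ`, the claim size distribution `F`, the
waiting times `W i` between consecutive claims (i.i.d. exponential of rate `lam`, so that the
counting process below is a Poisson process of rate `lam`) and the claim sizes `U i` (i.i.d. with
distribution `F`), independent of the waiting times. -/
structure RiskModel {Ω : Type*} [MeasurableSpace Ω] (P : Measure Ω) where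
  p : ℝ
  lam : ℝ
  r : ℝ
  α : ℝ
  δ : ℝ
  F : Measure ℝ
  p_pos : 0 < p
  lam_pos : 0 < lam
  r_pos : 0 < r
  r_lt_α : r < α
  r_lt_δ : r < δ
  F_prob : IsProbabilityMeasure F
  F_nonneg : F (Iio 0) = 0
  W : ℕ → Ω → ℝ
  U : ℕ → Ω → ℝ
  measurable_W : ∀ i, Measurable (W i)
  measurable_U : ∀ i, Measurable (U i)
  law_W : ∀ i, P.map (W i) = expMeasure lam
  law_U : ∀ i, P.map (U i) = F
  indep_W : iIndepFun W P
  indep_U : iIndepFun U P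
  indep_W_U : IndepFun (fun ω i => W i ω) (fun ω i => U i ω) P

namespace RiskModel

variable {Ω : Type*} [MeasurableSpace Ω] {P : Measure Ω} (M : RiskModel P)

/-- Arrival epoch of the claim with index `i` (indices start at `0`). -/
def S (i : ℕ) (ω : Ω) : ℝ := ∑ j ∈ Finset.range (i + 1), M.W j ω

/-- Number of claims up to time `t`. -/
def N (t : ℝ≥0) (ω : Ω) : ℕ := {i : ℕ | M.S i ω ≤ t}.ncard

/-- Aggregate claims up to time `t`. -/
def Y (t : ℝ≥0) (ω : Ω) : ℝ := ∑ i ∈ Finset.range (M.N t ω), M.U i ω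

theorem measurable_S (i : ℕ) : Measurable (M.S i) :=
  Finset.measurable_sum _ fun j _ => M.measurable_W j

theorem measurable_N (t : ℝ≥0) : Measurable (M.N t) := by
  refine measurable_ncard.comp (measurable_set_iff.2 fun i => ?_)
  exact measurableSet_setOfPred.1 (measurableSet_le (M.measurable_S i) measurable_const)

theorem measurable_Y (t : ℝ≥0) : Measurable (M.Y t) := by
  have h : Measurable (fun q : ℕ × Ω => ∑ i ∈ Finset.range q.1, M.U i q.2) :=
    measurable_from_prod_countable_right fun n => by
      simpa using Finset.measurable_sum (Finset.range n) fun i _ => M.measurable_U i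
  exact h.comp ((M.measurable_N t).prodMk measurable_id)

/-- The filtration generated by the aggregate claims and augmented by all null sets. (The initial
reserve is a constant, so it adds nothing.) -/
def filtration [P.IsComplete] : Filtration ℝ≥0 ‹MeasurableSpace Ω› where
  seq t := (⨆ s : ℝ≥0, ⨆ _ : s ≤ t, (borel ℝ).comap (M.Y s)) ⊔
    MeasurableSpace.generateFrom {A : Set Ω | P A = 0}
  mono' s t hst := by
    refine sup_le_sup_right ?_ _
    exact iSup_mono fun u => iSup_mono' fun hu => ⟨hu.trans hst, le_rfl⟩
  le' t := by
    refine sup_le (iSup_le fun s => iSup_le fun _ => ?_) ?_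
    · rw [← BorelSpace.measurable_eq (α := ℝ)]
      exact (M.measurable_Y s).comap_le
    · exact MeasurableSpace.generateFrom_le fun A hA => Measure.IsComplete.out' A hA

/-- The rate of premiums and interest when the reserve is `x`. -/
def drift (x : ℝ) : ℝ := M.p + (if 0 ≤ x then M.r * x else M.α * x)

/-- A cumulative dividend process: started at `0`, nondecreasing, left continuous (right limits
exist by monotonicity) and predictable. -/
structure DividendStrategy [P.IsComplete] where
  L : ℝ≥0 → Ω → ℝ
  L_zero : ∀ ω, L 0 ω = 0
  mono : ∀ ω, Monotone fun t => L t ω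
  left_cont : ∀ ω t, ContinuousWithinAt (fun s => L s ω) (Iic t) t
  predictable : IsStronglyPredictable M.filtration L

namespace DividendStrategy

variable {M} [P.IsComplete] (D : M.DividendStrategy)

/-- The path `t ↦ L_t(ω)`, extended by `L_0(ω) = 0` to negative times. -/
def path (ω : Ω) (t : ℝ) : ℝ := D.L t.toNNReal ω

theorem path_mono (ω : Ω) : Monotone (D.path ω) := fun _ _ h =>
  D.mono ω (Real.toNNReal_mono h)

/-- The Lebesgue-Stieltjes measure `dL_s(ω)`: it gives `[a, b)` the mass `L_b - L_a`, and
the point `s` the mass `L_{s+} - L_s`, for `0 ≤ a ≤ b` and `0 ≤ s`. -/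
def dL (ω : Ω) : Measure ℝ := (D.path_mono ω).stieltjesFunction.measure

end DividendStrategy

/-- `R` is the controlled reserve with initial value `x` and dividends `D`, i.e.
`dR_t = drift (R_{t-}) dt - dY_t - dL_t` and `R_0 = x`, in integrated form. -/
def IsReserve [P.IsComplete] (x : ℝ) (D : M.DividendStrategy) (R : ℝ≥0 → Ω → ℝ) : Prop :=
  ∀ᵐ ω ∂P, ∀ t : ℝ≥0,
    IntervalIntegrable (fun s : ℝ => M.drift (R s.toNNReal ω)) volume 0 t ∧
    R t ω = x + (∫ s in (0 : ℝ)..t, M.drift (R s.toNNReal ω)) - M.Y t ω - D.L t ω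

/-- Time of (absolute) ruin: the infimum of the times at which the reserve is at or below the
critical value `-p / α` (`∞` if there is none). -/
def ruinTime (R : ℝ≥0 → Ω → ℝ) (ω : Ω) : ℝ≥0∞ :=
  ⨅ (t : ℝ≥0) (_ : R t ω ≤ -M.p / M.α), (t : ℝ≥0∞)

/-- The time interval `[0, T]` up to ruin (`[0, ∞)` if there is no ruin). -/
def untilRuin (R : ℝ≥0 → Ω → ℝ) (ω : Ω) : Set ℝ :=
  {s | 0 ≤ s ∧ ENNReal.ofReal s ≤ M.ruinTime R ω}

/-- `D` is admissible for the initial reserve `x`, with controlled reserve `R`: a lump sum dividend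
`L_{t+} - L_t` never exceeds the excess of the reserve over the critical value (and is zero if the
reserve is already at or below it). -/
def Admissible [P.IsComplete] (x : ℝ) (D : M.DividendStrategy) (R : ℝ≥0 → Ω → ℝ) : Prop :=
  M.IsReserve x D R ∧
  ∀ᵐ ω ∂P, ∀ t : ℝ≥0, (t : ℝ≥0∞) ≤ M.ruinTime R ω →
    Function.rightLim (D.path ω) t - D.path ω t ≤ max (R t ω + M.p / M.α) 0

/-- Expected discounted dividends until ruin. -/
def returnOf [P.IsComplete] (D : M.DividendStrategy) (R : ℝ≥0 → Ω → ℝ) : ℝ≥0∞ :=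
  ∫⁻ ω, ∫⁻ s in M.untilRuin R ω, ENNReal.ofReal (Real.exp (-M.δ * s)) ∂(D.dL ω) ∂P

/-- The value function, as an extended nonnegative number. -/
def value [P.IsComplete] (x : ℝ) : ℝ≥0∞ :=
  ⨆ (D : M.DividendStrategy) (R : ℝ≥0 → Ω → ℝ) (_ : M.Admissible x D R), M.returnOf D R

/-- The value function, as a real number. -/
def V [P.IsComplete] (x : ℝ) : ℝ := (M.value x).toReal

/-- The operator `𝒢` applied to a function `u`. -/
def G (u : ℝ → ℝ) (x : ℝ) : ℝ :=
  M.drift x - (M.lam + M.δ) * u x +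
    M.lam * ∫ y in Icc 0 (x + M.p / M.α), u (x - y) ∂M.F

/-- The set `𝒜`. -/
def setA [P.IsComplete] : Set ℝ := {x | -M.p / M.α ≤ x ∧ M.G M.V x = 0}

/-- The set `ℬ`. -/
def setB [P.IsComplete] : Set ℝ :=
  {x | -M.p / M.α ≤ x ∧ HasDerivAt M.V 1 x ∧ M.G M.V x < 0}

/-- The set `𝒞`, the complement of `𝒜 ∪ ℬ` in `[-p / α, ∞)`. -/
def setC [P.IsComplete] : Set ℝ := Ici (-M.p / M.α) \ (M.setA ∪ M.setB)

/-- The band rule of the strategy `L*`, up to ruin: while the reserve is in `𝒜` dividends are paid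
at the rate of the incoming premiums and interest; when the reserve is in `ℬ` a lump sum is paid
that moves it to the lower end point of the part of `ℬ` below it; while it is in `𝒞` no dividends
are paid. -/
def FollowsBands [P.IsComplete] (D : M.DividendStrategy) (R : ℝ≥0 → Ω → ℝ) : Prop :=
  ∀ᵐ ω ∂P,
    (D.dL ω).restrict {s | s ∈ M.untilRuin R ω ∧ R s.toNNReal ω ∈ M.setA} =
      (volume.restrict {s | s ∈ M.untilRuin R ω ∧ R s.toNNReal ω ∈ M.setA}).withDensity
        (fun s => ENNReal.ofReal (M.drift (R s.toNNReal ω))) ∧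
    (∀ t : ℝ≥0, (t : ℝ≥0∞) ≤ M.ruinTime R ω → R t ω ∈ M.setB →
      Function.rightLim (D.path ω) t - D.path ω t =
        R t ω - sInf {y | Ioc y (R t ω) ⊆ M.setB}) ∧
    D.dL ω {s | s ∈ M.untilRuin R ω ∧ R s.toNNReal ω ∈ M.setC} = 0

end RiskModel

end

noncomputable section

namespace RiskModel

variable {Ω : Type*} [MeasurableSpace Ω] {P : Measure Ω} (M : RiskModel P)

/-! ### The uncontrolled flow -/

/-! The value function is identified with an analytic object. A supersolution (`IsSuper`) vanishes
up to `crit = -p/α`, has slope at least one above it (so paying at once is no gain), and along the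
uncontrolled flow `E` its value discounted at rate `q = lam + δ`, plus the rewards collected through
claims, does not increase (so waiting is no gain). Since `δ < α`, the explicit function `bound` is a
supersolution. Infima of supersolutions are supersolutions (`isSuper_v`), so there is a smallest
one, `v`; it is finite and continuous.

The bands come from minimality. The two inequalities give `G v ≤ 0` above `crit` (`G_v_nonpos`).
Near a level with `G v < 0`, either paying or waiting must be exactly optimal, since otherwise `v`
could be replaced locally by the larger of the two corresponding values and would not be minimal
(`dichotomy`). Hence `v` is affine of slope one to the left of each point of `ℬ`, waiting is optimal
just after each point of `𝒞`, each component of `ℬ` starts at a point of `𝒜` (`lowerEnd_mem_bandA`),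
and every high level lies in `ℬ` (`bandB_of_lt`).

Verification shows `V = v`. Between two claims, the dividends of an admissible strategy are paid for
by a loss of `v` (`IsPath.value_le`). Reweighting by `exp (lam * u)` turns the rate `q` into the
true discount `δ` at the price of a term `lam * v` (`IsPath.discounted_le`). In expectation that
term is the value just before the next claim, and the claim reward is the value just after it
(`lintegral_claim`), so the losses telescope to at most `v x` (`returnOf_le`). The band path loses
nothing between claims (`restPath_value`), and the remaining discounted value tends to zero because
reserves grow at rate `r < δ`. So the band strategy attains `v x` (`le_returnOf`, `value_eq`), and
the bands of `V` are those of `v`.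

For the negative levels (`bandC_of_neg`): at a point `y < 0` of `𝒜`, comparison of `G v = 0` with `G
v ≤ 0` to its right forces `v` to have slope at least `α / q > 1` there, so waiting would be
strictly profitable, a contradiction. A point of `ℬ` below zero would then have its component reach
down to `crit`, so that `v = x - crit`; this is again incompatible with `α > q`.

Measurability needs separate care, as the reserve is not assumed measurable. Predictability makes
the dividends before the next claim a function of time and the past claims
(`DividendStrategy.exists_path_eq`), and Picard iteration transfers this to the reserve. Conversely
the band strategy depends only on the aggregate claims, not on the unobservable epochs of zero
claims (`bandReserve_congr`), and is therefore predictable. -/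

theorem α_pos : 0 < M.α := M.r_pos.trans M.r_lt_α

theorem δ_pos : 0 < M.δ := M.r_pos.trans M.r_lt_δ

/-- The critical value of the reserve. -/
def crit : ℝ := -M.p / M.α

theorem crit_neg : M.crit < 0 := by
  have := div_pos M.p_pos M.α_pos
  rw [crit, neg_div]; linarith

theorem α_mul_crit : M.α * M.crit = -M.p := by
  have := M.α_pos
  rw [crit]; field_simp

theorem drift_of_nonneg {x : ℝ} (hx : 0 ≤ x) : M.drift x = M.p + M.r * x := by
  simp [drift, hx]

theorem drift_of_neg {x : ℝ} (hx : x < 0) : M.drift x = M.p + M.α * x := by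
  simp [drift, not_le.2 hx]

theorem drift_of_nonpos {x : ℝ} (hx : x ≤ 0) : M.drift x = M.p + M.α * x := by
  rcases hx.lt_or_eq with h | rfl
  · exact M.drift_of_neg h
  · simp [drift]

theorem drift_crit : M.drift M.crit = 0 := by
  rw [M.drift_of_neg M.crit_neg, M.α_mul_crit]; ring

theorem drift_sub_le {x y : ℝ} (h : x ≤ y) :
    M.drift y - M.drift x ≤ M.α * (y - x) := by
  have h1 := M.r_pos; have h2 := M.r_lt_α
  rcases le_or_gt 0 x with hx | hx
  · rw [M.drift_of_nonneg hx, M.drift_of_nonneg (hx.trans h)]; nlinarith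
  · rcases le_or_gt 0 y with hy | hy
    · rw [M.drift_of_nonneg hy, M.drift_of_neg hx]; nlinarith
    · rw [M.drift_of_neg hx, M.drift_of_neg hy]; nlinarith

theorem le_drift_sub {x y : ℝ} (h : x ≤ y) :
    M.r * (y - x) ≤ M.drift y - M.drift x := by
  have h1 := M.r_pos; have h2 := M.r_lt_α
  rcases le_or_gt 0 x with hx | hx
  · rw [M.drift_of_nonneg hx, M.drift_of_nonneg (hx.trans h)]; nlinarith
  · rcases le_or_gt 0 y with hy | hy
    · rw [M.drift_of_nonneg hy, M.drift_of_neg hx]; nlinarith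
    · rw [M.drift_of_neg hx, M.drift_of_neg hy]; nlinarith

theorem drift_strictMono : StrictMono M.drift := fun x y h => by
  have := M.le_drift_sub h.le
  have h2 := mul_pos M.r_pos (sub_pos.2 h)
  linarith

theorem drift_mono : Monotone M.drift := M.drift_strictMono.monotone

theorem abs_drift_sub_le (x y : ℝ) : |M.drift x - M.drift y| ≤ M.α * |x - y| := by
  rcases le_total x y with h | h
  · rw [abs_sub_comm, abs_sub_comm x, abs_of_nonneg (sub_nonneg.2 (M.drift_mono h)),
      abs_of_nonneg (sub_nonneg.2 h)]
    exact M.drift_sub_le h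
  · rw [abs_of_nonneg (sub_nonneg.2 (M.drift_mono h)), abs_of_nonneg (sub_nonneg.2 h)]
    exact M.drift_sub_le h

theorem continuous_drift : Continuous M.drift := by
  refine (LipschitzWith.of_dist_le_mul (K := ⟨M.α, M.α_pos.le⟩) fun x y => ?_).continuous
  exact M.abs_drift_sub_le x y

theorem drift_pos {x : ℝ} (hx : M.crit < x) : 0 < M.drift x := by
  simpa [M.drift_crit] using M.drift_strictMono hx

theorem drift_nonneg {x : ℝ} (hx : M.crit ≤ x) : 0 ≤ M.drift x := by
  simpa [M.drift_crit] using M.drift_mono hx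

/-- The solution of `E' = drift E`, `E 0 = 0`. -/
def E (τ : ℝ) : ℝ :=
  if 0 ≤ τ then M.p / M.r * (Real.exp (M.r * τ) - 1) else M.p / M.α * (Real.exp (M.α * τ) - 1)

/-- The inverse of `E` on `(crit, ∞)`. -/
def H (x : ℝ) : ℝ :=
  if 0 ≤ x then Real.log (1 + M.r * x / M.p) / M.r else Real.log (1 + M.α * x / M.p) / M.α

theorem E_of_nonneg {τ : ℝ} (h : 0 ≤ τ) : M.E τ = M.p / M.r * (Real.exp (M.r * τ) - 1) := by
  simp [E, h]

theorem E_of_nonpos {τ : ℝ} (h : τ ≤ 0) : M.E τ = M.p / M.α * (Real.exp (M.α * τ) - 1) := by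
  rcases h.lt_or_eq with h | rfl
  · simp [E, not_le.2 h]
  · simp [E]

theorem E_zero : M.E 0 = 0 := by simp [E]

theorem E_nonneg {τ : ℝ} (h : 0 ≤ τ) : 0 ≤ M.E τ := by
  rw [M.E_of_nonneg h]
  have h1 := Real.add_one_le_exp (M.r * τ)
  have h2 := mul_nonneg M.r_pos.le h
  exact mul_nonneg (div_pos M.p_pos M.r_pos).le (by linarith)

theorem E_nonpos {τ : ℝ} (h : τ ≤ 0) : M.E τ ≤ 0 := by
  rw [M.E_of_nonpos h]
  have h1 : Real.exp (M.α * τ) ≤ 1 :=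
    Real.exp_le_one_iff.2 (mul_nonpos_of_nonneg_of_nonpos M.α_pos.le h)
  exact mul_nonpos_of_nonneg_of_nonpos (div_pos M.p_pos M.α_pos).le (by linarith)

/-- Each branch solves its own linear equation. At the kink the one-sided derivatives agree because
both branches of `drift` equal `p` at zero. -/
theorem hasDerivAt_E (τ : ℝ) : HasDerivAt M.E (M.drift (M.E τ)) τ := by
  have hr := M.r_pos; have hα := M.α_pos; have hp := M.p_pos
  have key : ∀ (a : ℝ), 0 < a → HasDerivAt (fun τ => M.p / a * (Real.exp (a * τ) - 1))
      (M.p + a * (M.p / a * (Real.exp (a * τ) - 1))) τ := by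
    intro a ha
    have h := (((hasDerivAt_id' τ).const_mul a).exp.sub_const 1).const_mul (M.p / a)
    refine h.congr_deriv ?_
    field_simp; ring
  have h1 : 0 ≤ τ → HasDerivWithinAt M.E (M.drift (M.E τ)) (Ici 0) τ := fun h => by
    rw [M.drift_of_nonneg (M.E_nonneg h), M.E_of_nonneg h]
    exact (key _ hr).hasDerivWithinAt.congr (fun x hx => M.E_of_nonneg hx) (M.E_of_nonneg h)
  have h2 : τ ≤ 0 → HasDerivWithinAt M.E (M.drift (M.E τ)) (Iic 0) τ := fun h => by
    rw [M.drift_of_nonpos (M.E_nonpos h), M.E_of_nonpos h]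
    exact (key _ hα).hasDerivWithinAt.congr (fun x hx => M.E_of_nonpos hx) (M.E_of_nonpos h)
  rcases lt_trichotomy τ 0 with h | rfl | h
  · exact (h2 h.le).hasDerivAt (Iic_mem_nhds h)
  · have := (h2 le_rfl).union (h1 le_rfl)
    rwa [Iic_union_Ici, hasDerivWithinAt_univ] at this
  · exact (h1 h.le).hasDerivAt (Ici_mem_nhds h)

theorem continuous_E : Continuous M.E :=
  continuous_iff_continuousAt.2 fun τ => (M.hasDerivAt_E τ).continuousAt

theorem crit_lt_E (τ : ℝ) : M.crit < M.E τ := by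
  rcases le_total 0 τ with h | h
  · exact M.crit_neg.trans_le (M.E_nonneg h)
  · rw [M.E_of_nonpos h, crit, neg_div]
    have := mul_pos (div_pos M.p_pos M.α_pos) (Real.exp_pos (M.α * τ))
    linarith

theorem E_strictMono : StrictMono M.E :=
  strictMono_of_hasDerivAt_pos (fun τ => M.hasDerivAt_E τ) fun τ => M.drift_pos (M.crit_lt_E τ)

theorem E_mono : Monotone M.E := M.E_strictMono.monotone

theorem E_H {x : ℝ} (hx : M.crit < x) : M.E (M.H x) = x := by
  have hr := M.r_pos; have hα := M.α_pos; have hp := M.p_pos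
  rcases le_or_gt 0 x with h | h
  · have h0 : 0 ≤ M.r * x / M.p := by positivity
    have h1 : 0 ≤ M.H x := by
      rw [H, if_pos h]
      exact div_nonneg (Real.log_nonneg (by linarith)) hr.le
    rw [M.E_of_nonneg h1, H, if_pos h, mul_div_cancel₀ _ hr.ne', Real.exp_log (by linarith)]
    field_simp; ring
  · have hx' : -M.p < M.α * x := by
      rw [← M.α_mul_crit]; exact mul_lt_mul_of_pos_left hx hα
    have h0 : 0 < 1 + M.α * x / M.p := by
      have : -1 < M.α * x / M.p := by rw [lt_div_iff₀ hp]; linarith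
      linarith
    have h2 : M.α * x / M.p ≤ 0 := div_nonpos_of_nonpos_of_nonneg (by nlinarith) hp.le
    have h1 : M.H x ≤ 0 := by
      rw [H, if_neg (not_le.2 h)]
      exact div_nonpos_of_nonpos_of_nonneg (Real.log_nonpos h0.le (by linarith)) hα.le
    rw [M.E_of_nonpos h1, H, if_neg (not_le.2 h), mul_div_cancel₀ _ hα.ne', Real.exp_log h0]
    field_simp; ring

theorem H_E (τ : ℝ) : M.H (M.E τ) = τ := M.E_strictMono.injective (M.E_H (M.crit_lt_E τ))

theorem E_le_iff {x τ : ℝ} (hx : M.crit < x) : M.E τ ≤ x ↔ τ ≤ M.H x := by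
  conv_lhs => rw [← M.E_H hx]
  exact M.E_strictMono.le_iff_le

theorem le_E_iff {x τ : ℝ} (hx : M.crit < x) : x ≤ M.E τ ↔ M.H x ≤ τ := by
  conv_lhs => rw [← M.E_H hx]
  exact M.E_strictMono.le_iff_le

theorem E_lt_iff {x τ : ℝ} (hx : M.crit < x) : M.E τ < x ↔ τ < M.H x := by
  conv_lhs => rw [← M.E_H hx]
  exact M.E_strictMono.lt_iff_lt

theorem H_le_H {x y : ℝ} (hx : M.crit < x) (h : x ≤ y) : M.H x ≤ M.H y := by
  rw [← M.le_E_iff hx, M.E_H (hx.trans_le h)]; exact h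

theorem measurable_H : Measurable M.H := by
  unfold H
  exact Measurable.ite measurableSet_Ici (by fun_prop) (by fun_prop)

end RiskModel

namespace RiskModel

variable {Ω : Type*} [MeasurableSpace Ω] {P : Measure Ω} (M : RiskModel P)

/-! ### Supersolutions -/

/-- The killing rate: claim intensity plus discount rate. -/
def q : ℝ := M.lam + M.δ

theorem q_pos : 0 < M.q := add_pos M.lam_pos M.δ_pos

instance : IsProbabilityMeasure M.F := M.F_prob

theorem ae_F_nonneg : ∀ᵐ z ∂M.F, 0 ≤ z := by
  rw [ae_iff]
  convert M.F_nonneg using 2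
  ext z; simp

/-- The expectation of `u` after a claim. -/
def claimMean (u : ℝ → ℝ) (x : ℝ) : ℝ := ∫ z, u (x - z) ∂M.F

/-- Functions that vanish up to the critical value and grow at least at unit rate above it. -/
structure IsGrowth (u : ℝ → ℝ) : Prop where
  zero : ∀ x ≤ M.crit, u x = 0
  slope : ∀ x y, M.crit ≤ x → x ≤ y → u x + (y - x) ≤ u y

namespace IsGrowth

variable {M} {u w : ℝ → ℝ} (hu : M.IsGrowth u)
include hu

theorem mono : Monotone u := fun x y h => by
  rcases le_total y M.crit with hy | hy
  · rw [hu.zero y hy, hu.zero x (h.trans hy)]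
  · rcases le_total x M.crit with hx | hx
    · have := hu.slope M.crit y le_rfl hy
      rw [hu.zero _ le_rfl] at this
      rw [hu.zero x hx]; linarith
    · have := hu.slope x y hx h
      linarith

theorem nonneg (x : ℝ) : 0 ≤ u x := by
  rcases le_total x M.crit with hx | hx
  · rw [hu.zero x hx]
  · rw [← hu.zero M.crit le_rfl]; exact hu.mono hx

theorem sub_crit_le {x : ℝ} : x - M.crit ≤ u x := by
  rcases le_total x M.crit with hx | hx
  · have := hu.nonneg x; linarith
  · have := hu.slope M.crit x le_rfl hx
    rw [hu.zero _ le_rfl] at this; linarith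

theorem measurable : Measurable u := hu.mono.measurable

theorem integrable (x : ℝ) : Integrable (fun z => u (x - z)) M.F := by
  refine Integrable.of_bound (C := u x)
    (hu.measurable.comp (measurable_const.sub measurable_id)).aestronglyMeasurable ?_
  filter_upwards [M.ae_F_nonneg] with z hz
  rw [Real.norm_of_nonneg (hu.nonneg _)]
  exact hu.mono (by linarith)

theorem claimMean_nonneg (x : ℝ) : 0 ≤ M.claimMean u x :=
  integral_nonneg fun _ => hu.nonneg _

theorem claimMean_le (x : ℝ) : M.claimMean u x ≤ u x := by
  have : ∫ _, u x ∂M.F = u x := by simp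
  rw [← this]
  refine integral_mono_ae (hu.integrable x) (integrable_const _) ?_
  filter_upwards [M.ae_F_nonneg] with z hz
  exact hu.mono (by linarith)

theorem claimMean_mono : Monotone (M.claimMean u) := fun x y h =>
  integral_mono (hu.integrable x) (hu.integrable y) fun z => hu.mono (by simpa using h)

theorem claimMean_le_claimMean (hw : M.IsGrowth w) (h : ∀ x, u x ≤ w x) (x : ℝ) :
    M.claimMean u x ≤ M.claimMean w x :=
  integral_mono (hu.integrable x) (hw.integrable x) fun _ => h _

theorem claimMean_of_le {x : ℝ} (hx : x ≤ M.crit) : M.claimMean u x = 0 :=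
  le_antisymm ((hu.claimMean_le x).trans (hu.zero x hx).le) (hu.claimMean_nonneg x)

/-- The truncation in `G` is harmless: claims are almost surely nonnegative, and those leading below
`crit` contribute zero. -/
theorem claimMean_eq_setIntegral (x : ℝ) :
    ∫ z in Icc 0 (x + M.p / M.α), u (x - z) ∂M.F = M.claimMean u x := by
  rw [claimMean, ← integral_indicator measurableSet_Icc]
  refine integral_congr_ae ?_
  filter_upwards [M.ae_F_nonneg] with z hz
  by_cases h : z ∈ Icc 0 (x + M.p / M.α)
  · rw [indicator_of_mem h]
  · rw [indicator_of_notMem h, hu.zero]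
    have : x + M.p / M.α < z := by
      by_contra hc; exact h ⟨hz, not_lt.1 hc⟩
    rw [crit, neg_div]; linarith

theorem intervalIntegrable (a b : ℝ) :
    IntervalIntegrable (fun s => Real.exp (-M.q * s) * (M.lam * M.claimMean u (M.E s)))
      volume a b := by
  have h : IntervalIntegrable (fun s => M.lam * M.claimMean u (M.E s)) volume a b :=
    ((hu.claimMean_mono.comp M.E_mono).intervalIntegrable).const_mul _
  exact h.continuousOn_mul (by fun_prop)

end IsGrowth

/-- The discounted running reward along the uncontrolled flow. -/
def running (u : ℝ → ℝ) (a b : ℝ) : ℝ :=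
  ∫ s in a..b, Real.exp (-M.q * s) * (M.lam * M.claimMean u (M.E s))

/-- Supersolutions of the dividend problem: they dominate immediate payments and waiting. -/
structure IsSuper (u : ℝ → ℝ) : Prop extends M.IsGrowth u where
  flow : ∀ τ σ, τ ≤ σ →
    Real.exp (-M.q * σ) * u (M.E σ) + M.running u τ σ ≤ Real.exp (-M.q * τ) * u (M.E τ)

theorem IsGrowth.running_add {u : ℝ → ℝ} (hu : M.IsGrowth u) (a b c : ℝ) :
    M.running u a b + M.running u b c = M.running u a c :=
  intervalIntegral.integral_add_adjacent_intervals (hu.intervalIntegrable a b)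
    (hu.intervalIntegrable b c)

theorem IsGrowth.running_nonneg {u : ℝ → ℝ} (hu : M.IsGrowth u) {a b : ℝ} (h : a ≤ b) :
    0 ≤ M.running u a b :=
  intervalIntegral.integral_nonneg h fun _ _ => mul_nonneg (Real.exp_pos _).le
    (mul_nonneg M.lam_pos.le (hu.claimMean_nonneg _))

theorem IsGrowth.running_mono {u w : ℝ → ℝ} (hu : M.IsGrowth u) (hw : M.IsGrowth w)
    (h : ∀ x, u x ≤ w x) {a b : ℝ} (hab : a ≤ b) : M.running u a b ≤ M.running w a b := by
  refine intervalIntegral.integral_mono_on hab (hu.intervalIntegrable a b)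
    (hw.intervalIntegrable a b) fun s _ => ?_
  have := hu.claimMean_le_claimMean hw h (M.E s)
  have h1 := M.lam_pos.le
  gcongr

/-- As `claimMean u ≤ u`, the running reward is at most `K ∫ lam e^{-lam s} ds`, which is exactly
what the survival factor `e^{-lam s}` takes away from `K`. A bound at rate `δ` thus yields the flow
inequality at rate `q`. -/
theorem IsGrowth.flow_of_discounted {u : ℝ → ℝ} (hu : M.IsGrowth u) {τ σ : ℝ} (hτσ : τ ≤ σ)
    (h : ∀ s ∈ Icc τ σ, Real.exp (-M.δ * s) * u (M.E s) ≤ Real.exp (-M.δ * τ) * u (M.E τ)) :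
    Real.exp (-M.q * σ) * u (M.E σ) + M.running u τ σ ≤ Real.exp (-M.q * τ) * u (M.E τ) := by
  set K := Real.exp (-M.δ * τ) * u (M.E τ) with hK
  have hsplit : ∀ s, Real.exp (-M.q * s) = Real.exp (-M.lam * s) * Real.exp (-M.δ * s) := fun s => by
    rw [← Real.exp_add, q]; congr 1; ring
  have hd : ∀ s ∈ uIcc τ σ, HasDerivAt (fun s => -(K * Real.exp (-M.lam * s)))
      (M.lam * Real.exp (-M.lam * s) * K) s := fun s _ => by
    have := ((((hasDerivAt_id' s).const_mul (-M.lam)).exp).const_mul K).neg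
    exact this.congr_deriv (by ring)
  have hint : ∫ s in τ..σ, M.lam * Real.exp (-M.lam * s) * K =
      K * Real.exp (-M.lam * τ) - K * Real.exp (-M.lam * σ) := by
    rw [intervalIntegral.integral_eq_sub_of_hasDerivAt hd
      (Continuous.intervalIntegrable (by fun_prop) _ _)]
    ring
  have hrun : M.running u τ σ ≤ ∫ s in τ..σ, M.lam * Real.exp (-M.lam * s) * K := by
    refine intervalIntegral.integral_mono_on hτσ (hu.intervalIntegrable _ _)
      (Continuous.intervalIntegrable (by fun_prop) _ _) fun s hs => ?_
    have h1 := (mul_le_mul_of_nonneg_left (hu.claimMean_le (M.E s)) (Real.exp_pos (-M.δ * s)).le).trans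
      (h s hs)
    have h2 := mul_le_mul_of_nonneg_left h1 (mul_nonneg M.lam_pos.le (Real.exp_pos (-M.lam * s)).le)
    rw [hsplit]
    calc _ = M.lam * Real.exp (-M.lam * s) * (Real.exp (-M.δ * s) * M.claimMean u (M.E s)) := by ring
      _ ≤ _ := h2
  have h3 := mul_le_mul_of_nonneg_left (h σ ⟨hτσ, le_rfl⟩) (Real.exp_pos (-M.lam * σ)).le
  rw [hsplit σ, hsplit τ]
  have e1 : Real.exp (-M.lam * τ) * Real.exp (-M.δ * τ) * u (M.E τ) = K * Real.exp (-M.lam * τ) := by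
    rw [hK]; ring
  rw [e1, mul_assoc]
  linarith

/-- An explicit supersolution. -/
def bound (x : ℝ) : ℝ :=
  if x ≤ M.crit then 0 else
    if x ≤ 0 then M.p / M.δ * Real.exp (M.δ * M.H x) else M.p / M.δ + x

theorem bound_E_of_nonpos {τ : ℝ} (h : τ ≤ 0) :
    M.bound (M.E τ) = M.p / M.δ * Real.exp (M.δ * τ) := by
  rw [bound, if_neg (not_le.2 (M.crit_lt_E τ)), if_pos (M.E_nonpos h), M.H_E]

theorem bound_E_of_nonneg {τ : ℝ} (h : 0 ≤ τ) : M.bound (M.E τ) = M.p / M.δ + M.E τ := by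
  rcases h.eq_or_lt with rfl | h
  · rw [M.bound_E_of_nonpos le_rfl, M.E_zero]; simp
  · have : 0 < M.E τ := by rw [← M.E_zero]; exact M.E_strictMono h
    rw [bound, if_neg (not_le.2 (M.crit_lt_E τ)), if_neg (not_le.2 this)]

/-- Slope at least one, read in the time parameter. For `τ ≤ 0` the derivative is `p (e^{δτ} -
e^{ατ})`, which is nonnegative since `δ < α`; for `τ ≥ 0` the difference is constant. -/
theorem bound_E_sub_mono (hα : M.δ < M.α) : Monotone fun τ => M.bound (M.E τ) - M.E τ := by
  rw [← monotoneOn_univ, ← Iic_union_Ici (a := (0 : ℝ))]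
  refine MonotoneOn.union_right (c := (0 : ℝ)) ?_ ?_ isGreatest_Iic isLeast_Ici
  · have hd : ∀ τ, HasDerivAt
        (fun τ => M.p / M.δ * Real.exp (M.δ * τ) - M.p / M.α * (Real.exp (M.α * τ) - 1))
        (M.p * (Real.exp (M.δ * τ) - Real.exp (M.α * τ))) τ := fun τ => by
      have h1 := (((hasDerivAt_id' τ).const_mul M.δ).exp).const_mul (M.p / M.δ)
      have h2 := (((hasDerivAt_id' τ).const_mul M.α).exp.sub_const 1).const_mul (M.p / M.α)
      refine (h1.sub h2).congr_deriv ?_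
      have := M.α_pos; have := M.δ_pos
      field_simp
    have : MonotoneOn
        (fun τ => M.p / M.δ * Real.exp (M.δ * τ) - M.p / M.α * (Real.exp (M.α * τ) - 1)) (Iic 0) := by
      refine monotoneOn_of_deriv_nonneg (convex_Iic 0)
        (fun τ _ => (hd τ).continuousAt.continuousWithinAt)
        (fun τ _ => (hd τ).differentiableAt.differentiableWithinAt) fun τ hτ => ?_
      rw [interior_Iic] at hτ
      rw [(hd τ).deriv]
      refine mul_nonneg M.p_pos.le (sub_nonneg.2 (Real.exp_le_exp.2 ?_))
      exact mul_le_mul_of_nonpos_right hα.le (le_of_lt hτ)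
    refine this.congr fun τ hτ => ?_
    show _ = M.bound (M.E τ) - M.E τ
    rw [M.bound_E_of_nonpos hτ, M.E_of_nonpos hτ]
  · intro a ha b hb _
    simp only [M.bound_E_of_nonneg ha, M.bound_E_of_nonneg hb]; linarith

theorem isGrowth_bound (hα : M.δ < M.α) : M.IsGrowth M.bound := by
  refine ⟨fun x hx => by simp [bound, hx], fun x y hx hxy => ?_⟩
  -- `crit` is not in the range of `E`, so slopes starting there are checked by hand, from `p/α ≤
  -- p/δ` and `e^{ατ} ≤ e^{δτ}`.
  rcases hx.eq_or_lt with rfl | hx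
  · rcases hxy.eq_or_lt with rfl | hxy
    · simp
    have h0 : M.bound M.crit = 0 := by simp [bound]
    obtain ⟨τ, rfl⟩ : ∃ τ, M.E τ = y := ⟨_, M.E_H hxy⟩
    have hκ : -M.crit = M.p / M.α := by rw [crit, neg_div, neg_neg]
    have hle : M.p / M.α ≤ M.p / M.δ := div_le_div_of_nonneg_left M.p_pos.le M.δ_pos hα.le
    have hp := div_pos M.p_pos M.α_pos
    rw [h0]
    rcases le_total τ 0 with h | h
    · rw [M.bound_E_of_nonpos h, M.E_of_nonpos h]
      have h2 : Real.exp (M.α * τ) ≤ Real.exp (M.δ * τ) :=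
        Real.exp_le_exp.2 (mul_le_mul_of_nonpos_right hα.le h)
      have h3 := mul_le_mul hle h2 (Real.exp_pos _).le (hp.le.trans hle)
      linarith
    · rw [M.bound_E_of_nonneg h]; linarith
  · obtain ⟨τ, rfl⟩ : ∃ τ, M.E τ = x := ⟨_, M.E_H hx⟩
    obtain ⟨σ, rfl⟩ : ∃ σ, M.E σ = y := ⟨_, M.E_H (hx.trans_le hxy)⟩
    have := M.bound_E_sub_mono hα (M.E_strictMono.le_iff_le.1 hxy)
    simp only at this
    linarith

/-- The derivative has the sign of `p - δ K - (δ - r) E τ`. This decreases in `τ` because `r < δ`,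
so its sign at `a` decides. -/
theorem discounted_affine_antitoneOn {K a : ℝ} (ha : 0 ≤ a)
    (hK : M.p ≤ M.δ * K + (M.δ - M.r) * M.E a) :
    AntitoneOn (fun τ => Real.exp (-M.δ * τ) * (K + M.E τ)) (Ici a) := by
  have hd : ∀ τ, HasDerivAt (fun τ => Real.exp (-M.δ * τ) * (K + M.E τ))
      (Real.exp (-M.δ * τ) * (M.drift (M.E τ) - M.δ * (K + M.E τ))) τ := fun τ => by
    refine ((((hasDerivAt_id' τ).const_mul (-M.δ)).exp).mul
      ((M.hasDerivAt_E τ).const_add K)).congr_deriv ?_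
    ring
  refine antitoneOn_of_deriv_nonpos (convex_Ici a)
    (fun τ _ => (hd τ).continuousAt.continuousWithinAt)
    (fun τ _ => (hd τ).differentiableAt.differentiableWithinAt) fun τ hτ => ?_
  rw [interior_Ici] at hτ
  have hE := M.E_nonneg (ha.trans (le_of_lt hτ))
  have hE' := M.E_mono (le_of_lt hτ)
  rw [(hd τ).deriv]
  refine mul_nonpos_of_nonneg_of_nonpos (Real.exp_pos _).le ?_
  rw [M.drift_of_nonneg hE]
  nlinarith [M.r_lt_δ]

/-- Discounted at rate `δ`, `bound` is constant along the negative part of the flow, which explains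
the exponential in its definition, and it decreases along the positive part. -/
theorem isSuper_bound (hα : M.δ < M.α) : M.IsSuper M.bound := by
  suffices Antitone fun τ => Real.exp (-M.δ * τ) * M.bound (M.E τ) from
    ⟨M.isGrowth_bound hα, fun τ σ h =>
      (M.isGrowth_bound hα).flow_of_discounted M h fun s hs => this hs.1⟩
  rw [← antitoneOn_univ, ← Iic_union_Ici (a := (0 : ℝ))]
  refine AntitoneOn.union_right (c := (0 : ℝ)) ?_ ?_ isGreatest_Iic isLeast_Ici
  · intro a ha b hb _
    simp only [M.bound_E_of_nonpos ha, M.bound_E_of_nonpos hb]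
    have : ∀ c, Real.exp (-M.δ * c) * (M.p / M.δ * Real.exp (M.δ * c)) = M.p / M.δ := fun c => by
      rw [mul_left_comm, ← Real.exp_add]; simp
    rw [this, this]
  · have h := M.discounted_affine_antitoneOn (K := M.p / M.δ) le_rfl
      (by rw [mul_div_cancel₀ _ M.δ_pos.ne', M.E_zero]; simp)
    exact h.congr fun τ hτ => by simp only [M.bound_E_of_nonneg hτ]

/-- The minimal supersolution. -/
def v (x : ℝ) : ℝ := ⨅ u : {u // M.IsSuper u}, u.1 x

variable {M}

theorem IsSuper.v_le {u : ℝ → ℝ} (hu : M.IsSuper u) (x : ℝ) : M.v x ≤ u x :=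
  ciInf_le (f := fun u : {u // M.IsSuper u} => u.1 x)
    ⟨0, by rintro _ ⟨u, rfl⟩; exact u.2.nonneg x⟩ ⟨u, hu⟩

variable (M)

/-- Both conditions survive an infimum: `v ≤ u` holds inside the running reward as well, so the left
side for `v` lies below the right side for every supersolution `u`. -/
theorem isSuper_v (hα : M.δ < M.α) : M.IsSuper M.v := by
  have : Nonempty {u // M.IsSuper u} := ⟨⟨_, M.isSuper_bound hα⟩⟩
  have hg : M.IsGrowth M.v := by
    refine ⟨fun x hx => ?_, fun x y hx hxy => ?_⟩
    · have : ∀ u : {u // M.IsSuper u}, u.1 x = 0 := fun u => u.2.zero x hx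
      simp [v, this]
    · refine le_ciInf fun u => ?_
      have := u.2.slope x y hx hxy
      have := u.2.v_le x
      linarith
  refine ⟨hg, fun τ σ h => ?_⟩
  have key : Real.exp (M.q * τ) * (Real.exp (-M.q * σ) * M.v (M.E σ) + M.running M.v τ σ) ≤
      M.v (M.E τ) := by
    refine le_ciInf fun u => ?_
    have h1 := u.2.flow τ σ h
    have h2 := hg.running_mono M u.2.toIsGrowth u.2.v_le h
    have h3 := mul_le_mul_of_nonneg_left (u.2.v_le (M.E σ)) (Real.exp_pos (-M.q * σ)).le
    have h4 : Real.exp (-M.q * σ) * M.v (M.E σ) + M.running M.v τ σ ≤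
      Real.exp (-M.q * τ) * u.1 (M.E τ) := by linarith
    calc _ ≤ Real.exp (M.q * τ) * (Real.exp (-M.q * τ) * u.1 (M.E τ)) :=
          mul_le_mul_of_nonneg_left h4 (Real.exp_pos _).le
      _ = u.1 (M.E τ) := by rw [← mul_assoc, ← Real.exp_add]; simp
  have h5 := mul_le_mul_of_nonneg_left key (Real.exp_pos (-M.q * τ)).le
  rwa [← mul_assoc, ← Real.exp_add, neg_mul, neg_add_cancel, Real.exp_zero, one_mul,
    ← neg_mul] at h5

theorem isOpenEmbedding_E : IsOpenEmbedding M.E := by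
  have hr : range M.E = Ioi M.crit := by
    ext x; constructor
    · rintro ⟨τ, rfl⟩; exact M.crit_lt_E τ
    · intro hx; exact ⟨_, M.E_H hx⟩
  refine ⟨M.E_strictMono.isEmbedding_of_ordConnected (hr ▸ ordConnected_Ioi), hr ▸ isOpen_Ioi⟩

section

variable (hα : M.δ < M.α)
include hα

theorem v_E_le {τ σ : ℝ} (h : τ ≤ σ) : M.v (M.E σ) ≤ Real.exp (M.q * (σ - τ)) * M.v (M.E τ) := by
  have h1 := (M.isSuper_v hα).flow τ σ h
  have h2 := (M.isSuper_v hα).running_nonneg M h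
  have h3 := mul_le_mul_of_nonneg_left ((le_add_of_nonneg_right h2).trans h1)
    (Real.exp_pos (M.q * σ)).le
  rw [← mul_assoc, ← mul_assoc, ← Real.exp_add, ← Real.exp_add, neg_mul, add_neg_cancel,
    Real.exp_zero, one_mul] at h3
  have e : M.q * (σ - τ) = M.q * σ + -M.q * τ := by ring
  rwa [e]

/-- Along the flow `v` is monotone and grows at most at the exponential rate `q`, which squeezes it
from both sides. -/
theorem continuous_v_E : Continuous fun τ => M.v (M.E τ) := by
  refine continuous_iff_continuousAt.2 fun τ => ?_
  have hv := M.isSuper_v hα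
  have h1 : Tendsto (fun σ => Real.exp (M.q * |σ - τ|) * M.v (M.E τ)) (𝓝 τ) (𝓝 (M.v (M.E τ))) := by
    have : Continuous fun σ => Real.exp (M.q * |σ - τ|) * M.v (M.E τ) := by fun_prop
    simpa using this.tendsto τ
  have h2 : Tendsto (fun σ => Real.exp (-M.q * |σ - τ|) * M.v (M.E τ)) (𝓝 τ) (𝓝 (M.v (M.E τ))) := by
    have : Continuous fun σ => Real.exp (-M.q * |σ - τ|) * M.v (M.E τ) := by fun_prop
    simpa using this.tendsto τ
  have hq := M.q_pos
  have hnn := hv.nonneg (M.E τ)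
  refine tendsto_of_tendsto_of_tendsto_of_le_of_le h2 h1 (fun σ => ?_) fun σ => ?_
  · rcases le_total τ σ with h | h
    · calc _ ≤ 1 * M.v (M.E τ) := by
            gcongr
            exact Real.exp_le_one_iff.2 (by have := abs_nonneg (σ - τ); nlinarith)
        _ ≤ _ := by rw [one_mul]; exact hv.mono (M.E_mono h)
    · have h3 := M.v_E_le hα h
      simp only
      rw [abs_of_nonpos (sub_nonpos.2 h)]
      calc _ ≤ Real.exp (-M.q * -(σ - τ)) * (Real.exp (M.q * (τ - σ)) * M.v (M.E σ)) := by gcongr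
        _ = M.v (M.E σ) := by rw [← mul_assoc, ← Real.exp_add]; ring_nf; simp
  · rcases le_total τ σ with h | h
    · simp only
      rw [abs_of_nonneg (sub_nonneg.2 h)]; exact M.v_E_le hα h
    · calc _ ≤ 1 * M.v (M.E τ) := by rw [one_mul]; exact hv.mono (M.E_mono h)
        _ ≤ _ := by
            gcongr
            exact Real.one_le_exp (by positivity)

theorem v_le_bound (x : ℝ) : M.v x ≤ M.bound x := (M.isSuper_bound hα).v_le x

theorem v_le_affine {x : ℝ} (hx : 0 ≤ x) : M.v x ≤ M.p / M.δ + x := by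
  have h := M.v_le_bound hα x
  rw [← M.E_H (M.crit_neg.trans_le hx)] at h ⊢
  rwa [M.bound_E_of_nonneg] at h
  rw [← M.E_le_iff (M.crit_neg.trans_le hx), M.E_zero]; exact hx

/-- Above `crit` the open embedding `E` transfers continuity from time to level. At `crit` the
function is squeezed by `bound`, which tends to zero because `e^{δτ}` does as `τ → -∞`. -/
theorem continuous_v : Continuous M.v := by
  have hv := M.isSuper_v hα
  refine continuous_iff_continuousAt.2 fun x => ?_
  rcases lt_trichotomy x M.crit with h | rfl | h
  · refine (continuousAt_const (y := (0 : ℝ))).congr ?_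
    filter_upwards [Iio_mem_nhds h] with y hy
    exact (hv.zero y (le_of_lt hy)).symm
  · rw [ContinuousAt, hv.zero _ le_rfl, tendsto_order]
    refine ⟨fun a ha => Eventually.of_forall fun y => ha.trans_le (hv.nonneg y), fun a ha => ?_⟩
    obtain ⟨τ, hτ, hτa⟩ : ∃ τ ≤ (0 : ℝ), M.p / M.δ * Real.exp (M.δ * τ) < a := by
      have : Tendsto (fun τ => M.p / M.δ * Real.exp (M.δ * τ)) atBot (𝓝 (M.p / M.δ * 0)) :=
        (Real.tendsto_exp_atBot.comp (tendsto_id.const_mul_atBot M.δ_pos)).const_mul _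
      rw [mul_zero] at this
      obtain ⟨τ, h1, h2⟩ := ((eventually_le_atBot 0).and (this.eventually_lt_const ha)).exists
      exact ⟨τ, h1, h2⟩
    filter_upwards [Iio_mem_nhds (M.crit_lt_E τ)] with y hy
    refine (hv.mono (le_of_lt hy)).trans_lt ((M.v_le_bound hα _).trans_lt ?_)
    rwa [M.bound_E_of_nonpos hτ]
  · rw [← M.E_H h, ← M.isOpenEmbedding_E.continuousAt_iff]
    exact (M.continuous_v_E hα).continuousAt

theorem continuous_claimMean : Continuous (M.claimMean M.v) := by
  have hv := (M.isSuper_v hα).toIsGrowth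
  refine continuous_iff_continuousAt.2 fun x => ?_
  refine continuousAt_of_dominated (bound := fun _ => M.v (x + 1)) ?_ ?_ (integrable_const _) ?_
  · exact Eventually.of_forall fun y => (hv.integrable y).aestronglyMeasurable
  · filter_upwards [Iio_mem_nhds (lt_add_one x)] with y hy
    filter_upwards [M.ae_F_nonneg] with z hz
    rw [Real.norm_of_nonneg (hv.nonneg _)]
    exact hv.mono (by have : y < x + 1 := hy; linarith)
  · refine Eventually.of_forall fun z => ?_
    exact ((M.continuous_v hα).comp (continuous_id.sub continuous_const)).continuousAt

theorem G_v (x : ℝ) : M.G M.v x = M.drift x - M.q * M.v x + M.lam * M.claimMean M.v x := by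
  rw [G, (M.isSuper_v hα).claimMean_eq_setIntegral, q]

theorem continuous_G_v : Continuous (M.G M.v) := by
  have h1 := M.continuous_v hα
  have h2 := M.continuous_claimMean hα
  have h3 := M.continuous_drift
  rw [show M.G M.v = fun x => M.drift x - M.q * M.v x + M.lam * M.claimMean M.v x from
    funext (M.G_v hα)]
  fun_prop

end

end RiskModel

namespace RiskModel

variable {Ω : Type*} [MeasurableSpace Ω] {P : Measure Ω} (M : RiskModel P)

/-! ### Local analysis of the minimal supersolution -/

/-- The discounted value along the uncontrolled flow plus the rewards collected on the way. -/
def flowValue (τ : ℝ) : ℝ := Real.exp (-M.q * τ) * M.v (M.E τ) + M.running M.v 0 τ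

theorem _root_.HasDerivAt.nonpos_of_eventually_le {f : ℝ → ℝ} {f' a : ℝ} (hf : HasDerivAt f f' a)
    (h : ∀ᶠ x in 𝓝[>] a, f x ≤ f a) : f' ≤ 0 := by
  have h1 := (hasDerivWithinAt_iff_tendsto_slope' (s := Ioi a) (by simp)).1
    hf.hasDerivWithinAt
  refine le_of_tendsto h1 ?_
  filter_upwards [self_mem_nhdsWithin, h] with x hx hxa
  rw [slope_def_field]
  exact div_nonpos_of_nonpos_of_nonneg (sub_nonpos.2 hxa)
    (sub_nonneg.2 (le_of_lt hx))

section

variable (hα : M.δ < M.α)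
include hα

theorem flowValue_antitone : Antitone M.flowValue := fun τ σ h => by
  have hv := M.isSuper_v hα
  have h1 := hv.flow τ σ h
  have h2 := hv.running_add M 0 τ σ
  simp only [flowValue]; linarith

theorem hasDerivAt_running (τ : ℝ) : HasDerivAt (M.running M.v 0)
    (Real.exp (-M.q * τ) * (M.lam * M.claimMean M.v (M.E τ))) τ := by
  have h1 := (M.continuous_claimMean hα).comp M.continuous_E
  have h2 : Continuous fun s => Real.exp (-M.q * s) * (M.lam * M.claimMean M.v (M.E s)) := by
    have : Continuous fun s => M.claimMean M.v (M.E s) := h1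
    fun_prop
  exact (h2.integral_hasStrictDerivAt 0 τ).hasDerivAt

/-- The derivative of the flow value when the first summand is replaced by a function with known
derivative. -/
theorem hasDerivAt_flow {f : ℝ → ℝ} {f' τ : ℝ} (hf : HasDerivAt f f' τ) :
    HasDerivAt (fun σ => Real.exp (-M.q * σ) * f σ + M.running M.v 0 σ)
      (Real.exp (-M.q * τ) * (f' - M.q * f τ + M.lam * M.claimMean M.v (M.E τ))) τ := by
  refine (((((hasDerivAt_id' τ).const_mul (-M.q)).exp).mul hf).add
    (M.hasDerivAt_running hα τ)).congr_deriv ?_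
  ring

/-- Replacing `v` by the line of slope one through its value at `E τ` gives a curve below
`flowValue` to the right of `τ`, touching it at `τ`. As `flowValue` decreases, the derivative of
that curve at `τ`, which is `e^{-qτ} G v`, cannot be positive. -/
theorem G_v_nonpos {x : ℝ} (hx : M.crit ≤ x) : M.G M.v x ≤ 0 := by
  have hv := M.isSuper_v hα
  rcases hx.eq_or_lt with rfl | hx
  · rw [M.G_v hα, M.drift_crit, hv.zero _ le_rfl, hv.claimMean_of_le le_rfl]; simp
  obtain ⟨τ, rfl⟩ : ∃ τ, M.E τ = x := ⟨_, M.E_H hx⟩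
  have hd := M.hasDerivAt_flow hα (((M.hasDerivAt_E τ).sub_const (M.E τ)).const_add (M.v (M.E τ)))
  have h := hd.nonpos_of_eventually_le <| by
    filter_upwards [self_mem_nhdsWithin] with σ hσ
    replace hσ : τ ≤ σ := le_of_lt hσ
    have h1 := hv.slope _ _ (M.crit_lt_E τ).le (M.E_mono hσ)
    have h2 := M.flowValue_antitone hα hσ
    simp only [flowValue] at h2
    have h3 := mul_le_mul_of_nonneg_left h1 (Real.exp_pos (-M.q * σ)).le
    simp only [sub_self, add_zero]
    linarith
  rw [M.G_v hα]
  have := nonpos_of_mul_nonpos_right h (Real.exp_pos _)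
  simp only [sub_self, add_zero] at this
  linarith

theorem G_v_crit : M.G M.v M.crit = 0 := by
  have hv := M.isSuper_v hα
  rw [M.G_v hα, M.drift_crit, hv.zero _ le_rfl, hv.claimMean_of_le le_rfl]; simp

/-- With right slope one, the right derivative of `flowValue` is `e^{-qτ} G v`; if waiting is
optimal it is zero. So a level where both actions are optimal belongs to `𝒜`. -/
theorem G_v_eq_zero_of_const {τ σ : ℝ} (hτσ : τ < σ)
    (hd : HasDerivWithinAt M.v 1 (Ici (M.E τ)) (M.E τ))
    (hN : ∀ s ∈ Icc τ σ, M.flowValue s = M.flowValue τ) : M.G M.v (M.E τ) = 0 := by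
  have h1 : HasDerivWithinAt (fun s => M.v (M.E s)) (1 * M.drift (M.E τ)) (Ici τ) τ :=
    hd.comp τ (M.hasDerivAt_E τ).hasDerivWithinAt fun s hs => M.E_mono hs
  have h2 : HasDerivWithinAt M.flowValue
      (Real.exp (-M.q * τ) * M.G M.v (M.E τ)) (Ici τ) τ := by
    refine ((((((hasDerivAt_id' τ).const_mul (-M.q)).exp).hasDerivWithinAt).mul h1).add
      (M.hasDerivAt_running hα τ).hasDerivWithinAt).congr_deriv ?_
    rw [M.G_v hα]; ring
  have h3 : HasDerivWithinAt M.flowValue 0 (Ici τ) τ := by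
    refine (hasDerivWithinAt_const τ (Ici τ) (M.flowValue τ)).congr_of_eventuallyEq ?_ rfl
    filter_upwards [Icc_mem_nhdsGE hτσ] with s hs using hN s hs
  have h4 := (uniqueDiffWithinAt_Ici τ).eq_deriv _ h2 h3
  exact (mul_eq_zero.1 h4).resolve_left (Real.exp_pos _).ne'

/-- Minimality of `v`. If at an interior time neither paying down to `E τ₁` nor waiting until `τ₂`
reproduces `v`, then `v` is replaced between these levels by the maximum of the two values. The
margin in `G v < 0` makes this a supersolution on a short window, although it lies strictly below
`v` at `E τ`. -/
theorem dichotomy {τ₀ : ℝ} (hG : M.G M.v (M.E τ₀) < 0) :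
    ∃ ε > 0, ∀ τ₁ τ τ₂, τ₀ - ε ≤ τ₁ → τ₁ < τ → τ < τ₂ → τ₂ ≤ τ₀ + ε →
      M.v (M.E τ) = M.v (M.E τ₁) + (M.E τ - M.E τ₁) ∨ M.flowValue τ = M.flowValue τ₂ := by
  have hv := M.isSuper_v hα
  have hq := M.q_pos
  have cvE := M.continuous_v_E hα
  set η := -M.G M.v (M.E τ₀) / 2 with hη
  have hη0 : 0 < η := by rw [hη]; linarith
  have cG : Continuous fun σ => M.G M.v (M.E σ) := (M.continuous_G_v hα).comp M.continuous_E
  obtain ⟨ε₁, hε₁, hball⟩ := Metric.eventually_nhds_iff.1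
    (cG.continuousAt.eventually_lt_const (show M.G M.v (M.E τ₀) < -η by rw [hη]; linarith))
  -- The margin `η` absorbs two errors: `ev2` controls the oscillation of `v` on the window, needed
  -- for the paying value `m`, and `ev3` the gap between `v` and the waiting value `k`.
  have ev2 : ∀ᶠ ε in 𝓝 (0 : ℝ), M.q * (M.v (M.E (τ₀ + ε)) - M.v (M.E (τ₀ - ε))) < η := by
    have : Continuous fun ε => M.q * (M.v (M.E (τ₀ + ε)) - M.v (M.E (τ₀ - ε))) := by
      have a : Continuous fun ε => M.v (M.E (τ₀ + ε)) := cvE.comp (by fun_prop)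
      have b : Continuous fun ε => M.v (M.E (τ₀ - ε)) := cvE.comp (by fun_prop)
      fun_prop
    exact this.continuousAt.eventually_lt_const (by simpa using hη0)
  have ev3 : ∀ᶠ ε in 𝓝 (0 : ℝ), M.q * ((1 - Real.exp (-M.q * (2 * ε))) * M.v (M.E (τ₀ + ε))) < η := by
    have : Continuous fun ε => M.q * ((1 - Real.exp (-M.q * (2 * ε))) * M.v (M.E (τ₀ + ε))) := by
      have a : Continuous fun ε => M.v (M.E (τ₀ + ε)) := cvE.comp (by fun_prop)
      fun_prop
    exact this.continuousAt.eventually_lt_const (by simpa using hη0)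
  obtain ⟨ε, ⟨hεm, h2, h3⟩⟩ := (Eventually.and (Ioo_mem_nhdsGT hε₁)
    ((ev2.filter_mono nhdsWithin_le_nhds).and (ev3.filter_mono nhdsWithin_le_nhds))).exists
  refine ⟨ε, hεm.1, fun τ₁ τ τ₂ hτ₁ h1τ hτ2 hτ₂ => ?_⟩
  have h12 : τ₁ < τ₂ := h1τ.trans hτ2
  have hGJ : ∀ σ ∈ Icc τ₁ τ₂, M.G M.v (M.E σ) < -η := fun σ hσ => hball (by
    rw [Real.dist_eq, abs_lt]; constructor <;> linarith [hσ.1, hσ.2, hεm.2])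
  have hvJ : ∀ σ ∈ Icc τ₁ τ₂, M.v (M.E σ) ≤ M.v (M.E (τ₀ + ε)) := fun σ hσ =>
    hv.mono (M.E_mono (hσ.2.trans hτ₂))
  by_contra! hcon
  obtain ⟨hne1, hne2⟩ := hcon
  set N := M.flowValue τ₂ with hN
  -- the value obtained by waiting until `E τ₂`, and by paying immediately down to `E τ₁`
  set k : ℝ → ℝ := fun σ => Real.exp (M.q * σ) * (N - M.running M.v 0 σ) with hk
  set m : ℝ → ℝ := fun σ => M.v (M.E τ₁) + (M.E σ - M.E τ₁) with hm
  have hkN : ∀ σ, Real.exp (-M.q * σ) * k σ + M.running M.v 0 σ = N := fun σ => by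
    simp only [hk]
    rw [← mul_assoc, ← Real.exp_add]; simp
  have hkv_iff : ∀ σ, N ≤ M.flowValue σ → k σ ≤ M.v (M.E σ) := fun σ h => by
    have h1 := hkN σ
    rw [flowValue] at h
    exact le_of_mul_le_mul_left (by linarith) (Real.exp_pos (-M.q * σ))
  have hkv : ∀ σ ∈ Icc τ₁ τ₂, k σ ≤ M.v (M.E σ) := fun σ hσ =>
    hkv_iff σ (M.flowValue_antitone hα hσ.2)
  have hmv : ∀ σ ∈ Icc τ₁ τ₂, m σ ≤ M.v (M.E σ) := fun σ hσ =>
    hv.slope _ _ (M.crit_lt_E _).le (M.E_mono hσ.1)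
  have hk2 : k τ₂ = M.v (M.E τ₂) := by
    have h1 := hkN τ₂
    rw [hN, flowValue] at h1
    exact mul_left_cancel₀ (Real.exp_pos (-M.q * τ₂)).ne' (by linarith)
  have hm1 : m τ₁ = M.v (M.E τ₁) := by simp [hm]
  have hmτ : m τ < M.v (M.E τ) := lt_of_le_of_ne (hmv τ ⟨h1τ.le, hτ2.le⟩) hne1.symm
  have hkτ : k τ < M.v (M.E τ) := by
    refine lt_of_le_of_ne (hkv τ ⟨h1τ.le, hτ2.le⟩) fun h => hne2 ?_
    rw [flowValue, ← h, hkN]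
  -- slopes
  have hkd : ∀ σ, HasDerivAt k (M.q * k σ - M.lam * M.claimMean M.v (M.E σ)) σ := fun σ => by
    refine ((((hasDerivAt_id' σ).const_mul M.q).exp).mul
      ((M.hasDerivAt_running hα σ).const_sub N)).congr_deriv ?_
    have : Real.exp (M.q * σ) * Real.exp (-M.q * σ) = 1 := by rw [← Real.exp_add]; simp
    simp only [hk]
    linear_combination (-(M.lam * M.claimMean M.v (M.E σ))) * this
  have hklow : ∀ σ ∈ Icc τ₁ τ₂, M.q * (M.v (M.E σ) - k σ) ≤ η := fun σ hσ => by
    have h4 : Real.exp (-M.q * (2 * ε)) * M.v (M.E σ) ≤ k σ := by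
      have e1 : M.v (M.E σ) ≤ M.v (M.E τ₂) := hv.mono (M.E_mono hσ.2)
      have e2 := hkN σ
      have e3 := hv.running_add M 0 σ τ₂
      have e4 := hv.running_nonneg M hσ.2
      rw [hN, flowValue, ← e3] at e2
      have e5 : Real.exp (-M.q * τ₂) * M.v (M.E σ) ≤ Real.exp (-M.q * σ) * k σ := by
        have := mul_le_mul_of_nonneg_left e1 (Real.exp_pos (-M.q * τ₂)).le
        linarith
      have e6 : Real.exp (-M.q * σ) * (Real.exp (-M.q * (2 * ε)) * M.v (M.E σ)) ≤
          Real.exp (-M.q * τ₂) * M.v (M.E σ) := by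
        rw [← mul_assoc, ← Real.exp_add]
        refine mul_le_mul_of_nonneg_right (Real.exp_le_exp.2 ?_) (hv.nonneg _)
        nlinarith [hσ.1]
      exact le_of_mul_le_mul_left (e6.trans e5) (Real.exp_pos (-M.q * σ))
    have h5 : (1 - Real.exp (-M.q * (2 * ε))) * M.v (M.E σ) ≤
        (1 - Real.exp (-M.q * (2 * ε))) * M.v (M.E (τ₀ + ε)) := by
      refine mul_le_mul_of_nonneg_left (hvJ σ hσ) (sub_nonneg.2 (Real.exp_le_one_iff.2 ?_))
      nlinarith [hεm.1]
    have h6 : M.v (M.E σ) - k σ ≤ (1 - Real.exp (-M.q * (2 * ε))) * M.v (M.E (τ₀ + ε)) := by linarith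
    exact (mul_le_mul_of_nonneg_left h6 hq.le).trans h3.le
  -- The growth condition for the waiting value: the derivative is `-G v - q (v - k) ≥ η - η`.
  have hkE : MonotoneOn (fun σ => k σ - M.E σ) (Icc τ₁ τ₂) := by
    have hd : ∀ σ, HasDerivAt (fun σ => k σ - M.E σ)
        (M.q * k σ - M.lam * M.claimMean M.v (M.E σ) - M.drift (M.E σ)) σ := fun σ =>
      (hkd σ).sub (M.hasDerivAt_E σ)
    refine monotoneOn_of_deriv_nonneg (convex_Icc _ _)
      (fun σ _ => (hd σ).continuousAt.continuousWithinAt)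
      (fun σ _ => (hd σ).differentiableAt.differentiableWithinAt) fun σ hσ => ?_
    have hσ := interior_subset hσ
    rw [(hd σ).deriv]
    have e1 := hGJ σ hσ
    have e2 := hklow σ hσ
    rw [M.G_v hα] at e1
    linarith
  -- The flow condition for the paying value: up to a positive factor the derivative is `G v + q (v
  -- - m) ≤ -η + η`.
  have hNm : AntitoneOn (fun σ => Real.exp (-M.q * σ) * m σ + M.running M.v 0 σ) (Icc τ₁ τ₂) := by
    have hd : ∀ σ, HasDerivAt (fun σ => Real.exp (-M.q * σ) * m σ + M.running M.v 0 σ) _ σ :=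
      fun σ => M.hasDerivAt_flow hα (((M.hasDerivAt_E σ).sub_const (M.E τ₁)).const_add (M.v (M.E τ₁)))
    refine antitoneOn_of_deriv_nonpos (convex_Icc _ _)
      (fun σ _ => (hd σ).continuousAt.continuousWithinAt)
      (fun σ _ => (hd σ).differentiableAt.differentiableWithinAt) fun σ hσ => ?_
    have hσ := interior_subset hσ
    rw [(hd σ).deriv]
    refine mul_nonpos_of_nonneg_of_nonpos (Real.exp_pos _).le ?_
    have e1 := hGJ σ hσ
    rw [M.G_v hα] at e1
    have e2 := hvJ σ hσ
    have e3 : M.v (M.E (τ₀ - ε)) ≤ M.v (M.E τ₁) := hv.mono (M.E_mono hτ₁)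
    have e4 := M.E_mono hσ.1
    have e5 : M.q * (M.v (M.E σ) - (M.v (M.E τ₁) + (M.E σ - M.E τ₁))) ≤
      M.q * (M.v (M.E (τ₀ + ε)) - M.v (M.E (τ₀ - ε))) := by gcongr ?_ * ?_; linarith
    linarith
  -- the lowered function
  set u : ℝ → ℝ := fun x => if M.E τ₁ < x ∧ x ≤ M.E τ₂ then max (k (M.H x)) (m (M.H x)) else M.v x
    with hu
  have uJ : ∀ σ ∈ Icc τ₁ τ₂, u (M.E σ) = max (k σ) (m σ) := fun σ hσ => by
    rcases hσ.1.eq_or_lt with rfl | h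
    · simp only [hu, lt_irrefl, false_and, if_false]
      rw [hm1, max_eq_right (hkv _ hσ)]
    · simp only [hu]
      rw [if_pos ⟨M.E_strictMono h, M.E_mono hσ.2⟩, M.H_E]
  have uL : ∀ x ≤ M.E τ₁, u x = M.v x := fun x hx => by
    simp only [hu]; rw [if_neg fun h => absurd h.1 (not_lt.2 hx)]
  have uR : ∀ x, M.E τ₂ ≤ x → u x = M.v x := fun x hx => by
    rcases hx.eq_or_lt with rfl | h
    · rw [uJ _ ⟨h12.le, le_rfl⟩, hk2, max_eq_left (hmv _ ⟨h12.le, le_rfl⟩)]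
    · simp only [hu]; rw [if_neg fun h' => absurd h (not_lt.2 h'.2)]
  have uv : ∀ x, u x ≤ M.v x := fun x => by
    by_cases h : M.E τ₁ < x ∧ x ≤ M.E τ₂
    · have hx := (M.crit_lt_E τ₁).trans h.1
      have hJ : M.H x ∈ Icc τ₁ τ₂ := ⟨((M.E_lt_iff hx).1 h.1).le, (M.le_E_iff hx).1 h.2⟩
      have := max_le (hkv _ hJ) (hmv _ hJ)
      rw [← uJ _ hJ, M.E_H hx] at this
      exact this
    · simp only [hu]; rw [if_neg h]
  have ug : M.IsGrowth u := by
    refine ⟨fun x hx => by rw [uL x (hx.trans (M.crit_lt_E _).le), hv.zero x hx], ?_⟩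
    have hmon : MonotoneOn (fun x => u x - x) (Ici M.crit) := by
      have hS : Ici M.crit = Icc M.crit (M.E τ₁) ∪ (Icc (M.E τ₁) (M.E τ₂) ∪ Ici (M.E τ₂)) := by
        rw [Icc_union_Ici_eq_Ici (M.E_mono h12.le), Icc_union_Ici_eq_Ici (M.crit_lt_E _).le]
      rw [hS]
      have hvm : ∀ s, s ⊆ Ici M.crit → (∀ x ∈ s, u x = M.v x) → MonotoneOn (fun x => u x - x) s :=
        fun s hs h x hx y hy hxy => by
          simp only [h x hx, h y hy]
          have := hv.slope x y (hs hx) hxy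
          linarith
      refine MonotoneOn.union_right (c := M.E τ₁) (hvm _ Icc_subset_Ici_self fun x hx => uL x hx.2)
        (MonotoneOn.union_right (c := M.E τ₂) ?_
          (hvm _ (Ici_subset_Ici.2 (M.crit_lt_E _).le) fun x hx => uR x hx)
          (isGreatest_Icc (M.E_mono h12.le)) isLeast_Ici)
        (isGreatest_Icc (M.crit_lt_E _).le) ?_
      · intro x hx y hy hxy
        have hx0 := (M.crit_lt_E τ₁).trans_le hx.1
        have hy0 := (M.crit_lt_E τ₁).trans_le hy.1
        have hJx : M.H x ∈ Icc τ₁ τ₂ := ⟨(M.E_le_iff hx0).1 hx.1, (M.le_E_iff hx0).1 hx.2⟩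
        have hJy : M.H y ∈ Icc τ₁ τ₂ := ⟨(M.E_le_iff hy0).1 hy.1, (M.le_E_iff hy0).1 hy.2⟩
        have h4 := hkE hJx hJy (M.H_le_H hx0 hxy)
        have h5 := uJ _ hJx
        have h6 := uJ _ hJy
        simp only [hm, M.E_H hx0, M.E_H hy0] at h4 h5 h6
        simp only [h5, h6]
        rw [← max_sub_sub_right, ← max_sub_sub_right]
        exact max_le_max h4 (by linarith)
      · exact ⟨Or.inl ⟨le_rfl, M.E_mono h12.le⟩, fun x hx => hx.elim (fun h => h.1)
          fun h => (M.E_mono h12.le).trans h⟩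
    intro x y hx hxy
    have := hmon hx (le_trans hx hxy : M.crit ≤ y) hxy
    simp only at this; linarith
  have us : M.IsSuper u := by
    refine ⟨ug, ?_⟩
    have hant : Antitone fun σ => Real.exp (-M.q * σ) * u (M.E σ) + M.running M.v 0 σ := by
      rw [← antitoneOn_univ]
      have hS : univ = Iic τ₁ ∪ (Icc τ₁ τ₂ ∪ Ici τ₂) := by
        rw [Icc_union_Ici_eq_Ici h12.le, Iic_union_Ici]
      rw [hS]
      have hva : ∀ s, (∀ σ ∈ s, u (M.E σ) = M.v (M.E σ)) →
          AntitoneOn (fun σ => Real.exp (-M.q * σ) * u (M.E σ) + M.running M.v 0 σ) s :=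
        fun s h => ((M.flowValue_antitone hα).antitoneOn s).congr fun σ hσ => by
          simp only [h σ hσ, flowValue]
      refine AntitoneOn.union_right (c := τ₁) (hva _ fun σ hσ => uL _ (M.E_mono hσ))
        (AntitoneOn.union_right (c := τ₂) ?_ (hva _ fun σ hσ => uR _ (M.E_mono hσ))
          (isGreatest_Icc h12.le) isLeast_Ici) isGreatest_Iic
        ⟨Or.inl ⟨le_rfl, h12.le⟩, fun x hx => hx.elim (fun h => h.1) fun h => h12.le.trans h⟩
      intro a ha b hb hab
      -- The waiting value contributes the constant `N`, so the functional is the maximum of a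
      -- constant and a decreasing function.
      have hform : ∀ σ ∈ Icc τ₁ τ₂, Real.exp (-M.q * σ) * u (M.E σ) + M.running M.v 0 σ =
          max N (Real.exp (-M.q * σ) * m σ + M.running M.v 0 σ) := fun σ hσ => by
        rw [uJ σ hσ, mul_max_of_nonneg _ _ (Real.exp_pos _).le, ← max_add_add_right, hkN]
      simp only [hform a ha, hform b hb]
      exact max_le_max le_rfl (hNm ha hb hab)
    intro a b hab
    have e1 := hant hab
    have e2 := hv.running_add M 0 a b
    -- Monotonicity was shown with the rewards of `v`; the smaller rewards of `u` only help.
    have e3 := ug.running_mono M hv.toIsGrowth uv hab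
    simp only at e1; linarith
  have := us.v_le (M.E τ)
  rw [uJ τ ⟨h1τ.le, hτ2.le⟩] at this
  exact absurd this (not_le.2 (max_lt hkτ hmτ))

end

end RiskModel

namespace RiskModel

variable {Ω : Type*} [MeasurableSpace Ω] {P : Measure Ω} (M : RiskModel P)

/-! ### The bands of the minimal supersolution -/

/-- The set `𝒜` of the minimal supersolution. -/
def bandA : Set ℝ := {x | M.crit ≤ x ∧ M.G M.v x = 0}

/-- The set `ℬ` of the minimal supersolution. -/
def bandB : Set ℝ := {x | M.crit ≤ x ∧ HasDerivAt M.v 1 x ∧ M.G M.v x < 0}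

/-- The set `𝒞` of the minimal supersolution. -/
def bandC : Set ℝ := Ici M.crit \ (M.bandA ∪ M.bandB)

theorem notMem_bandA_of_bandB {x : ℝ} (hx : x ∈ M.bandB) : x ∉ M.bandA := fun h =>
  hx.2.2.ne h.2

/-- The lower end of the component of `ℬ` below `x`. -/
def lowerEnd (x : ℝ) : ℝ := sInf {y | Ioc y x ⊆ M.bandB}

section

variable (hα : M.δ < M.α)
include hα

theorem crit_mem_bandA : M.crit ∈ M.bandA := ⟨le_rfl, M.G_v_crit hα⟩

theorem isClosed_bandA : IsClosed M.bandA :=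
  isClosed_Ici.inter (isClosed_singleton.preimage (M.continuous_G_v hα))

theorem crit_lt_of_G_neg {x : ℝ} (hx : M.crit ≤ x) (h : M.G M.v x < 0) : M.crit < x := by
  refine hx.lt_of_ne ?_
  rintro rfl
  exact h.ne (M.G_v_crit hα)

theorem crit_lt_of_mem_bandB {x : ℝ} (hx : x ∈ M.bandB) : M.crit < x :=
  M.crit_lt_of_G_neg hα hx.1 hx.2.2

theorem mem_bandC_iff {x : ℝ} :
    x ∈ M.bandC ↔ M.crit < x ∧ M.G M.v x < 0 ∧ ¬ HasDerivAt M.v 1 x := by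
  constructor
  · rintro ⟨hx, h⟩
    have hx' : M.crit ≤ x := hx
    have h1 : M.G M.v x < 0 :=
      (M.G_v_nonpos hα hx').lt_of_ne fun h0 => h (Or.inl ⟨hx', h0⟩)
    exact ⟨M.crit_lt_of_G_neg hα hx' h1, h1, fun hd => h (Or.inr ⟨hx', hd, h1⟩)⟩
  · rintro ⟨h1, h2, h3⟩
    refine ⟨h1.le, ?_⟩
    rintro (h | h)
    · exact h2.ne h.2
    · exact h3 h.2.1

theorem v_affine_of_affine {a b : ℝ} (ha : M.crit ≤ a) (h : M.v b = M.v a + (b - a)) {x : ℝ}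
    (hx : x ∈ Icc a b) : M.v x = M.v a + (x - a) := by
  have hv := M.isSuper_v hα
  have h1 := hv.slope a x ha hx.1
  have h2 := hv.slope x b (ha.trans hx.1) hx.2
  linarith

theorem hasDerivAt_v_of_affine {a b : ℝ} (ha : M.crit ≤ a) (h : M.v b = M.v a + (b - a)) {x : ℝ}
    (hx : x ∈ Ioo a b) : HasDerivAt M.v 1 x := by
  refine (((hasDerivAt_id' x).sub_const a).const_add (M.v a)).congr_of_eventuallyEq ?_
  filter_upwards [Ioo_mem_nhds hx.1 hx.2] with y hy
  exact M.v_affine_of_affine hα ha h ⟨hy.1.le, hy.2.le⟩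

theorem continuous_flowValue : Continuous M.flowValue := by
  refine (Continuous.mul (by fun_prop) (M.continuous_v_E hα)).add ?_
  exact continuous_iff_continuousAt.2 fun τ => (M.hasDerivAt_running hα τ).continuousAt

/-- At a point of `ℬ` optimal waiting is excluded, as together with slope one it would give `G v =
0`. By `dichotomy`, `v` is then affine of slope one on an interval to the left. -/
theorem exists_Ioc_subset_bandB {x : ℝ} (hx : x ∈ M.bandB) :
    ∃ y < x, M.crit ≤ y ∧ Ioc y x ⊆ M.bandB := by
  have hcx := M.crit_lt_of_mem_bandB hα hx
  obtain ⟨τ, rfl⟩ : ∃ τ, M.E τ = x := ⟨_, M.E_H hcx⟩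
  obtain ⟨ε, hε, h⟩ := M.dichotomy hα hx.2.2
  have haff : M.v (M.E τ) = M.v (M.E (τ - ε)) + (M.E τ - M.E (τ - ε)) := by
    refine (h (τ - ε) τ (τ + ε) le_rfl (by linarith) (by linarith) le_rfl).resolve_right fun hN => ?_
    refine hx.2.2.ne (M.G_v_eq_zero_of_const hα (σ := τ + ε) (by linarith) hx.2.1.hasDerivWithinAt
      fun s hs => le_antisymm (M.flowValue_antitone hα hs.1) ?_)
    rw [hN]; exact M.flowValue_antitone hα hs.2
  have hlt : M.E (τ - ε) < M.E τ := M.E_strictMono (by linarith)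
  obtain ⟨l, hl, hlG⟩ := exists_Ioc_subset_of_mem_nhds
    ((M.continuous_G_v hα).continuousAt.eventually_lt_const hx.2.2) ⟨_, hlt⟩
  refine ⟨max l (M.E (τ - ε)), max_lt hl hlt, (M.crit_lt_E _).le.trans (le_max_right _ _),
    fun z hz => ?_⟩
  have hz1 := (le_max_right _ _).trans_lt hz.1
  refine ⟨((M.crit_lt_E _).trans hz1).le, ?_, hlG ⟨(le_max_left _ _).trans_lt hz.1, hz.2⟩⟩
  rcases hz.2.eq_or_lt with rfl | hz2
  · exact hx.2.1
  · exact M.hasDerivAt_v_of_affine hα (M.crit_lt_E _).le haff ⟨hz1, hz2⟩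

/-- If paying were optimal at some later time of the window, `v` would be affine of slope one on
both sides of `x`, and `x` would lie in `ℬ`. So waiting is optimal at all later times of the window,
and by continuity at `x` itself. -/
theorem exists_flowValue_const {x : ℝ} (hx : x ∈ M.bandC) :
    ∃ σ > M.H x, ∀ s ∈ Icc (M.H x) σ, M.flowValue s = M.flowValue (M.H x) := by
  obtain ⟨hcx, hG, hd⟩ := (M.mem_bandC_iff hα).1 hx
  obtain ⟨τ, rfl⟩ : ∃ τ, M.E τ = x := ⟨_, M.E_H hcx⟩
  rw [M.H_E]
  obtain ⟨ε, hε, h⟩ := M.dichotomy hα hG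
  have h1 : ∀ s ∈ Ioo τ (τ + ε), M.flowValue s = M.flowValue (τ + ε) := fun s hs => by
    refine (h (τ - ε) s (τ + ε) le_rfl (by linarith [hs.1]) hs.2 le_rfl).resolve_left fun haff => ?_
    exact hd (M.hasDerivAt_v_of_affine hα (M.crit_lt_E _).le haff
      ⟨M.E_strictMono (by linarith), M.E_strictMono hs.1⟩)
  have h2 : M.flowValue τ = M.flowValue (τ + ε) := by
    have t1 : Tendsto M.flowValue (𝓝[>] τ) (𝓝 (M.flowValue τ)) :=
      ((M.continuous_flowValue hα).tendsto τ).mono_left nhdsWithin_le_nhds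
    refine tendsto_nhds_unique t1 (tendsto_const_nhds.congr' ?_)
    filter_upwards [Ioo_mem_nhdsGT (show τ < τ + ε by linarith)] with s hs using (h1 s hs).symm
  refine ⟨τ + ε, by linarith, fun s hs => le_antisymm (M.flowValue_antitone hα hs.1) ?_⟩
  rw [h2]; exact M.flowValue_antitone hα hs.2

theorem bddBelow_lowerEnd {x : ℝ} (hx : x ∈ M.bandB) :
    M.crit ∈ lowerBounds {y | Ioc y x ⊆ M.bandB} := fun y hy => by
  by_contra! hlt
  have hc := M.crit_lt_of_mem_bandB hα hx
  exact M.notMem_bandA_of_bandB (hy ⟨hlt, hc.le⟩) (M.crit_mem_bandA hα)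

theorem lowerEnd_lt {x : ℝ} (hx : x ∈ M.bandB) : M.lowerEnd x < x := by
  obtain ⟨y, hy, -, h⟩ := M.exists_Ioc_subset_bandB hα hx
  exact (csInf_le ⟨_, M.bddBelow_lowerEnd hα hx⟩ h).trans_lt hy

theorem Ioc_lowerEnd_subset {x : ℝ} (hx : x ∈ M.bandB) : Ioc (M.lowerEnd x) x ⊆ M.bandB := by
  obtain ⟨y₀, hy₀, -, h⟩ := M.exists_Ioc_subset_bandB hα hx
  intro z hz
  obtain ⟨y, hy, hyz⟩ := exists_lt_of_csInf_lt ⟨y₀, h⟩ hz.1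
  exact hy ⟨hyz, hz.2⟩

theorem crit_le_lowerEnd {x : ℝ} (hx : x ∈ M.bandB) : M.crit ≤ M.lowerEnd x := by
  obtain ⟨y₀, hy₀, -, h⟩ := M.exists_Ioc_subset_bandB hα hx
  exact le_csInf ⟨y₀, h⟩ fun y hy => M.bddBelow_lowerEnd hα hx hy

theorem lowerEnd_notMem_bandB {x : ℝ} (hx : x ∈ M.bandB) : M.lowerEnd x ∉ M.bandB := fun hB => by
  obtain ⟨y, hy, -, h⟩ := M.exists_Ioc_subset_bandB hα hB
  refine absurd (csInf_le ⟨_, M.bddBelow_lowerEnd hα hx⟩ (a := y) ?_) (not_le.2 hy)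
  intro z hz
  rcases le_or_gt z (M.lowerEnd x) with hz' | hz'
  · exact h ⟨hz.1, hz'⟩
  · exact M.Ioc_lowerEnd_subset hα hx ⟨hz', hz.2⟩

theorem v_eq_lowerEnd {x : ℝ} (hx : x ∈ M.bandB) :
    M.v x = M.v (M.lowerEnd x) + (x - M.lowerEnd x) := by
  have hlt := M.lowerEnd_lt hα hx
  obtain ⟨c, hc, h⟩ := exists_hasDerivAt_eq_slope M.v (fun _ => 1) hlt
    (M.continuous_v hα).continuousOn fun z hz =>
      (M.Ioc_lowerEnd_subset hα hx ⟨hz.1, hz.2.le⟩).2.1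
  rw [eq_div_iff (sub_pos.2 hlt).ne'] at h
  linarith

/-- At a lower end in `𝒞`, waiting would be optimal while the component above gives right slope one;
`G_v_eq_zero_of_const` rules this out. -/
theorem lowerEnd_mem_bandA {x : ℝ} (hx : x ∈ M.bandB) : M.lowerEnd x ∈ M.bandA := by
  by_contra hA
  have hC : M.lowerEnd x ∈ M.bandC := ⟨M.crit_le_lowerEnd hα hx, fun h =>
    h.elim hA (M.lowerEnd_notMem_bandB hα hx)⟩
  obtain ⟨σ, hσ, h⟩ := M.exists_flowValue_const hα hC
  have hc := ((M.mem_bandC_iff hα).1 hC).1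
  have hlt := M.lowerEnd_lt hα hx
  refine hA ⟨hc.le, ?_⟩
  have hd : HasDerivWithinAt M.v 1 (Ici (M.lowerEnd x)) (M.lowerEnd x) := by
    refine ((((hasDerivAt_id' (M.lowerEnd x)).sub_const (M.lowerEnd x)).const_add
      (M.v (M.lowerEnd x))).hasDerivWithinAt).congr_of_eventuallyEq ?_ (by simp)
    filter_upwards [Icc_mem_nhdsGE hlt] with y hy
    exact M.v_affine_of_affine hα hc.le (M.v_eq_lowerEnd hα hx) hy
  have := M.G_v_eq_zero_of_const hα (τ := M.H (M.lowerEnd x)) hσ (by rwa [M.E_H hc]) h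
  rwa [M.E_H hc] at this

/-- Going up from `𝒞`, the set `ℬ` cannot be entered without meeting `𝒜` first, because each
component of `ℬ` has its lower end in `𝒜`. -/
theorem mem_bandC_of_Ico {y a : ℝ} (hy : y ∈ M.bandC) (h : ∀ z ∈ Ico y a, z ∉ M.bandA) {z : ℝ}
    (hz : z ∈ Ico y a) : z ∈ M.bandC := by
  refine ⟨(le_trans hy.1 hz.1 : M.crit ≤ z), ?_⟩
  rintro (hA | hB)
  · exact h z hz hA
  · have h1 := M.lowerEnd_mem_bandA hα hB
    have h2 := M.lowerEnd_lt hα hB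
    rcases le_or_gt y (M.lowerEnd z) with h3 | h3
    · exact h _ ⟨h3, h2.trans hz.2⟩ h1
    · exact hy.2 (Or.inr (M.Ioc_lowerEnd_subset hα hB ⟨h3, hz.1⟩))

/-- Continuous induction: the times at which the constant persists form a closed set, and
`exists_flowValue_const` extends it to the right at every point reached. -/
theorem flowValue_const_of_Ico {y a : ℝ} (hy : y ∈ M.bandC) (hya : y ≤ a)
    (h : ∀ z ∈ Ico y a, z ∉ M.bandA) :
    ∀ s ∈ Icc (M.H y) (M.H a), M.flowValue s = M.flowValue (M.H y) := by
  have hcy := ((M.mem_bandC_iff hα).1 hy).1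
  have hcl : IsClosed ({s | M.flowValue s = M.flowValue (M.H y)} ∩ Icc (M.H y) (M.H a)) :=
    (isClosed_eq (M.continuous_flowValue hα) continuous_const).inter isClosed_Icc
  refine hcl.Icc_subset_of_forall_exists_gt rfl ?_
  rintro s ⟨hs, hsI⟩ t ht
  have hC : M.E s ∈ M.bandC := M.mem_bandC_of_Ico hα hy h
    ⟨(M.le_E_iff hcy).2 hsI.1, (M.E_lt_iff (hcy.trans_le hya)).2 hsI.2⟩
  obtain ⟨σ, hσ, hc⟩ := M.exists_flowValue_const hα hC
  rw [M.H_E] at hσ hc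
  refine ⟨min σ t, ?_, lt_min hσ ht, min_le_right _ _⟩
  exact (hc _ ⟨(lt_min hσ ht).le, min_le_left _ _⟩).trans hs

/-- A reserve level above which everything is paid out. -/
theorem bandB_of_lt {x : ℝ} (hx : M.p / (M.δ - M.r) < x) : x ∈ M.bandB := by
  have hv := M.isSuper_v hα
  have hδr : 0 < M.δ - M.r := sub_pos.2 M.r_lt_δ
  -- Beyond `b` the income `p + r x` is at most `δ x`, so `v` continued with slope one from `b` is
  -- still a supersolution. By minimality it equals `v`.
  set b := M.p / (M.δ - M.r) with hb
  have hb0 : 0 < b := div_pos M.p_pos hδr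
  have hbc := M.crit_neg.trans hb0
  have hbδ : (M.δ - M.r) * b = M.p := by rw [hb]; field_simp
  have hvb := hv.sub_crit_le (x := b)
  set u : ℝ → ℝ := fun x => if x ≤ b then M.v x else M.v b + (x - b) with hu
  have u1 : ∀ y ≤ b, u y = M.v y := fun y hy => by simp [hu, hy]
  have u2 : ∀ y, b ≤ y → u y = M.v b + (y - b) := fun y hy => by
    rcases hy.eq_or_lt with rfl | h
    · simp [hu]
    · simp [hu, not_le.2 h]
  have uv : ∀ y, u y ≤ M.v y := fun y => by
    rcases le_total y b with h | h
    · rw [u1 y h]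
    · rw [u2 y h]; exact hv.slope _ _ hbc.le h
  have ug : M.IsGrowth u := by
    refine ⟨fun y hy => by rw [u1 y (hy.trans hbc.le), hv.zero y hy], fun y z hy hyz => ?_⟩
    rcases le_total z b with h | h
    · rw [u1 z h, u1 y (hyz.trans h)]; exact hv.slope y z hy hyz
    · rw [u2 z h]
      rcases le_total y b with h' | h'
      · rw [u1 y h']
        have := hv.slope y b hy h'
        linarith
      · rw [u2 y h']; linarith
  have us : M.IsSuper u := by
    refine ⟨ug, ?_⟩
    have fl : ∀ τ σ, τ ≤ σ → σ ≤ M.H b → Real.exp (-M.q * σ) * u (M.E σ) + M.running u τ σ ≤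
        Real.exp (-M.q * τ) * u (M.E τ) := fun τ σ h hσ => by
      rw [u1 _ ((M.E_le_iff hbc).2 hσ), u1 _ ((M.E_le_iff hbc).2 (h.trans hσ))]
      have e1 := hv.flow τ σ h
      have e2 := ug.running_mono M hv.toIsGrowth uv h
      linarith
    have fr : ∀ τ σ, τ ≤ σ → M.H b ≤ τ → Real.exp (-M.q * σ) * u (M.E σ) + M.running u τ σ ≤
        Real.exp (-M.q * τ) * u (M.E τ) := fun τ σ h hτ => by
      refine ug.flow_of_discounted M h fun s hs => ?_
      have hH : 0 ≤ M.H b := (M.E_le_iff hbc).1 (by rw [M.E_zero]; exact hb0.le)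
      have := M.discounted_affine_antitoneOn (K := M.v b - b) hH (by
        rw [M.E_H hbc]
        have := M.crit_neg
        have := M.r_pos
        nlinarith [M.δ_pos]) hτ (hτ.trans hs.1) hs.1
      rw [u2 _ ((M.le_E_iff hbc).2 hτ), u2 _ ((M.le_E_iff hbc).2 (hτ.trans hs.1))]
      have ee : ∀ z, M.v b + (z - b) = M.v b - b + z := fun z => by ring
      rw [ee, ee]; exact this
    intro τ σ h
    rcases le_total σ (M.H b) with hσ | hσ
    · exact fl τ σ h hσ
    rcases le_total τ (M.H b) with hτ | hτ
    · have e1 := fl τ _ hτ le_rfl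
      have e2 := fr _ σ hσ le_rfl
      have e3 := ug.running_add M τ (M.H b) σ
      linarith
    · exact fr τ σ h hτ
  have hveq : ∀ y, b ≤ y → M.v y = M.v b + (y - b) := fun y hy => by
    rw [← u2 y hy]; exact le_antisymm (us.v_le y) (uv y)
  refine ⟨(hbc.trans hx).le, M.hasDerivAt_v_of_affine hα hbc.le (hveq (x + 1) (by linarith))
    ⟨hx, lt_add_one x⟩, ?_⟩
  have e1 := hv.claimMean_le x
  have e2 := hveq x hx.le
  have e3 := mul_le_mul_of_nonneg_left e1 M.lam_pos.le
  rw [M.G_v hα, M.drift_of_nonneg (hb0.trans hx).le, q]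
  have := M.crit_neg
  have := M.δ_pos
  nlinarith

/-- Debit interest above `q` makes waiting strictly better than paying at negative levels: first `𝒜`
is excluded, then `ℬ`, whose components start in `𝒜`. -/
theorem bandC_of_neg (hα' : M.q < M.α) {x : ℝ} (hx : x ∈ Ioo M.crit 0) : x ∈ M.bandC := by
  have hv := M.isSuper_v hα
  have hq := M.q_pos
  have key : ∀ y ∈ Ioo M.crit 0, y ∉ M.bandA := by
    rintro y ⟨hy1, hy2⟩ ⟨-, hG⟩
    -- Subtract `G v y = 0` from `G v z ≤ 0`: the drift has slope `α`, and the claim term is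
    -- monotone and can be dropped.
    have h1 : ∀ z ∈ Ioo y 0, M.α / M.q * (z - y) ≤ M.v z - M.v y := fun z hz => by
      have e1 := M.G_v_nonpos hα (hy1.trans hz.1).le
      rw [M.G_v hα, M.drift_of_neg hz.2] at e1
      rw [M.G_v hα, M.drift_of_neg hy2] at hG
      have e2 := mul_le_mul_of_nonneg_left (hv.claimMean_mono hz.1.le) M.lam_pos.le
      rw [div_mul_eq_mul_div, div_le_iff₀ hq]
      linarith
    obtain ⟨τ, rfl⟩ : ∃ τ, M.E τ = y := ⟨_, M.E_H hy1⟩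
    -- The line of slope `α / q` now supports `v` from below, so its flow derivative must be
    -- nonpositive at `τ`. But that derivative exceeds the one for slope one, which is zero by `hG`,
    -- by a positive multiple of `(α / q - 1) * drift`.
    have hd := M.hasDerivAt_flow hα
      ((((M.hasDerivAt_E τ).sub_const (M.E τ)).const_mul (M.α / M.q)).const_add (M.v (M.E τ)))
    have h := hd.nonpos_of_eventually_le <| by
      have hlt : τ < M.H 0 := (M.E_lt_iff M.crit_neg).1 hy2
      filter_upwards [Ioo_mem_nhdsGT hlt] with σ hσ
      have e1 := h1 (M.E σ) ⟨M.E_strictMono hσ.1, (M.E_lt_iff M.crit_neg).2 hσ.2⟩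
      have e2 := M.flowValue_antitone hα hσ.1.le
      simp only [flowValue] at e2
      have e3 := mul_le_mul_of_nonneg_left
        (show M.v (M.E τ) + M.α / M.q * (M.E σ - M.E τ) ≤ M.v (M.E σ) by linarith)
        (Real.exp_pos (-M.q * σ)).le
      simp only [sub_self, add_zero, mul_zero]
      linarith
    have h2 := nonpos_of_mul_nonpos_right h (Real.exp_pos _)
    simp only [sub_self, add_zero, mul_zero] at h2
    rw [M.G_v hα] at hG
    have h3 := M.drift_pos (M.crit_lt_E τ)
    have h4 : 1 < M.α / M.q := (one_lt_div hq).2 hα'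
    nlinarith
  refine ⟨hx.1.le, ?_⟩
  rintro (hA | hB)
  · exact key x hx hA
  -- The lower end lies in `𝒜`, which has no points strictly between `crit` and zero. Then `v x = x
  -- - crit`, and the flow derivative contains `(α - q) (x - crit) > 0`.
  have hl : M.lowerEnd x = M.crit := by
    by_contra hne
    exact key _ ⟨(M.crit_le_lowerEnd hα hB).lt_of_ne (Ne.symm hne),
      (M.lowerEnd_lt hα hB).trans hx.2⟩ (M.lowerEnd_mem_bandA hα hB)
  have hvx := M.v_eq_lowerEnd hα hB
  rw [hl, hv.zero _ le_rfl, zero_add] at hvx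
  obtain ⟨τ, rfl⟩ : ∃ τ, M.E τ = x := ⟨_, M.E_H hx.1⟩
  have hd := M.hasDerivAt_flow hα ((M.hasDerivAt_E τ).sub_const M.crit)
  have h := hd.nonpos_of_eventually_le <| by
    filter_upwards [self_mem_nhdsWithin] with σ hσ
    have e2 := M.flowValue_antitone hα (le_of_lt hσ)
    simp only [flowValue] at e2
    have e3 := mul_le_mul_of_nonneg_left (hv.sub_crit_le (x := M.E σ)) (Real.exp_pos (-M.q * σ)).le
    rw [hvx] at e2
    linarith
  have h2 := nonpos_of_mul_nonpos_right h (Real.exp_pos _)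
  have h3 := mul_nonneg M.lam_pos.le (hv.claimMean_nonneg (M.E τ))
  rw [M.drift_of_neg hx.2] at h2
  have h4 := M.α_mul_crit
  have h5 := mul_pos (sub_pos.2 hα') (sub_pos.2 hx.1)
  nlinarith

end

end RiskModel

/-! ### Exponential reweighting of a measure on an interval -/

theorem lintegral_exp_Ioo {l : ℝ} (hl : 0 ≤ l) {a u : ℝ} (h : a ≤ u) :
    ENNReal.ofReal (Real.exp (l * a)) +
      ∫⁻ w in Ioo a u, ENNReal.ofReal (l * Real.exp (l * w)) = ENNReal.ofReal (Real.exp (l * u)) := by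
  have hd : ∀ s ∈ uIcc a u, HasDerivAt (fun s => Real.exp (l * s)) (l * Real.exp (l * s)) s :=
    fun s _ => (((hasDerivAt_id' s).const_mul l).exp).congr_deriv (by ring)
  have hi : ∫ w in a..u, l * Real.exp (l * w) = Real.exp (l * u) - Real.exp (l * a) :=
    intervalIntegral.integral_eq_sub_of_hasDerivAt hd
      (Continuous.intervalIntegrable (by fun_prop) _ _)
  rw [intervalIntegral.integral_of_le h, integral_Ioc_eq_integral_Ioo] at hi
  rw [← ofReal_integral_eq_lintegral_ofReal, hi, ← ENNReal.ofReal_add (Real.exp_pos _).le]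
  · congr 1; ring
  · exact sub_nonneg.2 (Real.exp_le_exp.2 (mul_le_mul_of_nonneg_left h hl))
  · exact ((Continuous.integrableOn_Icc (by fun_prop)).mono_set Ioo_subset_Icc_self)
  · exact Eventually.of_forall fun w => mul_nonneg hl (Real.exp_pos _).le

/-- Write `e^{lu}` as `e^{la}` plus the integral of its derivative and exchange the integrals by
Tonelli. -/
theorem lintegral_exp_Ico (K : Measure ℝ) [SFinite K] {l : ℝ} (hl : 0 ≤ l) (a b : ℝ) :
    ∫⁻ u in Ico a b, ENNReal.ofReal (Real.exp (l * u)) ∂K =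
      ENNReal.ofReal (Real.exp (l * a)) * K (Ico a b) +
        ∫⁻ w in Ioo a b, ENNReal.ofReal (l * Real.exp (l * w)) * K (Ioo w b) := by
  have h1 : ∫⁻ u in Ico a b, ENNReal.ofReal (Real.exp (l * u)) ∂K =
      ∫⁻ u in Ico a b, (ENNReal.ofReal (Real.exp (l * a)) +
        ∫⁻ w in Ioo a u, ENNReal.ofReal (l * Real.exp (l * w))) ∂K :=
    setLIntegral_congr_fun measurableSet_Ico fun u hu => (lintegral_exp_Ioo hl hu.1).symm
  rw [h1, lintegral_add_left measurable_const, setLIntegral_const]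
  congr 1
  have h2 : ∀ u ∈ Ico a b, ∫⁻ w in Ioo a u, ENNReal.ofReal (l * Real.exp (l * w)) =
      ∫⁻ w in Ioo a b, (Iio u).indicator (fun w => ENNReal.ofReal (l * Real.exp (l * w))) w :=
    fun u hu => by
      rw [lintegral_indicator measurableSet_Iio, Measure.restrict_restrict measurableSet_Iio]
      congr 2
      ext w; constructor
      · intro hw; exact ⟨hw.2, hw.1, hw.2.trans hu.2⟩
      · intro hw; exact ⟨hw.2.1, hw.1⟩
  rw [setLIntegral_congr_fun measurableSet_Ico h2, lintegral_lintegral_swap]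
  · refine setLIntegral_congr_fun measurableSet_Ioo fun w hw => ?_
    have h3 : ∀ u, (Iio u).indicator (fun w => ENNReal.ofReal (l * Real.exp (l * w))) w =
        (Ioi w).indicator (fun _ => ENNReal.ofReal (l * Real.exp (l * w))) u := fun u => by
      simp only [indicator, mem_Iio, mem_Ioi]
    simp only [h3]
    rw [lintegral_indicator measurableSet_Ioi, Measure.restrict_restrict measurableSet_Ioi,
      setLIntegral_const]
    congr 2
    ext u; constructor
    · intro hu; exact ⟨hu.1, hu.2.2⟩
    · intro hu; exact ⟨hu.1, (hw.1.trans hu.1).le, hu.2⟩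
  · refine Measurable.aemeasurable ?_
    have : (Function.uncurry fun u w =>
        (Iio u).indicator (fun w => ENNReal.ofReal (l * Real.exp (l * w))) w) =
        {z : ℝ × ℝ | z.2 < z.1}.indicator fun z => ENNReal.ofReal (l * Real.exp (l * z.2)) := by
      ext z; simp only [Function.uncurry, indicator, mem_Iio, mem_ofPred_eq]
    rw [this]
    exact Measurable.indicator (by fun_prop) (measurableSet_lt measurable_snd measurable_fst)

section
variable {K : Measure ℝ} [SFinite K] {l a b : ℝ} {X : ℝ → ℝ≥0∞}

theorem lintegral_exp_reweight (hl : 0 ≤ l) (hab : a ≤ b) :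
    ENNReal.ofReal (Real.exp (l * b)) * X b + ∫⁻ u in Ico a b, ENNReal.ofReal (Real.exp (l * u)) ∂K =
      ENNReal.ofReal (Real.exp (l * a)) * (X b + K (Ico a b)) +
        ∫⁻ w in Ioo a b, ENNReal.ofReal (l * Real.exp (l * w)) * (X b + K (Ioo w b)) := by
  simp only [mul_add]
  rw [lintegral_add_left (by fun_prop), lintegral_mul_const _ (by fun_prop), lintegral_exp_Ico K hl,
    ← lintegral_exp_Ioo hl hab]
  ring

/-- Averaging the inequalities for all starting times `s` against the derivative of `e^{ls}` removes
a factor `e^{-ls}` from the discount. The term with `X w` is the price of this change. -/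
theorem reweight_le (hl : 0 ≤ l) (hab : a ≤ b)
    (h : ∀ s ∈ Icc a b, X b + K (Ico s b) ≤ X s) :
    ENNReal.ofReal (Real.exp (l * b)) * X b + ∫⁻ u in Ico a b, ENNReal.ofReal (Real.exp (l * u)) ∂K ≤
      ENNReal.ofReal (Real.exp (l * a)) * X a +
        ∫⁻ w in Ioo a b, ENNReal.ofReal (l * Real.exp (l * w)) * X w := by
  rw [lintegral_exp_reweight hl hab]
  refine add_le_add (mul_le_mul_right (h a ⟨le_rfl, hab⟩) _)
    (setLIntegral_mono' measurableSet_Ioo fun w hw => mul_le_mul_right ?_ _)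
  exact (add_le_add_right (measure_mono Ioo_subset_Ico_self) _).trans (h w ⟨hw.1.le, hw.2.le⟩)

theorem le_reweight (hl : 0 ≤ l) (hab : a ≤ b) (ha : X a ≤ X b + K (Ico a b))
    (h : ∀ s ∈ Ioo a b, X s ≤ X b + K (Ioo s b)) :
    ENNReal.ofReal (Real.exp (l * a)) * X a +
        ∫⁻ w in Ioo a b, ENNReal.ofReal (l * Real.exp (l * w)) * X w ≤
      ENNReal.ofReal (Real.exp (l * b)) * X b +
        ∫⁻ u in Ico a b, ENNReal.ofReal (Real.exp (l * u)) ∂K := by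
  rw [lintegral_exp_reweight hl hab]
  exact add_le_add (mul_le_mul_right ha _)
    (setLIntegral_mono' measurableSet_Ioo fun w hw => mul_le_mul_right (h w hw) _)

end

namespace RiskModel

variable {Ω : Type*} [MeasurableSpace Ω] {P : Measure Ω} (M : RiskModel P)

/-! ### Paths between claims -/

/-- A Gronwall argument for the increasing drift with Lipschitz constant `α`. At the maximum of the
positive part of the difference, weighted by `e^{-2α(u - s)}`, the integral inequality reproduces at
most half of that maximum, so it is zero. -/
theorem comparison {s t x : ℝ} (hst : s ≤ t) {ρ φ : ℝ → ℝ}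
    (hρ : IntervalIntegrable (fun u => M.drift (ρ u)) volume s t) (hφ : Continuous φ)
    (hle : ∀ u ∈ Icc s t, ρ u ≤ x + ∫ w in s..u, M.drift (ρ w))
    (hge : ∀ u ∈ Icc s t, x + ∫ w in s..u, M.drift (φ w) ≤ φ u) :
    ∀ u ∈ Icc s t, x + ∫ w in s..u, M.drift (ρ w) ≤ φ u := by
  have hα := M.α_pos
  set z : ℝ → ℝ := fun u => x + ∫ w in s..u, M.drift (ρ w) with hz
  have zc : ContinuousOn z (Icc s t) := by
    have := intervalIntegral.continuousOn_primitive_interval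
      ((intervalIntegrable_iff' (f := fun u => M.drift (ρ u))).1 hρ)
    rw [uIcc_of_le hst] at this
    exact continuousOn_const.add this
  have hdφ : Continuous fun u => M.drift (φ u) := M.continuous_drift.comp hφ
  set f : ℝ → ℝ := fun u => Real.exp (-(2 * M.α) * (u - s)) * max (z u - φ u) 0 with hf
  have fc : ContinuousOn f (Icc s t) :=
    ContinuousOn.mul (by fun_prop) (ContinuousOn.sup (zc.sub hφ.continuousOn) continuousOn_const)
  obtain ⟨m, hm, hmax⟩ := isCompact_Icc.exists_isMaxOn ⟨s, left_mem_Icc.2 hst⟩ fc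
  have hf0 : ∀ u, 0 ≤ f u := fun u => mul_nonneg (Real.exp_pos _).le (le_max_right _ _)
  have hle' : ∀ u ∈ Icc s t, max (z u - φ u) 0 ≤ f m * Real.exp (2 * M.α * (u - s)) := fun u hu => by
    have h1 := mul_le_mul_of_nonneg_right (hmax hu : f u ≤ f m) (Real.exp_pos (2 * M.α * (u - s))).le
    have : f u * Real.exp (2 * M.α * (u - s)) = max (z u - φ u) 0 := by
      simp only [hf]
      rw [mul_right_comm, ← Real.exp_add]; simp
    rwa [this] at h1
  have hint : ∀ u, ∫ w in s..u, M.α * (f m * Real.exp (2 * M.α * (w - s))) =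
      f m / 2 * (Real.exp (2 * M.α * (u - s)) - 1) := fun u => by
    have hd : ∀ w ∈ uIcc s u, HasDerivAt (fun w => f m / 2 * Real.exp (2 * M.α * (w - s)))
        (M.α * (f m * Real.exp (2 * M.α * (w - s)))) w := fun w _ =>
      (((((hasDerivAt_id' w).sub_const s).const_mul (2 * M.α)).exp).const_mul (f m / 2)).congr_deriv
        (by ring)
    rw [intervalIntegral.integral_eq_sub_of_hasDerivAt hd
      (Continuous.intervalIntegrable (by fun_prop) _ _)]
    simp; ring
  have key : ∀ u ∈ Icc s t, z u - φ u ≤ f m / 2 * (Real.exp (2 * M.α * (u - s)) - 1) := fun u hu => by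
    have hρu : IntervalIntegrable (fun u => M.drift (ρ u)) volume s u :=
      hρ.mono_set (by rw [uIcc_of_le hst, uIcc_of_le hu.1]; exact Icc_subset_Icc_right hu.2)
    have h1 := hge u hu
    have h2 : (∫ w in s..u, M.drift (ρ w)) - ∫ w in s..u, M.drift (φ w) ≤
        ∫ w in s..u, M.α * (f m * Real.exp (2 * M.α * (w - s))) := by
      rw [← intervalIntegral.integral_sub hρu (hdφ.intervalIntegrable _ _)]
      refine intervalIntegral.integral_mono_on hu.1 (hρu.sub (hdφ.intervalIntegrable _ _))
        (Continuous.intervalIntegrable (by fun_prop) _ _) fun w hw => ?_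
      have hw' : w ∈ Icc s t := ⟨hw.1, hw.2.trans hu.2⟩
      refine le_trans ?_ (mul_le_mul_of_nonneg_left (hle' w hw') hα.le)
      have h3 := M.drift_mono (hle w hw')
      change M.drift (ρ w) ≤ M.drift (z w) at h3
      rcases le_total (φ w) (z w) with h | h
      · have h4 := M.drift_sub_le h
        have h5 := mul_le_mul_of_nonneg_left (le_max_left (z w - φ w) 0) hα.le
        linarith
      · have h4 := M.drift_mono h
        have h5 := mul_nonneg hα.le (le_max_right (z w - φ w) 0)
        linarith
    rw [hint] at h2
    simp only [hz]; linarith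
  have hm0 : f m ≤ 0 := by
    have h1 := key m hm
    by_contra! hpos
    have hexp := Real.exp_pos (2 * M.α * (m - s))
    have h2 : max (z m - φ m) 0 ≤ f m / 2 * Real.exp (2 * M.α * (m - s)) :=
      max_le (by linarith) (by positivity)
    have h3 := mul_le_mul_of_nonneg_left h2 (Real.exp_pos (-(2 * M.α) * (m - s))).le
    have h4 : Real.exp (-(2 * M.α) * (m - s)) * (f m / 2 * Real.exp (2 * M.α * (m - s))) = f m / 2 := by
      rw [mul_left_comm, ← Real.exp_add]; simp
    have h5 : f m ≤ f m / 2 := by rw [← h4]; exact h3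
    linarith
  intro u hu
  have h1 := key u hu
  have h2 : 1 ≤ Real.exp (2 * M.α * (u - s)) :=
    Real.one_le_exp (mul_nonneg (by linarith) (sub_nonneg.2 hu.1))
  have h3 : f m / 2 * (Real.exp (2 * M.α * (u - s)) - 1) ≤ 0 :=
    mul_nonpos_of_nonpos_of_nonneg (by linarith) (by linarith)
  change z u ≤ φ u
  linarith

/-- A path of the reserve without claims on `[a, b]`, controlled by the dividends `ℓ`. -/
structure IsPath (ℓ ρ : ℝ → ℝ) (a b : ℝ) : Prop where
  mono : Monotone ℓ
  le : a ≤ b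
  integrable : IntervalIntegrable (fun u => M.drift (ρ u)) volume a b
  eq : ∀ t ∈ Icc a b, ρ t = ρ a + (∫ w in a..t, M.drift (ρ w)) - (ℓ t - ℓ a)

namespace IsPath

variable {M} {ℓ ρ : ℝ → ℝ} {a b : ℝ} (h : M.IsPath ℓ ρ a b)
include h

theorem restrict {s t : ℝ} (has : a ≤ s) (hst : s ≤ t) (htb : t ≤ b) : M.IsPath ℓ ρ s t := by
  have hi : ∀ s t, a ≤ s → s ≤ t → t ≤ b →
      IntervalIntegrable (fun u => M.drift (ρ u)) volume s t := fun s t has hst htb =>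
    h.integrable.mono_set (by
      rw [uIcc_of_le hst, uIcc_of_le (has.trans (hst.trans htb))]; exact Icc_subset_Icc has htb)
  refine ⟨h.mono, hst, hi s t has hst htb, fun u hu => ?_⟩
  rw [h.eq u ⟨has.trans hu.1, hu.2.trans htb⟩, h.eq s ⟨has, hst.trans htb⟩,
    ← intervalIntegral.integral_add_adjacent_intervals (hi a s le_rfl has (hst.trans htb))
      (hi s u has hu.1 (hu.2.trans htb))]
  ring

theorem add_le {φ : ℝ → ℝ} (hφ : Continuous φ)
    (hge : ∀ u ∈ Icc a b, ρ a + ∫ w in a..u, M.drift (φ w) ≤ φ u) {u : ℝ} (hu : u ∈ Icc a b) :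
    ρ u + (ℓ u - ℓ a) ≤ φ u := by
  have := M.comparison h.le h.integrable hφ (fun w hw => by
    rw [h.eq w hw]
    have := h.mono hw.1
    linarith) hge u hu
  rw [h.eq u hu]; linarith

theorem le_crit (ha : ρ a ≤ M.crit) {u : ℝ} (hu : u ∈ Icc a b) : ρ u ≤ M.crit := by
  have h1 := h.add_le (φ := fun _ => M.crit) continuous_const
    (fun w _ => by simpa [M.drift_crit] using ha) hu
  have h2 := h.mono hu.1
  linarith

theorem add_le_flow (ha : M.crit < ρ a) {u : ℝ} (hu : u ∈ Icc a b) :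
    ρ u + (ℓ u - ℓ a) ≤ M.E (M.H (ρ a) + (u - a)) := by
  have hc : Continuous fun u => M.E (M.H (ρ a) + (u - a)) := M.continuous_E.comp (by fun_prop)
  refine h.add_le hc (fun w hw => ?_) hu
  have hd : ∀ s ∈ uIcc a w, HasDerivAt (fun u => M.E (M.H (ρ a) + (u - a)))
      (M.drift (M.E (M.H (ρ a) + (s - a)))) s := fun s _ => by
    have h1 : HasDerivAt (fun u => M.H (ρ a) + (u - a)) 1 s :=
      ((hasDerivAt_id' s).sub_const a).const_add _
    exact ((M.hasDerivAt_E (M.H (ρ a) + (s - a))).comp s h1).congr_deriv (mul_one _)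
  rw [intervalIntegral.integral_eq_sub_of_hasDerivAt hd
    ((M.continuous_drift.comp hc).intervalIntegrable _ _)]
  simp [M.E_H ha]

/-- Between claims the path inherits left continuity from the dividends, so the bound passes to the
right end. -/
theorem crit_le_right (hℓ : ContinuousWithinAt ℓ (Iic b) b) (hab : a < b)
    (hgt : ∀ u ∈ Ico a b, M.crit < ρ u) : M.crit ≤ ρ b := by
  have h1 : ContinuousOn (fun t => ∫ w in a..t, M.drift (ρ w)) (Icc a b) := by
    have := intervalIntegral.continuousOn_primitive_interval
      ((intervalIntegrable_iff' (f := fun u => M.drift (ρ u))).1 h.integrable)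
    rwa [uIcc_of_le hab.le] at this
  have h2 : ContinuousWithinAt ρ (Icc a b) b := by
    have h3 : ContinuousWithinAt (fun t => ρ a + (∫ w in a..t, M.drift (ρ w)) - (ℓ t - ℓ a))
        (Icc a b) b :=
      (continuousWithinAt_const.add (h1 b (right_mem_Icc.2 hab.le))).sub
        ((hℓ.mono Icc_subset_Iic_self).sub continuousWithinAt_const)
    exact h3.congr h.eq (h.eq b (right_mem_Icc.2 hab.le))
  have h4 : Tendsto ρ (𝓝[<] b) (𝓝 (ρ b)) := by
    have : 𝓝[Icc a b] b ≥ 𝓝[<] b := by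
      rw [← nhdsWithin_Ioo_eq_nhdsLT hab]
      exact nhdsWithin_mono _ Ioo_subset_Icc_self
    exact h2.mono_left this
  refine ge_of_tendsto h4 ?_
  filter_upwards [Ioo_mem_nhdsLT hab] with u hu using (hgt u ⟨hu.1.le, hu.2⟩).le

end IsPath

/-- The discounted minimal supersolution along a path. -/
def pathValue (ρ : ℝ → ℝ) (s : ℝ) : ℝ≥0∞ := ENNReal.ofReal (Real.exp (-M.q * s) * M.v (ρ s))

/-- The discounted rate of the value after a claim along a path. -/
def pathGain (ρ : ℝ → ℝ) (s : ℝ) : ℝ≥0∞ :=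
  ENNReal.ofReal (Real.exp (-M.q * s) * (M.lam * M.claimMean M.v (ρ s)))

section

variable (hα : M.δ < M.α)
include hα

theorem lintegral_pathGain_flow {τ s t : ℝ} (hst : s ≤ t) :
    ∫⁻ u in Ico s t, M.pathGain (fun u => M.E (τ + (u - s))) u =
      ENNReal.ofReal (Real.exp (M.q * (τ - s)) * M.running M.v τ (τ + (t - s))) := by
  have hv := M.isSuper_v hα
  have hc : Continuous fun u => Real.exp (-M.q * u) *
      (M.lam * M.claimMean M.v (M.E (τ + (u - s)))) := by
    have : Continuous fun u => M.claimMean M.v (M.E (τ + (u - s))) :=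
      (M.continuous_claimMean hα).comp (M.continuous_E.comp (by fun_prop))
    fun_prop
  unfold pathGain
  rw [← ofReal_integral_eq_lintegral_ofReal (hc.integrableOn_Icc.mono_set Ico_subset_Icc_self)
    (Eventually.of_forall fun u => mul_nonneg (Real.exp_pos _).le
      (mul_nonneg M.lam_pos.le (hv.claimMean_nonneg _))), integral_Ico_eq_integral_Ioo,
    ← integral_Ioc_eq_integral_Ioo, ← intervalIntegral.integral_of_le hst]
  congr 1
  have h1 : ∀ u, Real.exp (-M.q * u) * (M.lam * M.claimMean M.v (M.E (τ + (u - s)))) =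
      (fun w => Real.exp (M.q * (τ - s)) *
        (Real.exp (-M.q * w) * (M.lam * M.claimMean M.v (M.E w)))) (u + (τ - s)) := fun u => by
    have e1 : -M.q * u = M.q * (τ - s) + -M.q * (u + (τ - s)) := by ring
    have e2 : τ + (u - s) = u + (τ - s) := by ring
    rw [e2, e1, Real.exp_add, mul_assoc]
  rw [intervalIntegral.integral_congr fun u _ => h1 u,
    intervalIntegral.integral_comp_add_right (fun w => Real.exp (M.q * (τ - s)) *
        (Real.exp (-M.q * w) * (M.lam * M.claimMean M.v (M.E w)))),
    intervalIntegral.integral_const_mul, running, show s + (τ - s) = τ by ring,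
    show t + (τ - s) = τ + (t - s) by ring]

/-- Reserve plus dividends stay below the uncontrolled flow; the slope condition converts the
dividends into value, and the flow inequality compares with the start. All dividends are discounted
as if paid at `t`, which undervalues them. -/
theorem IsPath.step {ℓ ρ : ℝ → ℝ} {s t : ℝ} (h : M.IsPath ℓ ρ s t) (hs : M.crit < ρ s)
    (ht : M.crit ≤ ρ t) :
    M.pathValue ρ t + ENNReal.ofReal (Real.exp (-M.q * t) * (ℓ t - ℓ s)) +
      ∫⁻ u in Ico s t, M.pathGain ρ u ≤ M.pathValue ρ s := by
  have hv := M.isSuper_v hα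
  set τ := M.H (ρ s) with hτ
  have h1 := h.add_le_flow hs (right_mem_Icc.2 h.le)
  have hΔ := sub_nonneg.2 (h.mono h.le)
  have h2 : ∫⁻ u in Ico s t, M.pathGain ρ u ≤
      ENNReal.ofReal (Real.exp (M.q * (τ - s)) * M.running M.v τ (τ + (t - s))) := by
    rw [← M.lintegral_pathGain_flow hα h.le]
    refine setLIntegral_mono' measurableSet_Ico fun u hu => ENNReal.ofReal_le_ofReal ?_
    have h3 := h.add_le_flow hs (Ico_subset_Icc_self hu)
    have h4 := h.mono hu.1
    have h5 : ρ u ≤ M.E (τ + (u - s)) := by linarith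
    have h6 := M.lam_pos.le
    have h7 := hv.claimMean_mono h5
    simp only
    gcongr
  refine (add_le_add_right h2 _).trans ?_
  have h3 := hv.slope (ρ t) (M.E (τ + (t - s))) ht (by linarith)
  have h4 := hv.flow τ (τ + (t - s)) (by linarith [h.le])
  have h5 := hv.running_nonneg M (show τ ≤ τ + (t - s) by linarith [h.le])
  rw [pathValue, pathValue, ← ENNReal.ofReal_add, ← ENNReal.ofReal_add]
  · refine ENNReal.ofReal_le_ofReal ?_
    have h6 := mul_le_mul_of_nonneg_left h4 (Real.exp_pos (M.q * (τ - s))).le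
    rw [mul_add, ← mul_assoc, ← mul_assoc, ← Real.exp_add, ← Real.exp_add] at h6
    have e1 : M.q * (τ - s) + -M.q * (τ + (t - s)) = -M.q * t := by ring
    have e2 : M.q * (τ - s) + -M.q * τ = -M.q * s := by ring
    rw [e1, e2, M.E_H hs] at h6
    have h7 := mul_le_mul_of_nonneg_left (show M.v (ρ t) + (ℓ t - ℓ s) ≤ M.v (M.E (τ + (t - s))) by
      linarith) (Real.exp_pos (-M.q * t)).le
    linarith
  · exact add_nonneg (mul_nonneg (Real.exp_pos _).le (hv.nonneg _))
      (mul_nonneg (Real.exp_pos _).le hΔ)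
  · positivity
  · exact mul_nonneg (Real.exp_pos _).le (hv.nonneg _)
  · exact mul_nonneg (Real.exp_pos _).le hΔ

/-- Applying `step` on `n + 1` equal subintervals undervalues the dividends by at most the factor
`e^{-q (t - s)/(n + 1)}`, which tends to one. -/
theorem IsPath.value_le_of_gt {ℓ ρ : ℝ → ℝ} {s t : ℝ} (h : M.IsPath ℓ ρ s t) {μ : Measure ℝ}
    (hμ : ∀ s t, s ≤ t → μ (Ico s t) = ENNReal.ofReal (ℓ t - ℓ s))
    (hgt : ∀ u ∈ Ico s t, M.crit < ρ u) (ht : M.crit ≤ ρ t) :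
    M.pathValue ρ t + ∫⁻ u in Ico s t, ENNReal.ofReal (Real.exp (-M.q * u)) ∂μ +
      ∫⁻ u in Ico s t, M.pathGain ρ u ≤ M.pathValue ρ s := by
  have hq := M.q_pos
  have key : ∀ n : ℕ, M.pathValue ρ t + ENNReal.ofReal (Real.exp (-M.q * ((t - s) / (n + 1)))) *
      (∫⁻ u in Ico s t, ENNReal.ofReal (Real.exp (-M.q * u)) ∂μ) +
      ∫⁻ u in Ico s t, M.pathGain ρ u ≤ M.pathValue ρ s := by
    intro n
    set d := (t - s) / (n + 1) with hd
    have hn : (0 : ℝ) < n + 1 := by positivity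
    have hd0 : 0 ≤ d := div_nonneg (sub_nonneg.2 h.le) hn.le
    have hdn : d * (n + 1) = t - s := by rw [hd]; field_simp
    set c := ENNReal.ofReal (Real.exp (-M.q * d)) with hc
    have main : ∀ j : ℕ, j ≤ n + 1 → M.pathValue ρ (s + d * j) +
        c * (∫⁻ u in Ico s (s + d * j), ENNReal.ofReal (Real.exp (-M.q * u)) ∂μ) +
        ∫⁻ u in Ico s (s + d * j), M.pathGain ρ u ≤ M.pathValue ρ s := by
      intro j
      induction j with
      | zero => intro _; simp
      | succ j ih =>
        intro hj
        have ih := ih (by omega)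
        set s₁ := s + d * j with hs1
        set s₂ := s + d * ((j + 1 : ℕ) : ℝ) with hs2
        have h12 : s₂ = s₁ + d := by rw [hs1, hs2]; push_cast; ring
        have hj' : (j : ℝ) + 1 ≤ n + 1 := by exact_mod_cast hj
        have hs1s : s ≤ s₁ := by rw [hs1]; have : (0 : ℝ) ≤ j := by positivity
                                 nlinarith
        have hs2t : s₂ ≤ t := by
          rw [hs2]; push_cast
          have := mul_le_mul_of_nonneg_left hj' hd0
          linarith
        rcases hd0.eq_or_lt with hd00 | hdpos
        · have : s₂ = s₁ := by rw [h12, ← hd00, add_zero]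
          rw [this]; exact ih
        have hs1t : s₁ < t := by linarith
        have hs2c : M.crit ≤ ρ s₂ := by
          rcases hs2t.eq_or_lt with h' | h'
          · rw [h']; exact ht
          · exact (hgt _ ⟨by linarith, h'⟩).le
        have st := (h.restrict hs1s (by linarith) hs2t).step M hα (hgt _ ⟨hs1s, hs1t⟩) hs2c
        have hμ12 : c * ∫⁻ u in Ico s₁ s₂, ENNReal.ofReal (Real.exp (-M.q * u)) ∂μ ≤
            ENNReal.ofReal (Real.exp (-M.q * s₂) * (ℓ s₂ - ℓ s₁)) := by
          have b1 : ∫⁻ u in Ico s₁ s₂, ENNReal.ofReal (Real.exp (-M.q * u)) ∂μ ≤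
              ∫⁻ u in Ico s₁ s₂, ENNReal.ofReal (Real.exp (-M.q * s₁)) ∂μ :=
            setLIntegral_mono' measurableSet_Ico fun u hu => ENNReal.ofReal_le_ofReal
              (Real.exp_le_exp.2 (by nlinarith [hu.1]))
          rw [setLIntegral_const, hμ _ _ (by linarith)] at b1
          calc _ ≤ c * (ENNReal.ofReal (Real.exp (-M.q * s₁)) * ENNReal.ofReal (ℓ s₂ - ℓ s₁)) := by
                gcongr
            _ = _ := by
                rw [hc, ← mul_assoc, ← ENNReal.ofReal_mul (Real.exp_pos _).le, ← Real.exp_add,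
                  ← ENNReal.ofReal_mul (Real.exp_pos _).le]
                congr 3; rw [h12]; ring
        have hU : Ico s s₂ = Ico s s₁ ∪ Ico s₁ s₂ :=
          (Ico_union_Ico_eq_Ico hs1s (by linarith)).symm
        have hdis : Disjoint (Ico s s₁) (Ico s₁ s₂) := by
          rw [Set.disjoint_left]; intro u hu hu'; exact absurd hu.2 (not_lt.2 hu'.1)
        rw [hU, lintegral_union measurableSet_Ico hdis, lintegral_union measurableSet_Ico hdis,
          mul_add]
        calc _ = (M.pathValue ρ s₂ + c * (∫⁻ u in Ico s₁ s₂, ENNReal.ofReal (Real.exp (-M.q * u)) ∂μ)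
              + ∫⁻ u in Ico s₁ s₂, M.pathGain ρ u) +
              (c * (∫⁻ u in Ico s s₁, ENNReal.ofReal (Real.exp (-M.q * u)) ∂μ) +
              ∫⁻ u in Ico s s₁, M.pathGain ρ u) := by ring
          _ ≤ M.pathValue ρ s₁ + (c * (∫⁻ u in Ico s s₁, ENNReal.ofReal (Real.exp (-M.q * u)) ∂μ) +
              ∫⁻ u in Ico s s₁, M.pathGain ρ u) := by
              refine add_le_add_left (le_trans ?_ st) _
              gcongr
          _ ≤ _ := by rw [← add_assoc]; exact ih
    have := main (n + 1) le_rfl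
    have e : s + d * ((n + 1 : ℕ) : ℝ) = t := by push_cast; linarith
    rwa [e] at this
  have hc1 : Tendsto (fun n : ℕ => ENNReal.ofReal (Real.exp (-M.q * ((t - s) / (n + 1))))) atTop
      (𝓝 1) := by
    have h1 : Tendsto (fun n : ℕ => (t - s) / ((n : ℝ) + 1)) atTop (𝓝 0) :=
      tendsto_const_nhds.div_atTop (tendsto_natCast_atTop_atTop.atTop_add tendsto_const_nhds)
    have h2 : Continuous fun y => ENNReal.ofReal (Real.exp (-M.q * y)) :=
      ENNReal.continuous_ofReal.comp (by fun_prop)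
    have := (h2.tendsto 0).comp h1
    rw [mul_zero, Real.exp_zero, ENNReal.ofReal_one] at this
    exact this
  have h3 := ENNReal.Tendsto.mul_const
    (b := ∫⁻ u in Ico s t, ENNReal.ofReal (Real.exp (-M.q * u)) ∂μ) hc1 (Or.inl one_ne_zero)
  rw [one_mul] at h3
  exact le_of_tendsto ((tendsto_const_nhds.add h3).add tendsto_const_nhds)
    (Eventually.of_forall key)

/-- Up to the infimum `T` of the times at or below `crit`, `value_le_of_gt` applies. Afterwards
value and gain vanish, and `I` admits no dividend except a lump sum at `T`. Admissibility bounds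
this lump by the excess over `crit`, hence by `v`. -/
theorem IsPath.value_le {ℓ ρ : ℝ → ℝ} {a b : ℝ} (h : M.IsPath ℓ ρ a b) {μ : Measure ℝ}
    (hμ : ∀ s t, s ≤ t → μ (Ico s t) = ENNReal.ofReal (ℓ t - ℓ s))
    (hℓ : ∀ t, ContinuousWithinAt ℓ (Iic t) t) {I : Set ℝ}
    (hI : ∀ w ∈ I, w ∈ Ico a b → ∀ u ∈ Ico a w, M.crit < ρ u)
    (hlump : ∀ w ∈ I, w ∈ Ico a b → μ {w} ≤ ENNReal.ofReal (max (ρ w - M.crit) 0))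
    {s : ℝ} (hs : s ∈ Icc a b) :
    M.pathValue ρ b + ∫⁻ u in I ∩ Ico s b, ENNReal.ofReal (Real.exp (-M.q * u)) ∂μ +
      ∫⁻ u in Ico s b, M.pathGain ρ u ≤ M.pathValue ρ s := by
  have hv := M.isSuper_v hα
  have h' := h.restrict hs.1 hs.2 le_rfl
  by_cases hgt : ∀ u ∈ Ico s b, M.crit < ρ u
  · rcases hs.2.eq_or_lt with rfl | hsb
    · simp
    refine le_trans ?_ (h'.value_le_of_gt M hα hμ hgt (h'.crit_le_right (hℓ b) hsb hgt))
    gcongr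
    exact inter_subset_right
  push Not at hgt
  obtain ⟨u₀, hu₀, hρu₀⟩ := hgt
  set B := {u | u ∈ Ico s b ∧ ρ u ≤ M.crit} with hB
  have hBne : B.Nonempty := ⟨u₀, hu₀, hρu₀⟩
  have hBbdd : s ∈ lowerBounds B := fun u hu => hu.1.1
  set T := sInf B with hT
  have hsT : s ≤ T := le_csInf hBne hBbdd
  have hTb : T < b := (csInf_le ⟨s, hBbdd⟩ ⟨hu₀, hρu₀⟩).trans_lt hu₀.2
  have hafter : ∀ w, T < w → w ≤ b → ρ w ≤ M.crit := fun w hw hwb => by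
    obtain ⟨u, hu, huw⟩ := exists_lt_of_csInf_lt hBne hw
    exact (h.restrict (hs.1.trans hu.1.1) hu.1.2.le le_rfl).le_crit hu.2 ⟨huw.le, hwb⟩
  have hbefore : ∀ u ∈ Ico s T, M.crit < ρ u := fun u hu => by
    by_contra! hle
    exact absurd (csInf_le ⟨s, hBbdd⟩ (show u ∈ B from ⟨⟨hu.1, hu.2.trans hTb⟩, hle⟩))
      (not_le.2 hu.2)
  have hIT : I ∩ Ico s b ⊆ Ico s T ∪ (I ∩ {T}) := by
    rintro w ⟨hwI, hw⟩
    rcases lt_trichotomy w T with h1 | h1 | h1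
    · exact Or.inl ⟨hw.1, h1⟩
    · exact Or.inr ⟨hwI, h1⟩
    · obtain ⟨u, hu, huw⟩ := exists_lt_of_csInf_lt hBne h1
      have := hI w hwI ⟨hs.1.trans hw.1, hw.2⟩ u ⟨hs.1.trans hu.1.1, huw⟩
      exact absurd hu.2 (not_le.2 this)
  have hXb : M.pathValue ρ b = 0 := by
    rw [pathValue, hv.zero _ (hafter b hTb le_rfl)]; simp
  have hlumpT : ∫⁻ u in I ∩ {T}, ENNReal.ofReal (Real.exp (-M.q * u)) ∂μ ≤ M.pathValue ρ T := by
    by_cases hTI : T ∈ I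
    · rw [inter_eq_self_of_subset_right (singleton_subset_iff.2 hTI), lintegral_singleton]
      have h1 := hlump T hTI ⟨hs.1.trans hsT, hTb⟩
      rw [pathValue, ENNReal.ofReal_mul (Real.exp_pos _).le]
      gcongr
      exact h1.trans (ENNReal.ofReal_le_ofReal (max_le hv.sub_crit_le (hv.nonneg _)))
    · rw [inter_singleton_eq_empty.2 hTI]; simp
  have hgain : ∫⁻ u in Ico s b, M.pathGain ρ u = ∫⁻ u in Ico s T, M.pathGain ρ u := by
    have hdis : Disjoint (Ico s T) (Ico T b) := by
      rw [Set.disjoint_left]; intro u hu hu'; exact absurd hu.2 (not_lt.2 hu'.1)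
    rw [← Ico_union_Ico_eq_Ico hsT hTb.le, lintegral_union measurableSet_Ico hdis]
    -- At `T` itself the reserve may still be above `crit`, when a lump sum paid there causes the
    -- ruin; a single time does not matter for the integral.
    have : ∫⁻ u in Ico T b, M.pathGain ρ u = 0 := by
      rw [setLIntegral_congr (Ioo_ae_eq_Ico (μ := volume)).symm,
        setLIntegral_congr_fun measurableSet_Ioo (g := fun _ => 0), lintegral_zero]
      intro u hu
      simp [pathGain, hv.claimMean_of_le (hafter u hu.1 hu.2.le)]
    rw [this, add_zero]
  have hpre : M.pathValue ρ T + ∫⁻ u in Ico s T, ENNReal.ofReal (Real.exp (-M.q * u)) ∂μ +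
      ∫⁻ u in Ico s T, M.pathGain ρ u ≤ M.pathValue ρ s := by
    rcases hsT.eq_or_lt with h1 | h1
    · rw [← h1]; simp
    · have h2 := h.restrict hs.1 hsT hTb.le
      exact h2.value_le_of_gt M hα hμ hbefore (h2.crit_le_right (hℓ T) h1 hbefore)
  have hdiv : ∫⁻ u in I ∩ Ico s b, ENNReal.ofReal (Real.exp (-M.q * u)) ∂μ ≤
      ∫⁻ u in Ico s T, ENNReal.ofReal (Real.exp (-M.q * u)) ∂μ + M.pathValue ρ T :=
    (lintegral_mono_set hIT).trans
      ((lintegral_union_le _ _ _).trans (add_le_add_right hlumpT _))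
  rw [hXb, hgain, zero_add]
  refine le_trans (add_le_add_left hdiv _) (le_trans (le_of_eq ?_) hpre)
  ring

end

end RiskModel

namespace RiskModel

variable {Ω : Type*} [MeasurableSpace Ω] {P : Measure Ω} (M : RiskModel P)

/-! ### Discounting without killing -/

/-- The dividends and the rate of the value after a claim, as one discounted measure. -/
def rewardMeasure (μ : Measure ℝ) (I : Set ℝ) (ρ : ℝ → ℝ) : Measure ℝ :=
  (μ.restrict I).withDensity (fun u => ENNReal.ofReal (Real.exp (-M.q * u))) +
    volume.withDensity (M.pathGain ρ)

instance (μ : Measure ℝ) [SFinite μ] (I : Set ℝ) (ρ : ℝ → ℝ) :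
    SFinite (M.rewardMeasure μ I ρ) := by
  unfold rewardMeasure; infer_instance

theorem rewardMeasure_apply (μ : Measure ℝ) (I : Set ℝ) (ρ : ℝ → ℝ) {J : Set ℝ}
    (hJ : MeasurableSet J) : M.rewardMeasure μ I ρ J =
      ∫⁻ u in I ∩ J, ENNReal.ofReal (Real.exp (-M.q * u)) ∂μ + ∫⁻ u in J, M.pathGain ρ u := by
  rw [rewardMeasure, Measure.add_apply, withDensity_apply _ hJ, withDensity_apply _ hJ,
    Measure.restrict_restrict hJ, inter_comm]

theorem exp_lam_mul_exp_q (u : ℝ) : ENNReal.ofReal (Real.exp (-M.q * u)) *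
    ENNReal.ofReal (Real.exp (M.lam * u)) = ENNReal.ofReal (Real.exp (-M.δ * u)) := by
  rw [← ENNReal.ofReal_mul (Real.exp_pos _).le, ← Real.exp_add, q]
  congr 2; ring

theorem exp_lam_mul_ofReal_exp_q (u y : ℝ) : ENNReal.ofReal (Real.exp (M.lam * u)) *
    ENNReal.ofReal (Real.exp (-M.q * u) * y) = ENNReal.ofReal (Real.exp (-M.δ * u) * y) := by
  rw [ENNReal.ofReal_mul (Real.exp_pos _).le, ENNReal.ofReal_mul (Real.exp_pos _).le, ← mul_assoc,
    mul_comm (ENNReal.ofReal (Real.exp (M.lam * u))), M.exp_lam_mul_exp_q]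

/-- The discounted value along a path. -/
def discValue (ρ : ℝ → ℝ) (s : ℝ) : ℝ≥0∞ := ENNReal.ofReal (Real.exp (-M.δ * s) * M.v (ρ s))

/-- The discounted rate of the value after a claim. -/
def discGain (ρ : ℝ → ℝ) (s : ℝ) : ℝ≥0∞ :=
  ENNReal.ofReal (Real.exp (-M.δ * s) * (M.lam * M.claimMean M.v (ρ s)))

theorem lintegral_lam_pathValue (ρ : ℝ → ℝ) (a b : ℝ) :
    ∫⁻ w in Ioo a b, ENNReal.ofReal (M.lam * Real.exp (M.lam * w)) * M.pathValue ρ w =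
      ∫⁻ w in Ico a b, ENNReal.ofReal M.lam * M.discValue ρ w := by
  rw [setLIntegral_congr (Ioo_ae_eq_Ico (μ := volume))]
  refine lintegral_congr fun w => ?_
  rw [ENNReal.ofReal_mul M.lam_pos.le, mul_assoc, pathValue, M.exp_lam_mul_ofReal_exp_q, discValue]

section

variable (hα : M.δ < M.α)
include hα

theorem measurable_pathGain {ρ : ℝ → ℝ} (hρ : Measurable ρ) : Measurable (M.pathGain ρ) := by
  have h : Measurable (fun s => M.claimMean M.v (ρ s)) :=
    (M.isSuper_v hα).claimMean_mono.measurable.comp hρ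
  unfold pathGain
  fun_prop

theorem lintegral_exp_rewardMeasure (μ : Measure ℝ) (I : Set ℝ)
    {ρ : ℝ → ℝ} (hρ : Measurable ρ) (a b : ℝ) :
    ∫⁻ u in Ico a b, ENNReal.ofReal (Real.exp (M.lam * u)) ∂(M.rewardMeasure μ I ρ) =
      ∫⁻ u in I ∩ Ico a b, ENNReal.ofReal (Real.exp (-M.δ * u)) ∂μ +
        ∫⁻ u in Ico a b, M.discGain ρ u := by
  rw [rewardMeasure, Measure.restrict_add, lintegral_add_measure,
    restrict_withDensity measurableSet_Ico, restrict_withDensity measurableSet_Ico,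
    lintegral_withDensity_eq_lintegral_mul _ (by fun_prop) (by fun_prop),
    lintegral_withDensity_eq_lintegral_mul _ (M.measurable_pathGain hα hρ) (by fun_prop),
    Measure.restrict_restrict measurableSet_Ico, inter_comm]
  congr 1
  · exact lintegral_congr fun u => M.exp_lam_mul_exp_q u
  · refine lintegral_congr fun u => ?_
    rw [Pi.mul_apply, mul_comm, pathGain, M.exp_lam_mul_ofReal_exp_q, discGain]

/-- Multiplication by `e^{lam u}` turns the killed discount into the true one. The term `lam *
discValue` that appears has the expectation of the value just before the next claim. -/
theorem IsPath.discounted_le {ℓ ρ : ℝ → ℝ} {a b : ℝ} (h : M.IsPath ℓ ρ a b) (hρ : Measurable ρ)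
    {μ : Measure ℝ} [SFinite μ]
    (hμ : ∀ s t, s ≤ t → μ (Ico s t) = ENNReal.ofReal (ℓ t - ℓ s))
    (hℓ : ∀ t, ContinuousWithinAt ℓ (Iic t) t) {I : Set ℝ}
    (hI : ∀ w ∈ I, w ∈ Ico a b → ∀ u ∈ Ico a w, M.crit < ρ u)
    (hlump : ∀ w ∈ I, w ∈ Ico a b → μ {w} ≤ ENNReal.ofReal (max (ρ w - M.crit) 0)) :
    M.discValue ρ b + ∫⁻ u in I ∩ Ico a b, ENNReal.ofReal (Real.exp (-M.δ * u)) ∂μ +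
      ∫⁻ u in Ico a b, M.discGain ρ u ≤
    M.discValue ρ a + ∫⁻ u in Ico a b, ENNReal.ofReal M.lam * M.discValue ρ u := by
  have := reweight_le (K := M.rewardMeasure μ I ρ) (X := M.pathValue ρ) M.lam_pos.le h.le
    fun s hs => by
      rw [M.rewardMeasure_apply _ _ _ measurableSet_Ico, ← add_assoc]
      exact h.value_le M hα hμ hℓ hI hlump hs
  rw [M.lintegral_exp_rewardMeasure hα _ _ hρ, M.lintegral_lam_pathValue] at this
  simpa only [pathValue, M.exp_lam_mul_ofReal_exp_q, discValue, add_assoc] using this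

theorem le_discounted {ρ : ℝ → ℝ} {a b : ℝ} (hab : a ≤ b) (hρ : Measurable ρ)
    {μ : Measure ℝ} [SFinite μ] {I : Set ℝ}
    (ha : M.pathValue ρ a ≤ M.pathValue ρ b +
      M.rewardMeasure μ I ρ (Ico a b))
    (h : ∀ s ∈ Ioo a b, M.pathValue ρ s ≤ M.pathValue ρ b + M.rewardMeasure μ I ρ (Ioo s b)) :
    M.discValue ρ a + ∫⁻ u in Ico a b, ENNReal.ofReal M.lam * M.discValue ρ u ≤
      M.discValue ρ b + ∫⁻ u in I ∩ Ico a b, ENNReal.ofReal (Real.exp (-M.δ * u)) ∂μ +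
      ∫⁻ u in Ico a b, M.discGain ρ u := by
  have := le_reweight (K := M.rewardMeasure μ I ρ) (X := M.pathValue ρ) M.lam_pos.le hab ha h
  rw [M.lintegral_exp_rewardMeasure hα _ _ hρ, M.lintegral_lam_pathValue] at this
  simpa only [pathValue, M.exp_lam_mul_ofReal_exp_q, discValue, add_assoc] using this

end

/-! ### The path of the band strategy between claims -/

/-- The uncontrolled flow. -/
def flow (t x : ℝ) : ℝ :=
  if x ≤ M.crit then M.crit + (x - M.crit) * Real.exp (M.α * t) else M.E (M.H x + t)

open Classical in
/-- The reserve after the lump sum prescribed by the band rule. -/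
def base (x : ℝ) : ℝ := if x ∈ M.bandB then M.lowerEnd x else x

/-- The next level at which the band rule pays out all income. -/
def top (y : ℝ) : ℝ := sInf ((M.bandA ∪ Ici (M.p / (M.δ - M.r) + 1)) ∩ Ici y)

/-- The reserve under the band rule a time `t` after it was `x`, if there are no claims. -/
def bandPath (t x : ℝ) : ℝ := if t ≤ 0 then x else min (M.flow t (M.base x)) (M.top (M.base x))

theorem flow_of_le {x : ℝ} (hx : x ≤ M.crit) (t : ℝ) :
    M.flow t x = M.crit + (x - M.crit) * Real.exp (M.α * t) := by simp [flow, hx]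

theorem flow_of_gt {x : ℝ} (hx : M.crit < x) (t : ℝ) : M.flow t x = M.E (M.H x + t) := by
  simp [flow, not_le.2 hx]

theorem flow_zero (x : ℝ) : M.flow 0 x = x := by
  rcases le_or_gt x M.crit with h | h
  · simp [M.flow_of_le h]
  · simp [M.flow_of_gt h, M.E_H h]

theorem flow_le_crit {x : ℝ} (hx : x ≤ M.crit) (t : ℝ) : M.flow t x ≤ M.crit := by
  rw [M.flow_of_le hx]
  have := mul_nonneg (sub_nonneg.2 hx) (Real.exp_pos (M.α * t)).le
  linarith

theorem flow_add (s t x : ℝ) : M.flow (s + t) x = M.flow t (M.flow s x) := by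
  rcases le_or_gt x M.crit with h | h
  · rw [M.flow_of_le (M.flow_le_crit h s), M.flow_of_le h, M.flow_of_le h, mul_add, Real.exp_add]
    ring
  · rw [M.flow_of_gt h, M.flow_of_gt h, M.flow_of_gt (M.crit_lt_E _), M.H_E, add_assoc]

theorem hasDerivAt_flow_time (x t : ℝ) :
    HasDerivAt (fun t => M.flow t x) (M.drift (M.flow t x)) t := by
  rcases le_or_gt x M.crit with h | h
  · have h1 : (fun t => M.flow t x) = fun t => M.crit + (x - M.crit) * Real.exp (M.α * t) :=
      funext fun t => M.flow_of_le h t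
    rw [M.drift_of_neg ((M.flow_le_crit h t).trans_lt M.crit_neg), h1, M.flow_of_le h]
    refine (((((hasDerivAt_id' t).const_mul M.α).exp).const_mul
      (x - M.crit)).const_add M.crit).congr_deriv ?_
    have := M.α_mul_crit
    linear_combination -this
  · have h1 : (fun t => M.flow t x) = fun t => M.E (M.H x + t) :=
      funext fun t => M.flow_of_gt h t
    rw [h1, M.flow_of_gt h]
    exact ((M.hasDerivAt_E (M.H x + t)).comp t ((hasDerivAt_id' t).const_add (M.H x))).congr_deriv
      (mul_one _)

theorem continuous_flow_time (x : ℝ) : Continuous fun t => M.flow t x :=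
  continuous_iff_continuousAt.2 fun t => (M.hasDerivAt_flow_time x t).continuousAt

theorem measurable_flow : Measurable fun z : ℝ × ℝ => M.flow z.1 z.2 := by
  unfold flow
  refine Measurable.ite (measurableSet_le measurable_snd measurable_const) (by fun_prop) ?_
  exact M.continuous_E.measurable.comp
    ((M.measurable_H.comp measurable_snd).add measurable_fst)

theorem base_of_notMem {x : ℝ} (hx : x ∉ M.bandB) : M.base x = x := by simp [base, hx]

theorem base_of_mem {x : ℝ} (hx : x ∈ M.bandB) : M.base x = M.lowerEnd x := by simp [base, hx]

theorem base_of_le {x : ℝ} (hα : M.δ < M.α) (hx : x ≤ M.crit) : M.base x = x :=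
  M.base_of_notMem fun h => absurd (M.crit_lt_of_mem_bandB hα h) (not_lt.2 hx)

theorem bandPath_zero (x : ℝ) : M.bandPath 0 x = x := by simp [bandPath]

theorem bandPath_of_pos {t : ℝ} (ht : 0 < t) (x : ℝ) :
    M.bandPath t x = min (M.flow t (M.base x)) (M.top (M.base x)) := by
  simp [bandPath, not_le.2 ht]

theorem δ_lt_α (hα : M.q < M.α) : M.δ < M.α := by
  have := M.lam_pos
  rw [q] at hα; linarith

theorem level_pos : 0 < M.p / (M.δ - M.r) := div_pos M.p_pos (sub_pos.2 M.r_lt_δ)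

theorem top_le {y z : ℝ} (hz : z ∈ M.bandA ∪ Ici (M.p / (M.δ - M.r) + 1)) (hyz : y ≤ z) :
    M.top y ≤ z := csInf_le ⟨y, fun _ hw => hw.2⟩ ⟨hz, hyz⟩

theorem notMem_bandA_of_lt_top {y z : ℝ} (hz : z ∈ Ico y (M.top y)) : z ∉ M.bandA := fun h =>
  absurd (M.top_le (Or.inl h) hz.1) (not_le.2 hz.2)

section

variable (hα : M.q < M.α)
include hα

theorem base_le (x : ℝ) : M.base x ≤ x := by
  by_cases h : x ∈ M.bandB
  · rw [M.base_of_mem h]; exact (M.lowerEnd_lt (M.δ_lt_α hα) h).le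
  · rw [M.base_of_notMem h]

/-- Besides ordering the levels, monotonicity supplies the measurability of `base`; `top_mono` does
the same for `top`. -/
theorem base_mono : Monotone M.base := fun x y hxy => by
  by_cases hy : y ∈ M.bandB
  · rw [M.base_of_mem hy]
    rcases le_or_gt x (M.lowerEnd y) with h | h
    · exact (M.base_le hα x).trans h
    · have hx := M.Ioc_lowerEnd_subset (M.δ_lt_α hα) hy ⟨h, hxy⟩
      rw [M.base_of_mem hx]
      refine csInf_le ⟨_, M.bddBelow_lowerEnd (M.δ_lt_α hα) hx⟩ ?_
      exact (Ioc_subset_Ioc_right hxy).trans (M.Ioc_lowerEnd_subset (M.δ_lt_α hα) hy)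
  · rw [M.base_of_notMem hy]; exact (M.base_le hα x).trans hxy

theorem base_notMem (x : ℝ) : M.base x ∉ M.bandB := by
  by_cases h : x ∈ M.bandB
  · rw [M.base_of_mem h]; exact M.lowerEnd_notMem_bandB (M.δ_lt_α hα) h
  · rwa [M.base_of_notMem h]

/-- The levels just above `crit` lie in `𝒞`, so no component of `ℬ` reaches down to `crit`. The
prescribed lump sums therefore never cause ruin. -/
theorem crit_lt_base {x : ℝ} (hx : M.crit < x) : M.crit < M.base x := by
  by_cases h : x ∈ M.bandB
  · rw [M.base_of_mem h]
    refine (M.crit_le_lowerEnd (M.δ_lt_α hα) h).lt_of_ne fun he => ?_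
    obtain ⟨z, hz1, hz2⟩ := exists_between (lt_min hx M.crit_neg)
    have hC := M.bandC_of_neg (M.δ_lt_α hα) hα ⟨hz1, hz2.trans_le (min_le_right _ _)⟩
    refine hC.2 (Or.inr (M.Ioc_lowerEnd_subset (M.δ_lt_α hα) h ⟨?_, ?_⟩))
    · rwa [← he]
    · exact hz2.le.trans (min_le_left _ _)
  · rwa [M.base_of_notMem h]

theorem v_base {x : ℝ} : M.v x = M.v (M.base x) + (x - M.base x) := by
  by_cases h : x ∈ M.bandB
  · rw [M.base_of_mem h]; exact M.v_eq_lowerEnd (M.δ_lt_α hα) h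
  · rw [M.base_of_notMem h]; ring

theorem top_mem (y : ℝ) : M.top y ∈ (M.bandA ∪ Ici (M.p / (M.δ - M.r) + 1)) ∩ Ici y := by
  refine IsClosed.csInf_mem ?_ ?_ ⟨y, fun _ hw => hw.2⟩
  · exact ((M.isClosed_bandA (M.δ_lt_α hα)).union isClosed_Ici).inter isClosed_Ici
  · exact ⟨max (M.p / (M.δ - M.r) + 1) y, Or.inr (mem_Ici.2 (le_max_left _ _)), mem_Ici.2 (le_max_right _ _)⟩

theorem le_top (y : ℝ) : y ≤ M.top y := (M.top_mem hα y).2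

theorem top_mono : Monotone M.top := fun _ z hyz =>
  M.top_le (M.top_mem hα z).1 (hyz.trans (M.le_top hα z))

theorem top_eq_of_le {y z : ℝ} (hyz : y ≤ z) (hz : z ≤ M.top y) : M.top z = M.top y :=
  le_antisymm (M.top_le (M.top_mem hα y).1 hz) (M.top_mono hα hyz)

theorem top_of_mem_bandA {y : ℝ} (hy : y ∈ M.bandA) : M.top y = y :=
  le_antisymm (M.top_le (Or.inl hy) le_rfl) (M.le_top hα y)

theorem top_of_le {y : ℝ} (hy : y ≤ M.crit) : M.top y = M.crit := by
  refine le_antisymm (M.top_le (Or.inl (M.crit_mem_bandA (M.δ_lt_α hα))) hy) ?_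
  rcases (M.top_mem hα y).1 with h | h
  · exact h.1
  · have := M.crit_neg
    have := M.level_pos
    have h' : M.p / (M.δ - M.r) + 1 ≤ M.top y := h
    linarith

/-- The ray in the definition of `top` only makes the set nonempty. Its initial level lies in a
component of `ℬ` whose lower end is in `𝒜`, and a level outside `ℬ` is at or below that end. -/
theorem top_mem_bandA {y : ℝ} (hy : y ∉ M.bandB) : M.top y ∈ M.bandA := by
  have hα' := M.δ_lt_α hα
  rcases le_or_gt y M.crit with h | h
  · rw [M.top_of_le hα h]; exact M.crit_mem_bandA hα'
  set x := M.p / (M.δ - M.r) + 1 with hx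
  have hxB : x ∈ M.bandB := M.bandB_of_lt hα' (lt_add_one _)
  have hyl : y ≤ M.lowerEnd x := by
    by_contra! hlt
    rcases le_or_gt y x with h1 | h1
    · exact hy (M.Ioc_lowerEnd_subset hα' hxB ⟨hlt, h1⟩)
    · exact hy (M.bandB_of_lt hα' ((lt_add_one _).trans h1))
  have h1 := M.top_le (Or.inl (M.lowerEnd_mem_bandA hα' hxB)) hyl
  refine (M.top_mem hα y).1.resolve_right fun h2 => ?_
  exact absurd (h1.trans_lt (M.lowerEnd_lt hα' hxB)) (not_lt.2 h2)

theorem mem_bandC_of_lt_top {y z : ℝ} (hy : y ∉ M.bandB) (hcy : M.crit < y)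
    (hz : z ∈ Ico y (M.top y)) : z ∈ M.bandC := by
  have hyA := M.notMem_bandA_of_lt_top (z := y) ⟨le_rfl, hz.1.trans_lt hz.2⟩
  have hyC : y ∈ M.bandC := ⟨hcy.le, fun h => h.elim hyA hy⟩
  exact M.mem_bandC_of_Ico (M.δ_lt_α hα) hyC (fun w hw => M.notMem_bandA_of_lt_top hw) hz

theorem bandPath_of_le {x : ℝ} (hx : x ≤ M.crit) {t : ℝ} (ht : 0 ≤ t) :
    M.bandPath t x = M.flow t x := by
  rcases ht.eq_or_lt with rfl | ht
  · rw [M.bandPath_zero, M.flow_zero]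
  · rw [M.bandPath_of_pos ht, M.base_of_le (M.δ_lt_α hα) hx, M.top_of_le hα hx,
      min_eq_left (M.flow_le_crit hx t)]

theorem bandPath_of_gt {x : ℝ} (hx : M.crit < x) {t : ℝ} (ht : 0 < t) :
    M.bandPath t x = M.E (min (M.H (M.base x) + t) (M.H (M.top (M.base x)))) := by
  have hb := M.crit_lt_base hα hx
  rw [M.bandPath_of_pos ht, M.flow_of_gt hb, M.E_mono.map_min,
    M.E_H (hb.trans_le (M.le_top hα _))]

theorem bandPath_notMem_bandB {t : ℝ} (ht : 0 < t) (x : ℝ) : M.bandPath t x ∉ M.bandB := by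
  have hα' := M.δ_lt_α hα
  rcases le_or_gt x M.crit with hx | hx
  · rw [M.bandPath_of_le hα hx ht.le]
    exact fun h => absurd (M.crit_lt_of_mem_bandB hα' h) (not_lt.2 (M.flow_le_crit hx t))
  · have hb := M.crit_lt_base hα hx
    rw [M.bandPath_of_pos ht]
    rcases lt_or_ge (M.flow t (M.base x)) (M.top (M.base x)) with h | h
    · rw [min_eq_left h.le]
      have h1 : M.base x ≤ M.flow t (M.base x) := by
        rw [M.flow_of_gt hb, M.le_E_iff hb]; linarith
      exact fun hB => (M.mem_bandC_of_lt_top hα (M.base_notMem hα x) hb ⟨h1, h⟩).2 (Or.inr hB)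
    · rw [min_eq_right h]
      exact fun hB => M.notMem_bandA_of_bandB hB (M.top_mem_bandA hα (M.base_notMem hα x))

/-- After a positive time the path is outside `ℬ`, so a restart triggers no second lump sum and has
the same target level. -/
theorem bandPath_add {s t : ℝ} (hs : 0 < s) (ht : 0 ≤ t) (x : ℝ) :
    M.bandPath (s + t) x = M.bandPath t (M.bandPath s x) := by
  have hα' := M.δ_lt_α hα
  rcases ht.eq_or_lt with rfl | ht
  · rw [add_zero, M.bandPath_zero]
  rcases le_or_gt x M.crit with hx | hx
  · rw [M.bandPath_of_le hα hx (by linarith), M.bandPath_of_le hα hx hs.le,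
      M.bandPath_of_le hα (M.flow_le_crit hx s) ht.le, M.flow_add]
  have hb := M.crit_lt_base hα hx
  have hz := M.base_of_notMem (M.bandPath_notMem_bandB hα hs x)
  have hab := M.le_top hα (M.base x)
  have hH := M.H_le_H hb hab
  have hzE := M.bandPath_of_gt hα hx hs
  have hzc : M.crit < M.bandPath s x := by rw [hzE]; exact M.crit_lt_E _
  have hle : M.base x ≤ M.bandPath s x := by
    rw [hzE, M.le_E_iff hb]; exact le_min (by linarith) hH
  have htop : M.top (M.bandPath s x) = M.top (M.base x) :=
    M.top_eq_of_le hα hle (by rw [M.bandPath_of_pos hs]; exact min_le_right _ _)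
  rw [M.bandPath_of_gt hα hzc ht, hz, htop, hzE, M.H_E, M.bandPath_of_gt hα hx (by linarith)]
  congr 1
  rcases le_total (M.H (M.base x) + s) (M.H (M.top (M.base x))) with h | h
  · rw [min_eq_left h, add_assoc]
  · rw [min_eq_right h, min_eq_right (by linarith), min_eq_right (by linarith)]

theorem measurable_bandPath : Measurable fun z : ℝ × ℝ => M.bandPath z.1 z.2 := by
  have h1 := (M.base_mono hα).measurable
  have h2 := (M.top_mono hα).measurable
  unfold bandPath
  refine Measurable.ite (measurableSet_le measurable_fst measurable_const) measurable_snd ?_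
  refine Measurable.min (M.measurable_flow.comp (measurable_fst.prodMk (h1.comp measurable_snd))) ?_
  exact h2.comp (h1.comp measurable_snd)

end

end RiskModel

/-! ### Conservation of value along the band path -/

namespace RiskModel

variable {Ω : Type*} [MeasurableSpace Ω] {P : Measure Ω} (M : RiskModel P)

/-- The dividend rate under the band rule. -/
def payRate : ℝ → ℝ := M.bandA.indicator M.drift

/-- The band path started at a level outside `ℬ`. -/
def restPath (y t : ℝ) : ℝ := min (M.flow t y) (M.top y)

theorem payRate_nonneg (x : ℝ) : 0 ≤ M.payRate x :=
  indicator_nonneg (fun _ h => M.drift_nonneg h.1) x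

theorem continuous_restPath (y : ℝ) : Continuous (M.restPath y) :=
  (M.continuous_flow_time y).min continuous_const

theorem payRate_of_le {x : ℝ} (hx : x ≤ M.crit) : M.payRate x = 0 := by
  by_cases h : x ∈ M.bandA
  · rw [payRate, indicator_of_mem h, le_antisymm hx h.1, M.drift_crit]
  · rw [payRate, indicator_of_notMem h]

theorem bandPath_eq_restPath {t : ℝ} (ht : 0 < t) (x : ℝ) :
    M.bandPath t x = M.restPath (M.base x) t := M.bandPath_of_pos ht x

section

variable (hα : M.q < M.α)
include hα

theorem measurable_payRate : Measurable M.payRate :=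
  M.continuous_drift.measurable.indicator (M.isClosed_bandA (M.δ_lt_α hα)).measurableSet

theorem restPath_zero (y : ℝ) : M.restPath y 0 = y := by
  rw [restPath, M.flow_zero, min_eq_left (M.le_top hα y)]

theorem restPath_of_le {y : ℝ} (hy : y ≤ M.crit) (t : ℝ) : M.restPath y t = M.flow t y := by
  rw [restPath, M.top_of_le hα hy, min_eq_left (M.flow_le_crit hy t)]

theorem restPath_of_gt {y : ℝ} (hy : M.crit < y) (t : ℝ) :
    M.restPath y t = M.E (min (M.H y + t) (M.H (M.top y))) := by
  rw [restPath, M.flow_of_gt hy, M.E_mono.map_min, M.E_H (hy.trans_le (M.le_top hα _))]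

theorem restPath_of_ge {y : ℝ} (hy : M.crit < y) {t : ℝ} (ht : M.H (M.top y) - M.H y ≤ t) :
    M.restPath y t = M.top y := by
  rw [M.restPath_of_gt hα hy, min_eq_right (by linarith), M.E_H (hy.trans_le (M.le_top hα _))]

theorem payRate_of_lt {y : ℝ} (hy : M.crit < y) {t : ℝ} (h0 : 0 ≤ t)
    (ht : t < M.H (M.top y) - M.H y) : M.payRate (M.restPath y t) = 0 := by
  rw [payRate, indicator_of_notMem]
  refine M.notMem_bandA_of_lt_top (y := y) ?_
  rw [M.restPath_of_gt hα hy, min_eq_left (by linarith)]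
  exact ⟨(M.le_E_iff hy).2 (by linarith),
    (M.E_lt_iff (hy.trans_le (M.le_top hα _))).2 (by linarith)⟩

theorem intervalIntegrable_payRate {f : ℝ → ℝ} (hf : Continuous f) {w : ℝ → ℝ} (hw : Continuous w)
    (a b : ℝ) : IntervalIntegrable (fun u => w u * M.payRate (f u)) volume a b := by
  have h1 : (fun u => w u * M.payRate (f u)) =
      (f ⁻¹' M.bandA).indicator fun u => w u * M.drift (f u) := by
    ext u; by_cases h : f u ∈ M.bandA
    · rw [indicator_of_mem (by exact h), payRate, indicator_of_mem h]
    · rw [indicator_of_notMem (by exact h), payRate, indicator_of_notMem h, mul_zero]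
  rw [h1, intervalIntegrable_iff]
  refine IntegrableOn.indicator ?_ ((M.isClosed_bandA (M.δ_lt_α hα)).preimage hf).measurableSet
  rw [← intervalIntegrable_iff]
  exact (hw.mul (M.continuous_drift.comp hf)).intervalIntegrable _ _

/-- The path follows the flow without payment and then rests at `top`, a point of `𝒜`, where the
dividend rate cancels the drift. At the hitting time there is a corner, hence the fundamental
theorem with right derivatives. -/
theorem restPath_integral {y : ℝ} (hy : y ∉ M.bandB) {t : ℝ} (ht : 0 ≤ t) :
    (∫ s in (0 : ℝ)..t, M.drift (M.restPath y s)) - ∫ s in (0 : ℝ)..t, M.payRate (M.restPath y s) =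
      M.restPath y t - y := by
  have hc := M.continuous_restPath y
  have h1 : IntervalIntegrable (fun s => M.drift (M.restPath y s)) volume 0 t :=
    (M.continuous_drift.comp hc).intervalIntegrable _ _
  have h2 : IntervalIntegrable (fun s => M.payRate (M.restPath y s)) volume 0 t := by
    simpa using M.intervalIntegrable_payRate hα hc (w := fun _ => 1) continuous_const 0 t
  rw [← intervalIntegral.integral_sub h1 h2]
  rw [show M.restPath y t - y = M.restPath y t - M.restPath y 0 by rw [M.restPath_zero hα]]
  refine intervalIntegral.integral_eq_sub_of_hasDeriv_right_of_le ht hc.continuousOn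
    (fun s hs => ?_) (h1.sub h2)
  rcases le_or_gt y M.crit with h | h
  · have e : M.restPath y = fun s => M.flow s y := funext (M.restPath_of_le hα h)
    rw [e, M.payRate_of_le (M.flow_le_crit h s), sub_zero]
    exact (M.hasDerivAt_flow_time y s).hasDerivWithinAt
  rcases lt_or_ge s (M.H (M.top y) - M.H y) with hlt | hge
  · rw [M.payRate_of_lt hα h hs.1.le hlt, sub_zero]
    have e : M.restPath y s = M.flow s y := by
      rw [M.restPath_of_gt hα h, M.flow_of_gt h, min_eq_left (by linarith)]
    rw [e]
    refine ((M.hasDerivAt_flow_time y s).congr_of_eventuallyEq ?_).hasDerivWithinAt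
    filter_upwards [Iio_mem_nhds hlt] with w hw
    have hw : w < M.H (M.top y) - M.H y := hw
    rw [M.restPath_of_gt hα h, M.flow_of_gt h, min_eq_left (by linarith)]
  · rw [M.restPath_of_ge hα h hge, payRate, indicator_of_mem (M.top_mem_bandA hα hy), sub_self]
    refine (hasDerivWithinAt_const s _ (M.top y)).congr (fun w hw => ?_)
      (M.restPath_of_ge hα h hge)
    exact M.restPath_of_ge hα h (hge.trans (le_of_lt hw))

theorem intervalIntegrable_reward (y a b : ℝ) : IntervalIntegrable (fun u => Real.exp (-M.q * u) *
    (M.payRate (M.restPath y u) + M.lam * M.claimMean M.v (M.restPath y u))) volume a b := by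
  have hc := M.continuous_restPath y
  have h1 := M.intervalIntegrable_payRate hα hc (w := fun u => Real.exp (-M.q * u))
    (by fun_prop) a b
  have h2 : Continuous fun u => Real.exp (-M.q * u) *
      (M.lam * M.claimMean M.v (M.restPath y u)) := by
    have := (M.continuous_claimMean (M.δ_lt_α hα)).comp hc
    have : Continuous fun u => M.claimMean M.v (M.restPath y u) := this
    fun_prop
  simp only [mul_add]
  exact h1.add (h2.intervalIntegrable _ _)

/-- The band rule loses no value. On the way to `top` the path is in `𝒞`, where `flowValue` is
constant; at `top`, `G v = 0` says that dividends and claim rewards together arrive at rate `q v`.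
-/
theorem restPath_value {y : ℝ} (hy : y ∉ M.bandB) {s t : ℝ} (hs : 0 ≤ s) (hst : s ≤ t) :
    Real.exp (-M.q * s) * M.v (M.restPath y s) = Real.exp (-M.q * t) * M.v (M.restPath y t) +
      ∫ u in s..t, Real.exp (-M.q * u) *
        (M.payRate (M.restPath y u) + M.lam * M.claimMean M.v (M.restPath y u)) := by
  have hα' := M.δ_lt_α hα
  have hv := M.isSuper_v hα'
  rcases le_or_gt y M.crit with h | h
  · have e : ∀ u, M.restPath y u ≤ M.crit := fun u => by
      rw [M.restPath_of_le hα h]; exact M.flow_le_crit h u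
    simp [hv.zero _ (e _), M.payRate_of_le (e _), hv.claimMean_of_le (e _)]
  set θ := M.H (M.top y) - M.H y with hθ
  have hyt := M.le_top hα y
  have hθ0 : 0 ≤ θ := sub_nonneg.2 (M.H_le_H h hyt)
  -- before the level is reached
  have before : ∀ s t, 0 ≤ s → s ≤ t → t ≤ θ → Real.exp (-M.q * s) * M.v (M.restPath y s) =
      Real.exp (-M.q * t) * M.v (M.restPath y t) + ∫ u in s..t, Real.exp (-M.q * u) *
        (M.payRate (M.restPath y u) + M.lam * M.claimMean M.v (M.restPath y u)) := by
    intro s t hs hst ht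
    have hZ : ∀ u, u ≤ θ → M.restPath y u = M.E (M.H y + u) := fun u hu => by
      rw [M.restPath_of_gt hα h, min_eq_left (by linarith)]
    have hconst : M.flowValue (M.H y + s) = M.flowValue (M.H y + t) := by
      by_cases hA : y ∈ M.bandA
      · have : θ = 0 := by rw [hθ, M.top_of_mem_bandA hα hA, sub_self]
        have h1 : s = t := by linarith
        rw [h1]
      · have hC : y ∈ M.bandC := ⟨h.le, fun h' => h'.elim hA hy⟩
        have := M.flowValue_const_of_Ico hα' hC hyt fun z hz => M.notMem_bandA_of_lt_top hz
        exact (this (M.H y + s) ⟨by linarith, by linarith⟩).trans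
          (this (M.H y + t) ⟨by linarith, by linarith⟩).symm
    have hint : ∫ u in s..t, Real.exp (-M.q * u) *
        (M.payRate (M.restPath y u) + M.lam * M.claimMean M.v (M.restPath y u)) =
        Real.exp (M.q * M.H y) * M.running M.v (M.H y + s) (M.H y + t) := by
      rw [running, ← intervalIntegral.integral_const_mul, add_comm (M.H y) s, add_comm (M.H y) t,
        ← intervalIntegral.integral_comp_add_right]
      rw [intervalIntegral.integral_of_le hst, intervalIntegral.integral_of_le hst,
        integral_Ioc_eq_integral_Ioo, integral_Ioc_eq_integral_Ioo]
      refine setIntegral_congr_fun measurableSet_Ioo fun u hu => ?_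
      have e1 : Real.exp (-M.q * u) = Real.exp (M.q * M.H y) * Real.exp (-M.q * (u + M.H y)) := by
        rw [← Real.exp_add]; congr 1; ring
      rw [M.payRate_of_lt hα h (hs.trans hu.1.le) (hu.2.trans_le ht), zero_add,
        hZ u (hu.2.le.trans ht), add_comm (M.H y) u, e1, mul_assoc]
    have hr := hv.running_add M 0 (M.H y + s) (M.H y + t)
    simp only [flowValue] at hconst
    rw [hint, hZ s (hst.trans ht), hZ t ht]
    have e : ∀ u, Real.exp (-M.q * u) = Real.exp (M.q * M.H y) * Real.exp (-M.q * (M.H y + u)) :=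
      fun u => by rw [← Real.exp_add]; congr 1; ring
    rw [e s, e t]
    linear_combination Real.exp (M.q * M.H y) * (hconst - hr)
  -- after the level is reached
  have after : ∀ s t, θ ≤ s → s ≤ t → Real.exp (-M.q * s) * M.v (M.restPath y s) =
      Real.exp (-M.q * t) * M.v (M.restPath y t) + ∫ u in s..t, Real.exp (-M.q * u) *
        (M.payRate (M.restPath y u) + M.lam * M.claimMean M.v (M.restPath y u)) := by
    intro s t hs hst
    have hZ : ∀ u, θ ≤ u → M.restPath y u = M.top y := fun u hu => M.restPath_of_ge hα h hu
    have hA := M.top_mem_bandA hα hy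
    have hG := hA.2
    rw [M.G_v hα'] at hG
    have hint : ∫ u in s..t, Real.exp (-M.q * u) *
        (M.payRate (M.restPath y u) + M.lam * M.claimMean M.v (M.restPath y u)) =
        ∫ u in s..t, Real.exp (-M.q * u) * (M.q * M.v (M.top y)) := by
      refine intervalIntegral.integral_congr fun u hu => ?_
      rw [uIcc_of_le hst] at hu
      rw [hZ u (hs.trans hu.1), payRate, indicator_of_mem hA]
      congr 1; linarith
    have hd : ∀ u ∈ uIcc s t, HasDerivAt (fun u => -(Real.exp (-M.q * u) * M.v (M.top y)))
        (Real.exp (-M.q * u) * (M.q * M.v (M.top y))) u := fun u _ =>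
      (((((hasDerivAt_id' u).const_mul (-M.q)).exp).mul_const (M.v (M.top y))).neg).congr_deriv
        (by ring)
    rw [hint, intervalIntegral.integral_eq_sub_of_hasDerivAt hd
      (Continuous.intervalIntegrable (by fun_prop) _ _), hZ s hs, hZ t (hs.trans hst)]
    ring
  rcases le_total t θ with h1 | h1
  · exact before s t hs hst h1
  rcases le_total θ s with h2 | h2
  · exact after s t h2 hst
  rw [before s θ hs h2 le_rfl, after θ t le_rfl h1, add_assoc, add_comm (∫ u in θ..t, _),
    intervalIntegral.integral_add_adjacent_intervals (M.intervalIntegrable_reward hα y _ _)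
      (M.intervalIntegrable_reward hα y _ _)]

/-- The integral equation of the band path. -/
theorem bandPath_integral (x : ℝ) {a t : ℝ} (hat : a ≤ t) :
    IntervalIntegrable (fun u => M.drift (M.bandPath (u - a) x)) volume a t ∧
    IntervalIntegrable (fun u => M.payRate (M.bandPath (u - a) x)) volume a t ∧
    M.bandPath (t - a) x = x + (∫ u in a..t, M.drift (M.bandPath (u - a) x)) -
      ((if a < t then x - M.base x else 0) + ∫ u in a..t, M.payRate (M.bandPath (u - a) x)) := by
  set y := M.base x with hy
  have hcy := M.continuous_restPath y
  have hc : Continuous fun u => M.restPath y (u - a) := hcy.comp (by fun_prop)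
  have h1 : IntervalIntegrable (fun u => M.drift (M.restPath y (u - a))) volume a t :=
    (M.continuous_drift.comp hc).intervalIntegrable _ _
  have h2 : IntervalIntegrable (fun u => M.payRate (M.restPath y (u - a))) volume a t := by
    simpa using M.intervalIntegrable_payRate hα hc (w := fun _ => 1) continuous_const a t
  have he : ∀ u ∈ uIoc a t, M.restPath y (u - a) = M.bandPath (u - a) x := fun u hu => by
    rw [uIoc_of_le hat] at hu
    rw [M.bandPath_eq_restPath (sub_pos.2 hu.1)]
  have h3 := h1.congr (fun u hu => by simp only [he u hu] :
    EqOn _ (fun u => M.drift (M.bandPath (u - a) x)) (uIoc a t))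
  have h4 := h2.congr (fun u hu => by simp only [he u hu] :
    EqOn _ (fun u => M.payRate (M.bandPath (u - a) x)) (uIoc a t))
  refine ⟨h3, h4, ?_⟩
  rcases hat.eq_or_lt with rfl | hlt
  · simp [M.bandPath_zero]
  have e1 : ∫ u in a..t, M.drift (M.bandPath (u - a) x) =
      ∫ s in (0 : ℝ)..(t - a), M.drift (M.restPath y s) := by
    rw [← sub_self a, ← intervalIntegral.integral_comp_sub_right (fun s => M.drift (M.restPath y s))]
    refine intervalIntegral.integral_congr_ae (Eventually.of_forall fun u hu => ?_)
    rw [he u hu]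
  have e2 : ∫ u in a..t, M.payRate (M.bandPath (u - a) x) =
      ∫ s in (0 : ℝ)..(t - a), M.payRate (M.restPath y s) := by
    rw [← sub_self a, ← intervalIntegral.integral_comp_sub_right (fun s => M.payRate (M.restPath y s))]
    refine intervalIntegral.integral_congr_ae (Eventually.of_forall fun u hu => ?_)
    rw [he u hu]
  have h5 := M.restPath_integral hα (M.base_notMem hα x) (sub_nonneg.2 hat)
  rw [e1, e2, if_pos hlt, M.bandPath_eq_restPath (sub_pos.2 hlt)]
  rw [← hy] at h5 ⊢
  linarith

theorem ofReal_integral_reward {y a s t : ℝ} (hst : s ≤ t) :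
    ENNReal.ofReal (Real.exp (-M.q * a) * ∫ u in (s - a)..(t - a), Real.exp (-M.q * u) *
        (M.payRate (M.restPath y u) + M.lam * M.claimMean M.v (M.restPath y u))) =
      (∫⁻ u in Ioo s t, ENNReal.ofReal (Real.exp (-M.q * u)) *
          ENNReal.ofReal (M.payRate (M.restPath y (u - a)))) +
        ∫⁻ u in Ioo s t, M.pathGain (fun u => M.restPath y (u - a)) u := by
  have hα' := M.δ_lt_α hα
  have hv := M.isSuper_v hα'
  have hc : Continuous fun u => M.restPath y (u - a) :=
    (M.continuous_restPath y).comp (by fun_prop)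
  have e : ∀ u, Real.exp (-M.q * u) = Real.exp (-M.q * a) * Real.exp (-M.q * (u - a)) := fun u => by
    rw [← Real.exp_add]; congr 1; ring
  rw [← intervalIntegral.integral_comp_sub_right (fun u => Real.exp (-M.q * u) *
        (M.payRate (M.restPath y u) + M.lam * M.claimMean M.v (M.restPath y u))),
    ← intervalIntegral.integral_const_mul]
  simp only [← mul_assoc, ← e]
  have hm1 : Measurable fun u => ENNReal.ofReal (Real.exp (-M.q * u)) *
          ENNReal.ofReal (M.payRate (M.restPath y (u - a))) := by
    have : Measurable fun u => M.payRate (M.restPath y (u - a)) :=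
      (M.measurable_payRate hα).comp hc.measurable
    fun_prop
  have hn : ∀ u, 0 ≤ M.payRate (M.restPath y (u - a)) +
      M.lam * M.claimMean M.v (M.restPath y (u - a)) := fun u =>
    add_nonneg (M.payRate_nonneg _) (mul_nonneg M.lam_pos.le (hv.claimMean_nonneg _))
  have hi : IntervalIntegrable (fun u => Real.exp (-M.q * u) *
      (M.payRate (M.restPath y (u - a)) + M.lam * M.claimMean M.v (M.restPath y (u - a))))
      volume s t := by
    simp only [mul_add]
    refine (M.intervalIntegrable_payRate hα hc (by fun_prop) s t).add ?_
    have : Continuous fun u => M.claimMean M.v (M.restPath y (u - a)) :=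
      (M.continuous_claimMean hα').comp hc
    exact Continuous.intervalIntegrable (by fun_prop) _ _
  rw [intervalIntegral.integral_of_le hst, integral_Ioc_eq_integral_Ioo,
    ofReal_integral_eq_lintegral_ofReal, ← lintegral_add_left hm1]
  · refine lintegral_congr fun u => ?_
    rw [pathGain, ← ENNReal.ofReal_mul (Real.exp_pos _).le, ← ENNReal.ofReal_add]
    · congr 1; ring
    · exact mul_nonneg (Real.exp_pos _).le (M.payRate_nonneg _)
    · exact mul_nonneg (Real.exp_pos _).le (mul_nonneg M.lam_pos.le (hv.claimMean_nonneg _))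
  · rw [intervalIntegrable_iff_integrableOn_Ioo_of_le hst] at hi
    exact hi
  · exact Eventually.of_forall fun u => mul_nonneg (Real.exp_pos _).le (hn u)

theorem restPath_pathValue {y : ℝ} (hy : y ∉ M.bandB) {a s t : ℝ} (has : a ≤ s) (hst : s ≤ t) :
    M.pathValue (fun u => M.restPath y (u - a)) s = M.pathValue (fun u => M.restPath y (u - a)) t +
      ((∫⁻ u in Ioo s t, ENNReal.ofReal (Real.exp (-M.q * u)) *
          ENNReal.ofReal (M.payRate (M.restPath y (u - a)))) +
        ∫⁻ u in Ioo s t, M.pathGain (fun u => M.restPath y (u - a)) u) := by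
  have hv := M.isSuper_v (M.δ_lt_α hα)
  have e : ∀ u, Real.exp (-M.q * u) = Real.exp (-M.q * a) * Real.exp (-M.q * (u - a)) := fun u => by
    rw [← Real.exp_add]; congr 1; ring
  have h := M.restPath_value hα hy (sub_nonneg.2 has) (sub_le_sub_right hst a)
  rw [← M.ofReal_integral_reward hα hst, pathValue, pathValue, ← ENNReal.ofReal_add, e s, e t,
    mul_assoc, h, mul_add, mul_assoc]
  · exact mul_nonneg (Real.exp_pos _).le (hv.nonneg _)
  · refine mul_nonneg (Real.exp_pos _).le (intervalIntegral.integral_nonneg (by linarith) fun u _ => ?_)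
    exact mul_nonneg (Real.exp_pos _).le
      (add_nonneg (M.payRate_nonneg _) (mul_nonneg M.lam_pos.le (hv.claimMean_nonneg _)))

theorem bandPath_pathValue (x : ℝ) {a s t : ℝ} (has : a < s) (hst : s ≤ t) :
    M.pathValue (fun u => M.bandPath (u - a) x) s = M.pathValue (fun u => M.bandPath (u - a) x) t +
      ((∫⁻ u in Ioo s t, ENNReal.ofReal (Real.exp (-M.q * u)) *
          ENNReal.ofReal (M.payRate (M.bandPath (u - a) x))) +
        ∫⁻ u in Ioo s t, M.pathGain (fun u => M.bandPath (u - a) x) u) := by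
  have h := M.restPath_pathValue hα (M.base_notMem hα x) has.le hst
  have e : ∀ u, a < u → M.bandPath (u - a) x = M.restPath (M.base x) (u - a) := fun u hu =>
    M.bandPath_eq_restPath (sub_pos.2 hu) x
  simp only [pathValue, e s has, e t (has.trans_le hst)] at h ⊢
  rw [h]
  congr 2 <;> refine setLIntegral_congr_fun measurableSet_Ioo fun u hu => ?_
  · simp only [e u (has.trans hu.1)]
  · simp only [pathGain, e u (has.trans hu.1)]

/-- The initial lump sum crosses a component of `ℬ`, where `v` has slope one, so it is exchanged for
value at par. -/
theorem bandPath_pathValue_start (x : ℝ) {a t : ℝ} (hat : a < t) :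
    M.pathValue (fun u => M.bandPath (u - a) x) a =
      M.pathValue (fun u => M.bandPath (u - a) x) t +
      (ENNReal.ofReal (Real.exp (-M.q * a)) * ENNReal.ofReal (x - M.base x) +
        (∫⁻ u in Ioo a t, ENNReal.ofReal (Real.exp (-M.q * u)) *
          ENNReal.ofReal (M.payRate (M.bandPath (u - a) x))) +
        ∫⁻ u in Ioo a t, M.pathGain (fun u => M.bandPath (u - a) x) u) := by
  have hv := M.isSuper_v (M.δ_lt_α hα)
  have h := M.restPath_pathValue hα (M.base_notMem hα x) le_rfl hat.le
  have e : ∀ u, a < u → M.bandPath (u - a) x = M.restPath (M.base x) (u - a) := fun u hu =>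
    M.bandPath_eq_restPath (sub_pos.2 hu) x
  have h1 : M.pathValue (fun u => M.bandPath (u - a) x) a =
      M.pathValue (fun u => M.restPath (M.base x) (u - a)) a +
        ENNReal.ofReal (Real.exp (-M.q * a)) * ENNReal.ofReal (x - M.base x) := by
    simp only [pathValue, sub_self, M.bandPath_zero, M.restPath_zero hα]
    rw [← ENNReal.ofReal_mul (Real.exp_pos _).le, ← ENNReal.ofReal_add, ← mul_add, ← M.v_base hα]
    · exact mul_nonneg (Real.exp_pos _).le (hv.nonneg _)
    · exact mul_nonneg (Real.exp_pos _).le (sub_nonneg.2 (M.base_le hα x))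
  have h2 : M.pathValue (fun u => M.bandPath (u - a) x) t =
      M.pathValue (fun u => M.restPath (M.base x) (u - a)) t := by
    simp only [pathValue, e t hat]
  have h3 : ∫⁻ u in Ioo a t, ENNReal.ofReal (Real.exp (-M.q * u)) *
          ENNReal.ofReal (M.payRate (M.bandPath (u - a) x)) =
      ∫⁻ u in Ioo a t, ENNReal.ofReal (Real.exp (-M.q * u)) *
          ENNReal.ofReal (M.payRate (M.restPath (M.base x) (u - a))) :=
    setLIntegral_congr_fun measurableSet_Ioo fun u hu => by simp only [e u hu.1]
  have h4 : ∫⁻ u in Ioo a t, M.pathGain (fun u => M.bandPath (u - a) x) u =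
      ∫⁻ u in Ioo a t, M.pathGain (fun u => M.restPath (M.base x) (u - a)) u :=
    setLIntegral_congr_fun measurableSet_Ioo fun u hu => by simp only [pathGain, e u hu.1]
  rw [h1, h, h2, h3, h4]
  ring

end

end RiskModel

/-! ### The exponential distribution -/

theorem lintegral_expMeasure (l : ℝ) (f : ℝ → ℝ≥0∞) (hf : Measurable f) :
    ∫⁻ w, f w ∂(expMeasure l) =
      ∫⁻ w in Ioi 0, ENNReal.ofReal (l * Real.exp (-(l * w))) * f w := by
  have h0 : expMeasure l = volume.withDensity (exponentialPDF l) := rfl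
  have hm : Measurable (exponentialPDF l) :=
    (measurable_exponentialPDFReal l).ennreal_ofReal
  rw [h0, lintegral_withDensity_eq_lintegral_mul _ hm hf, setLIntegral_congr
    (Ioi_ae_eq_Ici (μ := volume)), ← lintegral_indicator measurableSet_Ici]
  refine lintegral_congr fun w => ?_
  by_cases hw : 0 ≤ w
  · rw [indicator_of_mem (by exact hw), Pi.mul_apply, exponentialPDF_of_nonneg hw]
  · rw [indicator_of_notMem (by exact hw), Pi.mul_apply, exponentialPDF_of_neg (not_le.1 hw),
      zero_mul]

theorem expMeasure_Ioi {l : ℝ} (hl : 0 < l) {w : ℝ} (hw : 0 ≤ w) :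
    expMeasure l (Ioi w) = ENNReal.ofReal (Real.exp (-(l * w))) := by
  rw [← lintegral_indicator_one measurableSet_Ioi, lintegral_expMeasure _ _
    (measurable_one.indicator measurableSet_Ioi)]
  have h1 : ∀ y, ENNReal.ofReal (l * Real.exp (-(l * y))) * (Ioi w).indicator 1 y =
      (Ioi w).indicator (fun y => ENNReal.ofReal (l * Real.exp (-(l * y)))) y := fun y => by
    by_cases h : y ∈ Ioi w <;> simp [h]
  simp only [h1]
  rw [lintegral_indicator measurableSet_Ioi, Measure.restrict_restrict measurableSet_Ioi,
    inter_eq_self_of_subset_left (Ioi_subset_Ioi hw)]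
  have hi : IntegrableOn (fun y => Real.exp (-l * y)) (Ioi w) :=
    integrableOn_exp_mul_Ioi (by linarith) w
  have hi' : IntegrableOn (fun y => l * Real.exp (-(l * y))) (Ioi w) := by
    have := hi.const_mul l
    simp only [neg_mul] at this
    exact this
  rw [← ofReal_integral_eq_lintegral_ofReal hi'
    (Eventually.of_forall fun y => mul_nonneg hl.le (Real.exp_pos _).le), integral_const_mul]
  congr 1
  have h2 := integral_exp_mul_Ioi (a := -l) (by linarith) w
  simp only [neg_mul] at h2
  rw [h2]; field_simp

theorem expMeasure_Iic {l : ℝ} (hl : 0 < l) : expMeasure l (Iic 0) = 0 := by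
  have := isProbabilityMeasure_expMeasure hl
  rw [← compl_Ioi, prob_compl_eq_zero_iff measurableSet_Ioi, expMeasure_Ioi hl le_rfl]
  simp

/-- Tonelli and the survival function: the exponential law has constant hazard rate `l`. This is the
compensator identity for a single waiting time. -/
theorem lintegral_expMeasure_integral {l : ℝ} (hl : 0 < l) (f : ℝ → ℝ≥0∞) (hf : Measurable f) :
    ∫⁻ w, ∫⁻ y in Ioo 0 w, ENNReal.ofReal l * f y ∂volume ∂(expMeasure l) =
      ∫⁻ w, f w ∂(expMeasure l) := by
  have := isProbabilityMeasure_expMeasure hl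
  have h1 : ∀ w, ∫⁻ y in Ioo 0 w, ENNReal.ofReal l * f y =
      ∫⁻ y in Ioi 0, (Ioi y).indicator (fun _ => ENNReal.ofReal l * f y) w := fun w => by
    have : ∀ y, (Ioi y).indicator (fun _ => ENNReal.ofReal l * f y) w =
        (Iio w).indicator (fun y => ENNReal.ofReal l * f y) y := fun y => by
      simp only [indicator, mem_Ioi, mem_Iio]
    simp only [this]
    rw [lintegral_indicator measurableSet_Iio, Measure.restrict_restrict measurableSet_Iio,
      inter_comm, Ioi_inter_Iio]
  simp only [h1]
  rw [lintegral_lintegral_swap, lintegral_expMeasure _ _ hf]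
  · refine setLIntegral_congr_fun measurableSet_Ioi fun y hy => ?_
    rw [lintegral_indicator_const measurableSet_Ioi, expMeasure_Ioi hl (le_of_lt hy),
      ENNReal.ofReal_mul hl.le]
    ring
  · have : (Function.uncurry fun w y => (Ioi y).indicator (fun _ => ENNReal.ofReal l * f y) w) =
        {z : ℝ × ℝ | z.2 < z.1}.indicator fun z => ENNReal.ofReal l * f z.2 := by
      ext z; simp only [Function.uncurry, indicator, mem_Ioi, mem_ofPred_eq]
    rw [this]
    exact (Measurable.indicator (by fun_prop)
      (measurableSet_lt measurable_snd measurable_fst)).aemeasurable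

namespace RiskModel

/-! ### Waiting times and claim sizes as sequences -/

/-- Sequences of waiting times and of claim sizes. -/
abbrev Seqs : Type := (ℕ → ℝ) × (ℕ → ℝ)

/-- The claim epochs, starting with `0`. -/
def epoch (ξ : Seqs) (k : ℕ) : ℝ := ∑ j ∈ Finset.range k, ξ.1 j

/-- Number of claims up to time `t`. -/
def count (ξ : Seqs) (t : ℝ) : ℕ := {i : ℕ | epoch ξ (i + 1) ≤ t}.ncard

/-- Aggregate claims up to time `t`. -/
def total (ξ : Seqs) (t : ℝ) : ℝ := ∑ i ∈ Finset.range (count ξ t), ξ.2 i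

/-- The sequences with all entries from index `k` on deleted. -/
def trunc (k : ℕ) (ξ : Seqs) : Seqs :=
  (fun i => if i < k then ξ.1 i else 0, fun i => if i < k then ξ.2 i else 0)

/-- The sequences with positive waiting times and nonnegative claims for which claims do not
accumulate. -/
def good : Set Seqs :=
  {ξ | (∀ i, 0 < ξ.1 i) ∧ (∀ i, 0 ≤ ξ.2 i) ∧ ∀ n : ℕ, ∃ k, (n : ℝ) ≤ epoch ξ k}

theorem epoch_zero (ξ : Seqs) : epoch ξ 0 = 0 := by simp [epoch]

theorem epoch_succ (ξ : Seqs) (k : ℕ) : epoch ξ (k + 1) = epoch ξ k + ξ.1 k :=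
  Finset.sum_range_succ _ _

theorem epoch_trunc {j k : ℕ} (h : j ≤ k) (ξ : Seqs) : epoch (trunc k ξ) j = epoch ξ j := by
  refine Finset.sum_congr rfl fun i hi => ?_
  simp only [trunc, (Finset.mem_range.1 hi).trans_le h, if_true]

theorem measurable_epoch (k : ℕ) : Measurable fun ξ => epoch ξ k := by
  unfold epoch; fun_prop

theorem measurable_trunc (k : ℕ) : Measurable (trunc k) := by
  unfold trunc
  refine Measurable.prodMk ?_ ?_ <;>
  · refine measurable_pi_lambda _ fun i => ?_
    by_cases h : i < k <;> simp only [h, if_true, if_false] <;> fun_prop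

theorem measurableSet_good : MeasurableSet good := by
  have h1 : MeasurableSet {ξ : Seqs | ∀ i, 0 < ξ.1 i} := by
    simp only [ofPred_forall]
    exact MeasurableSet.iInter fun i => measurableSet_lt measurable_const (by fun_prop)
  have h2 : MeasurableSet {ξ : Seqs | ∀ i, 0 ≤ ξ.2 i} := by
    simp only [ofPred_forall]
    exact MeasurableSet.iInter fun i => measurableSet_le measurable_const (by fun_prop)
  have h3 : MeasurableSet {ξ : Seqs | ∀ n : ℕ, ∃ k, (n : ℝ) ≤ epoch ξ k} := by
    simp only [ofPred_forall, ofPred_exists]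
    exact MeasurableSet.iInter fun n => MeasurableSet.iUnion fun k =>
      measurableSet_le measurable_const (measurable_epoch k)
  exact h1.inter (h2.inter h3)

section good

variable {ξ : Seqs} (hξ : ξ ∈ good)
include hξ

theorem epoch_strictMono : StrictMono (epoch ξ) :=
  strictMono_nat_of_lt_succ fun k => by rw [epoch_succ]; have := hξ.1 k; linarith

theorem epoch_nonneg (k : ℕ) : 0 ≤ epoch ξ k := by
  rw [← epoch_zero ξ]; exact (epoch_strictMono hξ).monotone (Nat.zero_le k)

theorem exists_epoch_lt (t : ℝ) : ∃ k, t < epoch ξ k := by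
  obtain ⟨n, hn⟩ := exists_nat_gt t
  obtain ⟨k, hk⟩ := hξ.2.2 n
  exact ⟨k, hn.trans_le hk⟩

theorem exists_mem_epoch {t : ℝ} (ht : 0 ≤ t) : ∃ k, t ∈ Ico (epoch ξ k) (epoch ξ (k + 1)) := by
  classical
  have h := exists_epoch_lt hξ t
  have h0 : Nat.find h ≠ 0 := fun h0 => by
    have := Nat.find_spec h
    rw [h0, epoch_zero] at this; linarith
  obtain ⟨k, hk⟩ := Nat.exists_eq_succ_of_ne_zero h0
  refine ⟨k, not_lt.1 (Nat.find_min h (hk ▸ Nat.lt_succ_self k)), ?_⟩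
  have := Nat.find_spec h
  rwa [hk] at this

theorem count_eq {k : ℕ} {t : ℝ} (ht : t ∈ Ico (epoch ξ k) (epoch ξ (k + 1))) : count ξ t = k := by
  have : {i : ℕ | epoch ξ (i + 1) ≤ t} = (Finset.range k : Set ℕ) := by
    ext i
    simp only [mem_ofPred_eq, Finset.coe_range, mem_Iio]
    constructor
    · intro h
      have := (epoch_strictMono hξ).lt_iff_lt.1 (h.trans_lt ht.2)
      omega
    · intro h
      exact ((epoch_strictMono hξ).monotone (by omega : i + 1 ≤ k)).trans ht.1
  rw [count, this, ncard_coe_finset, Finset.card_range]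

theorem total_eq {k : ℕ} {t : ℝ} (ht : t ∈ Ico (epoch ξ k) (epoch ξ (k + 1))) :
    total ξ t = ∑ i ∈ Finset.range k, ξ.2 i := by
  rw [total, count_eq hξ ht]

end good

variable {Ω : Type*} [MeasurableSpace Ω] {P : Measure Ω} (M : RiskModel P)

/-- The waiting times and claim sizes of the model. -/
def seqs (ω : Ω) : Seqs := (fun i => M.W i ω, fun i => M.U i ω)

theorem Y_eq_total (t : ℝ≥0) (ω : Ω) : M.Y t ω = total (M.seqs ω) t := rfl

theorem measurable_seqs : Measurable M.seqs :=
  (measurable_pi_lambda _ fun i => M.measurable_W i).prodMk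
    (measurable_pi_lambda _ fun i => M.measurable_U i)

/-- The history before the claim with index `k`, including the claims before it. -/
def hist (k : ℕ) (ω : Ω) : Seqs := trunc k (M.seqs ω)

theorem measurable_hist (k : ℕ) : Measurable (M.hist k) :=
  (measurable_trunc k).comp M.measurable_seqs

theorem epoch_hist (k : ℕ) (ω : Ω) : epoch (M.hist k ω) k = epoch (M.seqs ω) k :=
  epoch_trunc le_rfl _

theorem indepFun_trunc [IsProbabilityMeasure P] {X : ℕ → Ω → ℝ} (hX : ∀ i, Measurable (X i))
    (h : iIndepFun X P) (k : ℕ) :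
    IndepFun (fun ω i => if i < k then X i ω else 0) (X k) P := by
  have h1 := h.indepFun_finset (Finset.range k) {k}
    (by simp) hX
  have hφ : Measurable fun (y : Finset.range k → ℝ) (i : ℕ) =>
      if hi : i < k then y ⟨i, Finset.mem_range.2 hi⟩ else 0 := by
    refine measurable_pi_lambda _ fun i => ?_
    by_cases hi : i < k <;> simp only [hi, dite_true, dite_false] <;> fun_prop
  have hψ : Measurable fun (y : ({k} : Finset ℕ) → ℝ) => y ⟨k, by simp⟩ := by fun_prop
  have h2 := h1.comp hφ hψ
  convert h2 using 1
  · ext ω i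
    by_cases hi : i < k <;> simp [hi]
  · rfl

/-- The ratio of the geometric sequence of discounted claim epochs. With `θ = 1` it excludes
accumulation of claims; with `θ = δ - r` it makes the remaining value vanish. -/
theorem laplace_lt_one {θ : ℝ} (hθ : 0 < θ) :
    ∫⁻ w, ENNReal.ofReal (Real.exp (-θ * w)) ∂(expMeasure M.lam) < 1 := by
  have := isProbabilityMeasure_expMeasure M.lam_pos
  have hpos : ∀ᵐ w ∂(expMeasure M.lam), 0 < w := by
    rw [ae_iff]
    simp only [not_lt]
    exact expMeasure_Iic M.lam_pos
  have hlt : ∀ w : ℝ, 0 < w → ENNReal.ofReal (Real.exp (-θ * w)) < 1 := fun w hw => by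
    rw [ENNReal.ofReal_lt_one, Real.exp_lt_one_iff]
    nlinarith
  have h1 : ∫⁻ _, (1 : ℝ≥0∞) ∂(expMeasure M.lam) = 1 := by simp
  rw [← h1]
  refine lintegral_strict_mono (IsProbabilityMeasure.ne_zero _) aemeasurable_const ?_ ?_
  · refine ne_top_of_le_ne_top ENNReal.one_ne_top (le_trans (lintegral_mono_ae ?_) h1.le)
    filter_upwards [hpos] with w hw using (hlt w hw).le
  · filter_upwards [hpos] with w hw using hlt w hw

variable [IsProbabilityMeasure P]

/-- Independence within the waiting times, within the claim sizes and between the two sequences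
makes the joint law of history, next waiting time and next claim a product. -/
theorem lintegral_hist (k : ℕ) (Φ : Seqs × ℝ × ℝ → ℝ≥0∞) (hΦ : Measurable Φ) :
    ∫⁻ ω, Φ (M.hist k ω, M.W k ω, M.U k ω) ∂P =
      ∫⁻ ω, ∫⁻ w, ∫⁻ u, Φ (M.hist k ω, w, u) ∂M.F ∂(expMeasure M.lam) ∂P := by
  have := isProbabilityMeasure_expMeasure M.lam_pos
  set hW : Ω → ℕ → ℝ := fun ω i => if i < k then M.W i ω else 0 with hhW
  set hU : Ω → ℕ → ℝ := fun ω i => if i < k then M.U i ω else 0 with hhU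
  have mcut : Measurable fun (y : ℕ → ℝ) (i : ℕ) => if i < k then y i else 0 := by
    refine measurable_pi_lambda _ fun i => ?_
    by_cases hi : i < k <;> simp only [hi, if_true, if_false] <;> fun_prop
  have mcut2 : Measurable fun (y : ℕ → ℝ) => ((fun i => if i < k then y i else 0 : ℕ → ℝ), y k) :=
    mcut.prodMk (measurable_pi_apply k)
  have mhW : Measurable hW := mcut.comp (measurable_pi_lambda _ fun i => M.measurable_W i)
  have mhU : Measurable hU := mcut.comp (measurable_pi_lambda _ fun i => M.measurable_U i)
  have eW : P.map (fun ω => (hW ω, M.W k ω)) = (P.map hW).prod (expMeasure M.lam) := by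
    rw [← M.law_W k]
    exact (indepFun_iff_map_prod_eq_prod_map_map mhW.aemeasurable (M.measurable_W k).aemeasurable).1
      (indepFun_trunc M.measurable_W M.indep_W k)
  have eU : P.map (fun ω => (hU ω, M.U k ω)) = (P.map hU).prod M.F := by
    rw [← M.law_U k]
    exact (indepFun_iff_map_prod_eq_prod_map_map mhU.aemeasurable (M.measurable_U k).aemeasurable).1
      (indepFun_trunc M.measurable_U M.indep_U k)
  have mA : Measurable fun ω => (hW ω, M.W k ω) := mhW.prodMk (M.measurable_W k)
  have mB : Measurable fun ω => (hU ω, M.U k ω) := mhU.prodMk (M.measurable_U k)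
  have eAB : P.map (fun ω => ((hW ω, M.W k ω), (hU ω, M.U k ω))) =
      ((P.map hW).prod (expMeasure M.lam)).prod ((P.map hU).prod M.F) := by
    rw [← eW, ← eU]
    exact (indepFun_iff_map_prod_eq_prod_map_map mA.aemeasurable mB.aemeasurable).1
      (M.indep_W_U.comp mcut2 mcut2)
  have eH : P.map (M.hist k) = (P.map hW).prod (P.map hU) :=
    (indepFun_iff_map_prod_eq_prod_map_map mhW.aemeasurable mhU.aemeasurable).1
      (M.indep_W_U.comp mcut mcut)
  have pW : IsProbabilityMeasure (P.map hW) := Measure.isProbabilityMeasure_map mhW.aemeasurable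
  have pU : IsProbabilityMeasure (P.map hU) := Measure.isProbabilityMeasure_map mhU.aemeasurable
  have l1 : ∫⁻ ω, Φ (M.hist k ω, M.W k ω, M.U k ω) ∂P =
      ∫⁻ a, ∫⁻ b, ∫⁻ c, ∫⁻ d, Φ ((a, c), b, d) ∂M.F ∂(P.map hU) ∂(expMeasure M.lam) ∂(P.map hW) := by
    have : ∫⁻ ω, Φ (M.hist k ω, M.W k ω, M.U k ω) ∂P =
        ∫⁻ z, Φ ((z.1.1, z.2.1), z.1.2, z.2.2)
          ∂(P.map (fun ω => ((hW ω, M.W k ω), (hU ω, M.U k ω)))) := by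
      rw [lintegral_map (by fun_prop) (mA.prodMk mB)]
      rfl
    rw [this, eAB, lintegral_prod _ (by fun_prop), lintegral_prod _ (by fun_prop)]
    refine lintegral_congr fun a => lintegral_congr fun b => ?_
    rw [lintegral_prod _ (by fun_prop)]
  have l2 : ∫⁻ ω, ∫⁻ w, ∫⁻ u, Φ (M.hist k ω, w, u) ∂M.F ∂(expMeasure M.lam) ∂P =
      ∫⁻ a, ∫⁻ c, ∫⁻ b, ∫⁻ d, Φ ((a, c), b, d) ∂M.F ∂(expMeasure M.lam) ∂(P.map hU) ∂(P.map hW) := by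
    have m1 : Measurable fun h : Seqs => ∫⁻ w, ∫⁻ u, Φ (h, w, u) ∂M.F ∂(expMeasure M.lam) := by
      fun_prop
    rw [← lintegral_map (g := M.hist k) m1 (M.measurable_hist k), eH, lintegral_prod _ m1.aemeasurable]
  rw [l1, l2]
  refine lintegral_congr fun a => ?_
  rw [lintegral_lintegral_swap]
  fun_prop

/-- The compensation formula for the claim with index `k`. -/
theorem lintegral_claim (k : ℕ) (h : Seqs → ℝ → ℝ → ℝ≥0∞)
    (hh : Measurable fun z : Seqs × ℝ × ℝ => h z.1 z.2.1 z.2.2) :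
    ∫⁻ ω, h (M.hist k ω) (epoch (M.seqs ω) (k + 1)) (M.U k ω) ∂P =
      ∫⁻ ω, ∫⁻ s in Ioo (epoch (M.seqs ω) k) (epoch (M.seqs ω) (k + 1)),
        ENNReal.ofReal M.lam * ∫⁻ u, h (M.hist k ω) s u ∂M.F ∂volume ∂P := by
  have me := measurable_epoch k
  have h1 := M.lintegral_hist k (fun z => h z.1 (epoch z.1 k + z.2.1) z.2.2)
    (hh.comp (measurable_fst.prodMk
      ((Measurable.add (me.comp measurable_fst) (measurable_fst.comp measurable_snd)).prodMk
        (measurable_snd.comp measurable_snd))))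
  simp only [M.epoch_hist, show ∀ ω, epoch (M.seqs ω) k + M.W k ω =
    epoch (M.seqs ω) (k + 1) from fun ω => (epoch_succ _ _).symm] at h1
  rw [h1]
  set f : Seqs → ℝ → ℝ≥0∞ := fun η y => ∫⁻ u, h η (epoch η k + y) u ∂M.F with hf
  have mh2 : Measurable fun z : (Seqs × ℝ) × ℝ => h z.1.1 (epoch z.1.1 k + z.1.2) z.2 :=
    hh.comp ((measurable_fst.comp measurable_fst).prodMk
      ((Measurable.add (me.comp (measurable_fst.comp measurable_fst))
        (measurable_snd.comp measurable_fst)).prodMk measurable_snd))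
  have mf : Measurable (Function.uncurry f) := mh2.lintegral_prod_right'
  have mfη : ∀ η, Measurable (f η) := fun η => mf.comp (measurable_const.prodMk measurable_id)
  -- The factorisation is used a second time, for the time integral up to the next claim;
  -- `lintegral_expMeasure_integral` then matches the two expressions.
  have h2 := M.lintegral_hist k
    (fun z => ∫⁻ y in Ioo 0 z.2.1, ENNReal.ofReal M.lam * f z.1 y) (by
      have : (fun z : Seqs × ℝ × ℝ => ∫⁻ y in Ioo 0 z.2.1, ENNReal.ofReal M.lam * f z.1 y) =
          fun z => ∫⁻ y, {x : (Seqs × ℝ × ℝ) × ℝ | x.2 ∈ Ioo 0 x.1.2.1}.indicator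
            (fun x => ENNReal.ofReal M.lam * f x.1.1 x.2) (z, y) := by
        ext z
        rw [← lintegral_indicator measurableSet_Ioo]
        rfl
      rw [this]
      refine Measurable.lintegral_prod_right' (f := {x : (Seqs × ℝ × ℝ) × ℝ | x.2 ∈ Ioo 0 x.1.2.1}.indicator
            (fun x => ENNReal.ofReal M.lam * f x.1.1 x.2)) ?_
      refine Measurable.indicator ?_ ?_
      · exact measurable_const.mul (mf.comp ((measurable_fst.comp measurable_fst).prodMk measurable_snd))
      · exact (measurableSet_lt measurable_const measurable_snd).inter
          (measurableSet_lt measurable_snd (by fun_prop)))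
  simp only [lintegral_const, measure_univ, mul_one] at h2
  have h3 : ∀ ω, ∫⁻ s in Ioo (epoch (M.seqs ω) k) (epoch (M.seqs ω) (k + 1)),
        ENNReal.ofReal M.lam * ∫⁻ u, h (M.hist k ω) s u ∂M.F ∂volume =
      ∫⁻ y in Ioo 0 (M.W k ω), ENNReal.ofReal M.lam * f (M.hist k ω) y := fun ω => by
    simp only [hf, M.epoch_hist]
    set e := epoch (M.seqs ω) k
    have h4 := (measurePreserving_add_left volume e).setLIntegral_comp_emb
      (measurableEmbedding_addLeft e)
      (fun s => ENNReal.ofReal M.lam * ∫⁻ u, h (M.hist k ω) s u ∂M.F) (Ioo 0 (M.W k ω))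
    rw [h4]
    congr 2
    rw [epoch_succ, image_const_add_Ioo, add_zero]
    rfl
  simp only [h3]
  rw [h2]
  refine lintegral_congr fun ω => ?_
  rw [lintegral_expMeasure_integral M.lam_pos _ (mfη _)]
  simp only [hf, M.epoch_hist]

theorem lintegral_exp_epoch_succ {θ : ℝ} (k : ℕ) :
    ∫⁻ ω, ENNReal.ofReal (Real.exp (-θ * epoch (M.seqs ω) (k + 1))) ∂P =
      (∫⁻ ω, ENNReal.ofReal (Real.exp (-θ * epoch (M.seqs ω) k)) ∂P) *
        ∫⁻ w, ENNReal.ofReal (Real.exp (-θ * w)) ∂(expMeasure M.lam) := by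
  have me := measurable_epoch k
  have h := M.lintegral_hist k
    (fun z => ENNReal.ofReal (Real.exp (-θ * epoch z.1 k)) * ENNReal.ofReal (Real.exp (-θ * z.2.1)))
    (by
      have : Measurable fun z : Seqs × ℝ × ℝ => epoch z.1 k := me.comp measurable_fst
      fun_prop)
  have h1 : ∀ ω, ENNReal.ofReal (Real.exp (-θ * epoch (M.seqs ω) (k + 1))) =
      ENNReal.ofReal (Real.exp (-θ * epoch (M.hist k ω) k)) *
        ENNReal.ofReal (Real.exp (-θ * M.W k ω)) := fun ω => by
    rw [← ENNReal.ofReal_mul (Real.exp_pos _).le, ← Real.exp_add, M.epoch_hist, epoch_succ, mul_add]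
    rfl
  simp only [h1]
  rw [h]
  simp only [lintegral_const, measure_univ, mul_one]
  rw [← lintegral_mul_const _ (by
    have := me.comp M.measurable_seqs
    have : Measurable fun ω => epoch (M.seqs ω) k := this
    fun_prop)]
  refine lintegral_congr fun ω => ?_
  rw [lintegral_const_mul _ (by fun_prop), M.epoch_hist]

theorem lintegral_exp_epoch {θ : ℝ} (k : ℕ) :
    ∫⁻ ω, ENNReal.ofReal (Real.exp (-θ * epoch (M.seqs ω) k)) ∂P =
      (∫⁻ w, ENNReal.ofReal (Real.exp (-θ * w)) ∂(expMeasure M.lam)) ^ k := by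
  induction k with
  | zero => simp [epoch_zero]
  | succ k ih => rw [M.lintegral_exp_epoch_succ, ih, pow_succ]

/-- Claims do not accumulate: the expectation of `∑ e^{-S_k}` is a convergent geometric series, so
almost surely `e^{-S_k}` tends to zero. -/
theorem ae_good : ∀ᵐ ω ∂P, M.seqs ω ∈ good := by
  have h1 : ∀ᵐ ω ∂P, ∀ i, 0 < M.W i ω := by
    rw [ae_all_iff]
    intro i
    have : ∀ᵐ w ∂(P.map (M.W i)), 0 < w := by
      rw [M.law_W, ae_iff]
      simp only [not_lt]
      exact expMeasure_Iic M.lam_pos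
    exact ae_of_ae_map (M.measurable_W i).aemeasurable this
  have h2 : ∀ᵐ ω ∂P, ∀ i, 0 ≤ M.U i ω := by
    rw [ae_all_iff]
    intro i
    have : ∀ᵐ w ∂(P.map (M.U i)), 0 ≤ w := by
      rw [M.law_U]; exact M.ae_F_nonneg
    exact ae_of_ae_map (M.measurable_U i).aemeasurable this
  have mexp : ∀ k, Measurable fun ω => ENNReal.ofReal (Real.exp (-1 * epoch (M.seqs ω) k)) := fun k => by
    have : Measurable fun ω => epoch (M.seqs ω) k := (measurable_epoch k).comp M.measurable_seqs
    fun_prop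
  have h3 : ∫⁻ ω, ∑' k, ENNReal.ofReal (Real.exp (-1 * epoch (M.seqs ω) k)) ∂P ≠ ∞ := by
    rw [lintegral_tsum fun k => (mexp k).aemeasurable]
    simp only [M.lintegral_exp_epoch]
    rw [ENNReal.tsum_geometric]
    exact ENNReal.inv_ne_top.2 (tsub_pos_iff_lt.2 (M.laplace_lt_one one_pos)).ne'
  have h4 := ae_lt_top (Measurable.tsum mexp) h3
  filter_upwards [h1, h2, h4] with ω hW hU hT
  refine ⟨hW, hU, fun n => ?_⟩
  have h5 := ENNReal.tendsto_atTop_zero_of_tsum_ne_top hT.ne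
  have h6 : (0 : ℝ≥0∞) < ENNReal.ofReal (Real.exp (-1 * n)) := ENNReal.ofReal_pos.2 (Real.exp_pos _)
  obtain ⟨k, hk⟩ := (h5.eventually_lt_const h6).exists
  refine ⟨k, ?_⟩
  rw [ENNReal.ofReal_lt_ofReal_iff (Real.exp_pos _), Real.exp_lt_exp] at hk
  linarith

end RiskModel

namespace RiskModel

/-! ### Processes that depend on the history before a claim -/

/-- The claims up to time `t` among the first `k` claims. -/
def partialTotal (k : ℕ) (t : ℝ) (ξ : Seqs) : ℝ :=
  ∑ i ∈ Finset.range k, if epoch ξ (i + 1) ≤ t then ξ.2 i else 0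

theorem measurable_partialTotal (k : ℕ) :
    Measurable fun z : ℝ × Seqs => partialTotal k z.1 z.2 := by
  unfold partialTotal
  refine Finset.measurable_sum _ fun i _ => ?_
  exact Measurable.ite (measurableSet_le ((measurable_epoch _).comp measurable_snd) measurable_fst)
    (by fun_prop) measurable_const

theorem measurable_partialTotal_right (k : ℕ) (t : ℝ) : Measurable (partialTotal k t) := by
  unfold partialTotal
  refine Finset.measurable_sum _ fun i _ => ?_
  exact Measurable.ite (measurableSet_le (measurable_epoch _) measurable_const)
    (by fun_prop) measurable_const

theorem partialTotal_trunc (k : ℕ) (t : ℝ) (ξ : Seqs) :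
    partialTotal k t (trunc k ξ) = partialTotal k t ξ := by
  refine Finset.sum_congr rfl fun i hi => ?_
  have hi := Finset.mem_range.1 hi
  rw [epoch_trunc (by omega)]
  simp [trunc, hi]

theorem total_eq_partialTotal {ξ : Seqs} (hξ : ξ ∈ good) {k : ℕ} {t : ℝ} (ht : 0 ≤ t)
    (hk : t < epoch ξ (k + 1)) : total ξ t = partialTotal k t ξ := by
  obtain ⟨j, hj⟩ := exists_mem_epoch hξ ht
  have hjk : j < k + 1 := (epoch_strictMono hξ).lt_iff_lt.1 (hj.1.trans_lt hk)
  rw [total_eq hξ hj, partialTotal, ← Finset.sum_filter]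
  refine Finset.sum_congr (Finset.ext fun i => ?_) fun _ _ => rfl
  simp only [Finset.mem_range, Finset.mem_filter]
  constructor
  · intro h
    exact ⟨by omega, ((epoch_strictMono hξ).monotone (by omega : i + 1 ≤ j)).trans hj.1⟩
  · rintro ⟨_, h⟩
    have := (epoch_strictMono hξ).lt_iff_lt.1 (h.trans_lt hj.2)
    omega

theorem total_epoch {ξ : Seqs} (hξ : ξ ∈ good) (k : ℕ) :
    total ξ (epoch ξ (k + 1)) = partialTotal k (epoch ξ (k + 1)) ξ + ξ.2 k := by
  have hs := epoch_strictMono hξ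
  rw [total_eq hξ (k := k + 1) ⟨le_rfl, hs (by omega)⟩, Finset.sum_range_succ, partialTotal]
  congr 1
  refine Finset.sum_congr rfl fun i hi => ?_
  rw [if_pos (hs.monotone (by have := Finset.mem_range.1 hi; omega))]

theorem abs_partialTotal_le (k : ℕ) (t : ℝ) (ξ : Seqs) :
    |partialTotal k t ξ| ≤ ∑ i ∈ Finset.range k, |ξ.2 i| := by
  refine (Finset.abs_sum_le_sum_abs _ _).trans (Finset.sum_le_sum fun i _ => ?_)
  split_ifs
  · exact le_rfl
  · simp

variable {Ω : Type*} [MeasurableSpace Ω] {P : Measure Ω} (M : RiskModel P)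

section agree

variable {ι β : Type*} [MeasurableSpace β] (P) (C : ι → Ω → Prop) (φ : ι → Ω → β)

/-- The sets that, on the part described by `C`, are almost surely determined by `φ`. -/
@[reducible] def agreeSpace : MeasurableSpace (ι × Ω) where
  MeasurableSet' A := ∃ A' : Set β, MeasurableSet A' ∧
    ∀ᵐ ω ∂P, ∀ t, C t ω → ((t, ω) ∈ A ↔ φ t ω ∈ A')
  measurableSet_empty := ⟨∅, .empty, by simp⟩
  measurableSet_compl := by
    rintro A ⟨A', hA', h⟩
    refine ⟨A'ᶜ, hA'.compl, ?_⟩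
    filter_upwards [h] with ω hω t ht
    simp only [mem_compl_iff, hω t ht]
  measurableSet_iUnion := by
    intro f hf
    choose f' hf' h using hf
    refine ⟨⋃ i, f' i, .iUnion hf', ?_⟩
    filter_upwards [ae_all_iff.2 h] with ω hω t ht
    simp only [mem_iUnion, fun i => hω i t ht]

variable {P C φ}

theorem measurableSet_agreeSpace {A : Set (ι × Ω)} : MeasurableSet[agreeSpace P C φ] A ↔
    ∃ A' : Set β, MeasurableSet A' ∧ ∀ᵐ ω ∂P, ∀ t, C t ω → ((t, ω) ∈ A ↔ φ t ω ∈ A') := Iff.rfl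

theorem exists_of_measurable {m : MeasurableSpace (ι × Ω)} (hm : m ≤ agreeSpace P C φ)
    {f : ι × Ω → ℝ≥0∞} (hf : Measurable[m] f) :
    ∃ g : β → ℝ≥0∞, Measurable g ∧ ∀ᵐ ω ∂P, ∀ t, C t ω → f (t, ω) = g (φ t ω) := by
  refine @Measurable.ennreal_induction _ m (fun f => ∃ g : β → ℝ≥0∞, Measurable g ∧
    ∀ᵐ ω ∂P, ∀ t, C t ω → f (t, ω) = g (φ t ω)) ?_ ?_ ?_ f hf
  · intro c s hs
    obtain ⟨s', hs', h⟩ := measurableSet_agreeSpace.1 (hm s hs)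
    refine ⟨s'.indicator fun _ => c, measurable_const.indicator hs', ?_⟩
    filter_upwards [h] with ω hω t ht
    simp only [indicator]
    split_ifs <;> simp_all
  · rintro f₁ f₂ - - - ⟨g₁, hg₁, h₁⟩ ⟨g₂, hg₂, h₂⟩
    refine ⟨g₁ + g₂, hg₁.add hg₂, ?_⟩
    filter_upwards [h₁, h₂] with ω hω₁ hω₂ t ht
    simp only [Pi.add_apply, hω₁ t ht, hω₂ t ht]
  · intro f _ _ h
    choose g hg h using h
    refine ⟨fun z => ⨆ i, g i z, .iSup hg, ?_⟩
    filter_upwards [ae_all_iff.2 h] with ω hω t ht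
    simp only [fun i => hω i t ht]

end agree

section filtration

variable [IsProbabilityMeasure P] [P.IsComplete]

/-- Aggregate claims at times before the claim with index `k` are a function of the earlier claims,
and null events are matched by the empty set. -/
theorem exists_of_measurableSet_filtration (k : ℕ) (s : ℝ≥0) (T : Set ℝ≥0)
    (hT : ∀ t ∈ T, s < t ∨ s = 0) {A : Set Ω} (hA : MeasurableSet[M.filtration s] A) :
    ∃ A' : Set (ℝ≥0 × Seqs), MeasurableSet A' ∧ ∀ᵐ ω ∂P, ∀ t : ℝ≥0,
      t ∈ T ∧ (t : ℝ) ≤ epoch (M.seqs ω) (k + 1) → (ω ∈ A ↔ (t, M.hist k ω) ∈ A') := by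
  have h0 : (M.filtration s : MeasurableSpace Ω) =
    (⨆ u : ℝ≥0, ⨆ _ : u ≤ s, (borel ℝ).comap (M.Y u)) ⊔
    MeasurableSpace.generateFrom {A : Set Ω | P A = 0} := rfl
  have key : (M.filtration s : MeasurableSpace Ω) ≤ (agreeSpace P
      (fun (t : ℝ≥0) ω => t ∈ T ∧ (t : ℝ) ≤ epoch (M.seqs ω) (k + 1))
      (fun t ω => (t, M.hist k ω))).map Prod.snd := ?_
  · exact measurableSet_agreeSpace.1 (key A hA)
  rw [h0]
  refine sup_le (iSup₂_le fun u hu => ?_) (MeasurableSpace.generateFrom_le fun A hA => ?_)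
  · rintro _ ⟨B, hB, rfl⟩
    have hm : Measurable fun z : ℝ≥0 × Seqs => partialTotal k u z.2 :=
      (measurable_partialTotal_right k u).comp measurable_snd
    have hB' : MeasurableSet B := hB
    refine measurableSet_agreeSpace.2 ⟨_, hm hB', ?_⟩
    filter_upwards [M.ae_good] with ω hω t ht
    -- The strict inequality `s < t` lets `t` be the claim epoch itself: a predictable event at `t`
    -- looks only at times before `t`.
    have h1 : (u : ℝ) < epoch (M.seqs ω) (k + 1) := by
      rcases hT t ht.1 with h | h
      · exact (NNReal.coe_lt_coe.2 (hu.trans_lt h)).trans_le ht.2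
      · have h0 : u = 0 := le_antisymm (h ▸ hu) zero_le
        rw [h0, NNReal.coe_zero, ← epoch_zero (M.seqs ω)]
        exact epoch_strictMono hω (Nat.succ_pos k)
    have h2 := total_eq_partialTotal hω (NNReal.coe_nonneg u) h1
    simp only [mem_preimage, hist, partialTotal_trunc, M.Y_eq_total, h2]
  · refine measurableSet_agreeSpace.2 ⟨∅, .empty, ?_⟩
    have : ∀ᵐ ω ∂P, ω ∉ A := measure_eq_zero_iff_ae_notMem.1 hA
    filter_upwards [this] with ω hω t _
    simp [hω]

theorem predictable_le_agreeSpace (k : ℕ) :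
    M.filtration.predictable ≤ agreeSpace P
      (fun (t : ℝ≥0) ω => (t : ℝ) ≤ epoch (M.seqs ω) (k + 1)) (fun t ω => (t, M.hist k ω)) := by
  have key : ∀ (s : ℝ≥0) (T : Set ℝ≥0), MeasurableSet T → (∀ t ∈ T, s < t ∨ s = 0) →
      ∀ A, MeasurableSet[M.filtration s] A → MeasurableSet[agreeSpace P
      (fun (t : ℝ≥0) ω => (t : ℝ) ≤ epoch (M.seqs ω) (k + 1))
      (fun t ω => (t, M.hist k ω))] (T ×ˢ A) := by
    intro s T mT hT A hA
    obtain ⟨A', mA', h⟩ := M.exists_of_measurableSet_filtration k s T hT hA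
    refine measurableSet_agreeSpace.2 ⟨(T ×ˢ univ) ∩ A', (mT.prod .univ).inter mA', ?_⟩
    filter_upwards [h] with ω hω t ht
    simp only [mem_prod, mem_inter_iff, mem_univ, and_true]
    exact and_congr_right fun h' => hω t ⟨h', ht⟩
  refine measurableSpace_le_predictable_of_measurableSet (fun A hA => ?_) fun s A hA => ?_
  · exact key ⊥ {⊥} (measurableSet_singleton _) (fun _ _ => Or.inr rfl) A hA
  · exact key s (Ioi s) measurableSet_Ioi (fun t ht => Or.inl ht) A hA

variable {M} in
-- Predictability means that the next claim is not seen even at its own epoch, so the endpoint is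
-- included. Nonnegativity of the dividends allows the induction for `ℝ≥0∞`-valued functions.
theorem DividendStrategy.exists_path_eq (D : M.DividendStrategy) (k : ℕ) :
    ∃ ℓ : ℝ × Seqs → ℝ, Measurable ℓ ∧ ∀ᵐ ω ∂P, ∀ t : ℝ, 0 ≤ t →
      t ≤ epoch (M.seqs ω) (k + 1) → D.path ω t = ℓ (t, M.hist k ω) := by
  have h1 : Measurable[M.filtration.predictable] fun z => ENNReal.ofReal (Function.uncurry D.L z) :=
    ENNReal.measurable_ofReal.comp D.predictable.measurable
  obtain ⟨g, hg, h⟩ := exists_of_measurable (M.predictable_le_agreeSpace k) h1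
  refine ⟨fun z => (g (z.1.toNNReal, z.2)).toReal, by fun_prop, ?_⟩
  filter_upwards [h] with ω hω t ht htk
  rw [← hω t.toNNReal (by rwa [Real.coe_toNNReal _ ht]), Function.uncurry_apply_pair,
    ENNReal.toReal_ofReal]
  · rfl
  · have := D.mono ω (zero_le : 0 ≤ t.toNNReal)
    simp only [D.L_zero] at this
    exact this

end filtration

/-! ### Picard iteration -/

section picard

variable {β : Type*} [MeasurableSpace β]

/-- Picard iterates for the equation `ρ t = g t + ∫ s in 0..t, drift (ρ s)` with a parameter. -/
def picard (g : ℝ × β → ℝ) : ℕ → ℝ × β → ℝ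
  | 0 => fun _ => 0
  | j + 1 => fun z => g z + ∫ s in Ioo 0 z.1, M.drift (picard g j (s, z.2))

theorem measurable_picard {g : ℝ × β → ℝ} (hg : Measurable g) (j : ℕ) :
    Measurable (M.picard g j) := by
  induction j with
  | zero => exact measurable_const
  | succ j ih =>
    refine hg.add ?_
    have h1 : ∀ z : ℝ × β, ∫ s in Ioo 0 z.1, M.drift (M.picard g j (s, z.2)) =
        ∫ s, {y : (ℝ × β) × ℝ | y.2 ∈ Ioo 0 y.1.1}.indicator
          (fun y => M.drift (M.picard g j (y.2, y.1.2))) (z, s) := fun z => by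
      rw [← integral_indicator measurableSet_Ioo]; rfl
    simp only [h1]
    refine (StronglyMeasurable.integral_prod_right' (Measurable.stronglyMeasurable ?_)).measurable
    refine Measurable.indicator ?_ ?_
    · exact M.continuous_drift.measurable.comp
        (ih.comp (measurable_snd.prodMk (measurable_snd.comp measurable_fst)))
    · exact (measurableSet_lt measurable_const measurable_snd).inter
        (measurableSet_lt measurable_snd (by fun_prop))

/-- In the norm weighted by `e^{-2αt}` each iteration halves the error. The equation is assumed only
before `b`, while the limit at `b` is the value of the right side there, that is, the reserve before
the claim. -/
theorem tendsto_picard {g : ℝ × β → ℝ} (hg : Measurable g) (y : β) {ρ : ℝ → ℝ} {b K : ℝ} (hb : 0 < b)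
    (hi : IntervalIntegrable (fun s => M.drift (ρ s)) volume 0 b)
    (heq : ∀ t ∈ Ico 0 b, ρ t = g (t, y) + ∫ s in (0 : ℝ)..t, M.drift (ρ s))
    (hK : ∀ t ∈ Ico 0 b, |ρ t| ≤ K) {t : ℝ} (ht : t ∈ Icc 0 b) :
    Tendsto (fun j => M.picard g j (t, y)) atTop
      (𝓝 (g (t, y) + ∫ s in (0 : ℝ)..t, M.drift (ρ s))) := by
  have hα := M.α_pos
  have hρm : ∀ t ∈ Icc 0 b, IntegrableOn (fun s => M.drift (ρ s)) (Ioo 0 t) := fun t ht =>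
    ((intervalIntegrable_iff_integrableOn_Ioc_of_le (ht.1.trans ht.2)).1 hi).mono_set
      (Ioo_subset_Ioc_self.trans (Ioc_subset_Ioc_right ht.2))
  -- The integral sees only times before `t`, so an error bound on `Ico 0 b` passes to the next
  -- iterate on all of `Icc 0 b`.
  have step : ∀ j : ℕ, (∀ t ∈ Ico 0 b, |M.picard g j (t, y) - ρ t| ≤
        K * 2⁻¹ ^ j * Real.exp (2 * M.α * t)) → ∀ t ∈ Icc 0 b,
      |M.picard g (j + 1) (t, y) - (g (t, y) + ∫ s in (0 : ℝ)..t, M.drift (ρ s))| ≤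
        K * 2⁻¹ ^ (j + 1) * Real.exp (2 * M.α * t) := by
    intro j hj t ht
    have hbd : ∀ s ∈ Ioo 0 t, |M.drift (M.picard g j (s, y)) - M.drift (ρ s)| ≤
        M.α * (K * 2⁻¹ ^ j * Real.exp (2 * M.α * s)) := fun s hs =>
      (M.abs_drift_sub_le _ _).trans (mul_le_mul_of_nonneg_left
        (hj s ⟨hs.1.le, hs.2.trans_le ht.2⟩) hα.le)
    have hbi : IntegrableOn (fun s => M.α * (K * 2⁻¹ ^ j * Real.exp (2 * M.α * s))) (Ioo 0 t) :=
      (Continuous.integrableOn_Icc (by fun_prop)).mono_set Ioo_subset_Icc_self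
    have hm : Measurable fun s => M.drift (M.picard g j (s, y)) :=
      M.continuous_drift.measurable.comp ((M.measurable_picard hg j).comp (by fun_prop))
    have hdi : IntegrableOn (fun s => M.drift (M.picard g j (s, y)) - M.drift (ρ s)) (Ioo 0 t) :=
      hbi.mono' (hm.aestronglyMeasurable.sub (hρm t ht).aestronglyMeasurable)
        ((ae_restrict_iff' measurableSet_Ioo).2 (Eventually.of_forall hbd))
    have hpi : IntegrableOn (fun s => M.drift (M.picard g j (s, y))) (Ioo 0 t) := by
      have := Integrable.add hdi (hρm t ht)
      refine this.congr (Eventually.of_forall fun s => ?_)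
      simp
    have h1 : M.picard g (j + 1) (t, y) - (g (t, y) + ∫ s in (0 : ℝ)..t, M.drift (ρ s)) =
        ∫ s in Ioo 0 t, (M.drift (M.picard g j (s, y)) - M.drift (ρ s)) := by
      rw [integral_sub hpi (hρm t ht), intervalIntegral.integral_of_le ht.1,
        integral_Ioc_eq_integral_Ioo]
      simp only [picard]
      ring
    rw [h1, ← Real.norm_eq_abs]
    refine (norm_integral_le_of_norm_le hbi
      ((ae_restrict_iff' measurableSet_Ioo).2 (Eventually.of_forall hbd))).trans ?_
    have hd : ∀ s ∈ uIcc 0 t, HasDerivAt (fun s => K * 2⁻¹ ^ (j + 1) * Real.exp (2 * M.α * s))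
        (M.α * (K * 2⁻¹ ^ j * Real.exp (2 * M.α * s))) s := fun s _ =>
      ((((hasDerivAt_id' s).const_mul (2 * M.α)).exp).const_mul _).congr_deriv (by
        rw [pow_succ]; ring)
    rw [← integral_Ioc_eq_integral_Ioo, ← intervalIntegral.integral_of_le ht.1,
      intervalIntegral.integral_eq_sub_of_hasDerivAt hd
        (Continuous.intervalIntegrable (by fun_prop) _ _)]
    have hK0 := (abs_nonneg _).trans (hK 0 ⟨le_rfl, hb⟩)
    have : 0 ≤ K * 2⁻¹ ^ (j + 1) * Real.exp (2 * M.α * 0) := by positivity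
    linarith
  have bound : ∀ j : ℕ, ∀ t ∈ Ico 0 b, |M.picard g j (t, y) - ρ t| ≤
      K * 2⁻¹ ^ j * Real.exp (2 * M.α * t) := by
    intro j
    induction j with
    | zero =>
      intro t ht
      have h1 := hK t ht
      have h2 : 1 ≤ Real.exp (2 * M.α * t) := Real.one_le_exp (by have := ht.1; positivity)
      simp only [picard, zero_sub, abs_neg, pow_zero, mul_one]
      nlinarith [abs_nonneg (ρ t)]
    | succ j ih =>
      intro t ht
      rw [heq t ht]
      exact step j ih t (Ico_subset_Icc_self ht)
  have hlim : Tendsto (fun j : ℕ => K * 2⁻¹ ^ (j + 1) * Real.exp (2 * M.α * t)) atTop (𝓝 0) := by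
    have h1 := (tendsto_pow_atTop_nhds_zero_of_lt_one (r := (2⁻¹ : ℝ)) (by norm_num)
      (by norm_num)).comp (tendsto_add_atTop_nat 1)
    have h2 := (h1.const_mul K).mul_const (Real.exp (2 * M.α * t))
    simpa using h2
  rw [← tendsto_add_atTop_iff_nat 1, tendsto_iff_norm_sub_tendsto_zero]
  exact squeeze_zero (fun _ => norm_nonneg _) (fun j => step j (bound j) t ht) hlim

end picard

variable {M} in
-- The reserve is not assumed measurable, but it solves an integral equation whose data depend
-- measurably on time and history, and Picard iteration determines the solution. At the claim epoch
-- the version is the level before the claim.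
theorem IsReserve.exists_reserve_eq [IsProbabilityMeasure P] [P.IsComplete] {x : ℝ}
    {D : M.DividendStrategy} {R : ℝ≥0 → Ω → ℝ} (hR : M.IsReserve x D R) (k : ℕ) :
    ∃ ρ : ℝ × Seqs → ℝ, Measurable ρ ∧ ∀ᵐ ω ∂P, ∀ t : ℝ, 0 ≤ t →
      (t < epoch (M.seqs ω) (k + 1) → ρ (t, M.hist k ω) = R t.toNNReal ω) ∧
      (t = epoch (M.seqs ω) (k + 1) → ρ (t, M.hist k ω) = R t.toNNReal ω + M.U k ω) := by
  obtain ⟨ℓ, hℓ, h⟩ := D.exists_path_eq k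
  set g : ℝ × Seqs → ℝ := fun z => x - partialTotal k z.1 z.2 - ℓ z with hg
  have mg : Measurable g := (measurable_const.sub (measurable_partialTotal k)).sub hℓ
  refine ⟨fun z => limsup (fun j => M.picard g j z) atTop,
    Measurable.limsup fun j => M.measurable_picard mg j, ?_⟩
  filter_upwards [h, hR, M.ae_good] with ω hω hRω hgood t ht
  set b := epoch (M.seqs ω) (k + 1) with hb
  have hbpos : 0 < b := by
    rw [← epoch_zero (M.seqs ω)]; exact epoch_strictMono hgood (Nat.succ_pos k)
  have hb0 := hbpos.le
  have h0 := (hRω b.toNNReal).1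
  rw [Real.coe_toNNReal _ hb0] at h0
  have hgt : ∀ t, 0 ≤ t → t ≤ b → g (t, M.hist k ω) =
      x - partialTotal k t (M.seqs ω) - D.path ω t := fun t ht htb => by
    simp only [hg, hist, partialTotal_trunc]
    rw [hω t ht htb]; rfl
  have hRt : ∀ t, 0 ≤ t → R t.toNNReal ω = x + (∫ s in (0 : ℝ)..t, M.drift (R s.toNNReal ω)) -
      total (M.seqs ω) t - D.path ω t := fun t ht => by
    have := (hRω t.toNNReal).2
    rw [M.Y_eq_total, Real.coe_toNNReal _ ht] at this
    exact this
  have heq : ∀ t ∈ Ico 0 b, R t.toNNReal ω =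
      g (t, M.hist k ω) + ∫ s in (0 : ℝ)..t, M.drift (R s.toNNReal ω) := fun t ht => by
    rw [hRt t ht.1, hgt t ht.1 ht.2.le, total_eq_partialTotal hgood ht.1 ht.2]
    ring
  have hLb : ∀ t, 0 ≤ D.path ω t := fun t => by
    have := D.mono ω (zero_le : 0 ≤ t.toNNReal)
    simp only [D.L_zero] at this
    exact this
  have hK : ∀ t ∈ Ico 0 b, |R t.toNNReal ω| ≤ |x| + ∑ i ∈ Finset.range k, |(M.seqs ω).2 i| +
      D.path ω b + ∫ s in (0 : ℝ)..b, |M.drift (R s.toNNReal ω)| := fun t ht => by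
    rw [heq t ht, hgt t ht.1 ht.2.le]
    have h1 := abs_partialTotal_le k t (M.seqs ω)
    have h2 : |∫ s in (0 : ℝ)..t, M.drift (R s.toNNReal ω)| ≤
        ∫ s in (0 : ℝ)..b, |M.drift (R s.toNNReal ω)| :=
      (intervalIntegral.abs_integral_le_integral_abs ht.1).trans
        (intervalIntegral.integral_mono_interval le_rfl ht.1 ht.2.le
          (Eventually.of_forall fun _ => abs_nonneg _) h0.abs)
    have h3 : |D.path ω t| ≤ D.path ω b := by
      rw [abs_of_nonneg (hLb t)]; exact D.path_mono ω ht.2.le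
    have h4 := abs_add_le (x - partialTotal k t (M.seqs ω) - D.path ω t)
      (∫ s in (0 : ℝ)..t, M.drift (R s.toNNReal ω))
    have h5 := abs_sub (x - partialTotal k t (M.seqs ω)) (D.path ω t)
    have h6 := abs_sub x (partialTotal k t (M.seqs ω))
    linarith
  have hlim := fun ht => (M.tendsto_picard mg (M.hist k ω) hbpos h0 heq hK (t := t) ht).limsup_eq
  refine ⟨fun htb => ?_, fun htb => ?_⟩
  · exact (hlim ⟨ht, htb.le⟩).trans (heq t ⟨ht, htb⟩).symm
  · refine (hlim ⟨ht, htb.le⟩).trans ?_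
    rw [hgt t ht htb.le, hRt t ht, htb, hb, total_epoch hgood k]
    simp only [seqs]
    ring

end RiskModel

/-! ### Stieltjes measures of left-continuous monotone functions -/

theorem Monotone.leftLim_stieltjesFunction {f : ℝ → ℝ} (hf : Monotone f)
    (hc : ∀ t, ContinuousWithinAt f (Iic t) t) (t : ℝ) :
    Function.leftLim hf.stieltjesFunction t = f t := by
  have h : (hf.stieltjesFunction : ℝ → ℝ) = Function.rightLim f :=
    funext hf.stieltjesFunction_eq
  rw [h, leftLim_rightLim (hf.tendsto_leftLim t), (hc t).leftLim_eq]

theorem Monotone.stieltjesFunction_measure_Ico {f : ℝ → ℝ} (hf : Monotone f)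
    (hc : ∀ t, ContinuousWithinAt f (Iic t) t) (s t : ℝ) :
    hf.stieltjesFunction.measure (Ico s t) = ENNReal.ofReal (f t - f s) := by
  rw [StieltjesFunction.measure_Ico, hf.leftLim_stieltjesFunction hc,
    hf.leftLim_stieltjesFunction hc]

theorem Monotone.stieltjesFunction_measure_singleton {f : ℝ → ℝ} (hf : Monotone f)
    (hc : ∀ t, ContinuousWithinAt f (Iic t) t) (t : ℝ) :
    hf.stieltjesFunction.measure {t} = ENNReal.ofReal (Function.rightLim f t - f t) := by
  rw [StieltjesFunction.measure_singleton, hf.leftLim_stieltjesFunction hc]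
  rfl

namespace RiskModel

variable {Ω : Type*} [MeasurableSpace Ω] {P : Measure Ω} {M : RiskModel P}

/-! ### The Stieltjes measure of a dividend path -/

namespace DividendStrategy

variable [P.IsComplete] (D : M.DividendStrategy) (ω : Ω)

theorem path_left_cont (t : ℝ) : ContinuousWithinAt (D.path ω) (Iic t) t := by
  have h := D.left_cont ω t.toNNReal
  exact ContinuousWithinAt.comp (f := Real.toNNReal) (t := Iic t.toNNReal) h
    continuous_real_toNNReal.continuousWithinAt fun s hs => Real.toNNReal_mono hs

theorem path_of_nonpos {t : ℝ} (ht : t ≤ 0) : D.path ω t = 0 := by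
  rw [path, Real.toNNReal_of_nonpos ht, D.L_zero]

theorem path_nonneg (t : ℝ) : 0 ≤ D.path ω t := by
  rcases le_total t 0 with h | h
  · rw [D.path_of_nonpos ω h]
  · rw [← D.path_of_nonpos ω le_rfl]; exact D.path_mono ω h

theorem dL_Ico (s t : ℝ) : D.dL ω (Ico s t) = ENNReal.ofReal (D.path ω t - D.path ω s) :=
  (D.path_mono ω).stieltjesFunction_measure_Ico (D.path_left_cont ω) s t

theorem dL_singleton (t : ℝ) : D.dL ω {t} =
    ENNReal.ofReal (Function.rightLim (D.path ω) t - D.path ω t) :=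
  (D.path_mono ω).stieltjesFunction_measure_singleton (D.path_left_cont ω) t

instance : SFinite (D.dL ω) := by unfold dL; infer_instance

end DividendStrategy

/-! ### Controlled paths -/

variable (M) in
/-- `R` is the reserve for the initial value `x`, claims `ξ` and dividend path `ℓ`. -/
structure IsControlled (x : ℝ) (ξ : Seqs) (ℓ R : ℝ → ℝ) : Prop where
  good : ξ ∈ good
  mono : Monotone ℓ
  nonneg : ∀ t, 0 ≤ ℓ t
  integrable : ∀ t, 0 ≤ t → IntervalIntegrable (fun s => M.drift (R s)) volume 0 t
  eq : ∀ t, 0 ≤ t → R t = x + (∫ s in (0 : ℝ)..t, M.drift (R s)) - total ξ t - ℓ t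

/-- `φ` is the path `R` between the claims with indices `k - 1` and `k`, up to and including the time
immediately before the claim with index `k`. -/
def IsPiece (ξ : Seqs) (R : ℝ → ℝ) (k : ℕ) (φ : ℝ → ℝ) : Prop :=
  (∀ t ∈ Ico (epoch ξ k) (epoch ξ (k + 1)), φ t = R t) ∧
    φ (epoch ξ (k + 1)) = R (epoch ξ (k + 1)) + ξ.2 k

namespace IsControlled

variable {x : ℝ} {ξ : Seqs} {ℓ R : ℝ → ℝ} (h : M.IsControlled x ξ ℓ R)
include h

theorem isPath {k : ℕ} {φ : ℝ → ℝ} (hφ : IsPiece ξ R k φ) :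
    M.IsPath ℓ φ (epoch ξ k) (epoch ξ (k + 1)) := by
  have hs := epoch_strictMono h.good
  set a := epoch ξ k
  set b := epoch ξ (k + 1)
  have hab : a < b := hs (Nat.lt_succ_self k)
  have ha : 0 ≤ a := epoch_nonneg h.good k
  have hb : 0 ≤ b := ha.trans hab.le
  have hRi : IntervalIntegrable (fun s => M.drift (R s)) volume a b :=
    (h.integrable a ha).symm.trans (h.integrable b hb)
  -- The piece and `R` may differ at `b`, where `R` has already been reduced by the claim; this is
  -- one point.
  have hcongr : ∀ t ∈ Icc a b, ∀ᵐ s, s ∈ uIoc a t → M.drift (R s) = M.drift (φ s) := by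
    intro t ht
    have : ∀ᵐ s : ℝ, s ≠ b := by
      rw [ae_iff]; simp
    filter_upwards [this] with s hsb hst
    rw [uIoc_of_le ht.1] at hst
    rw [hφ.1 s ⟨hst.1.le, lt_of_le_of_ne (hst.2.trans ht.2) hsb⟩]
  refine ⟨h.mono, hab.le, hRi.congr_ae ?_, fun t ht => ?_⟩
  · exact (ae_restrict_iff' measurableSet_uIoc).2 (hcongr b (right_mem_Icc.2 hab.le))
  · rw [← intervalIntegral.integral_congr_ae (hcongr t ht), hφ.1 a ⟨le_rfl, hab⟩, h.eq a ha,
      total_eq h.good (t := a) ⟨le_rfl, hab⟩]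
    have h0 : 0 ≤ t := ha.trans ht.1
    have hadd := intervalIntegral.integral_add_adjacent_intervals (h.integrable a ha)
      ((h.integrable a ha).symm.trans (h.integrable t h0))
    rcases ht.2.eq_or_lt with htb | htb
    · rw [htb] at hadd ⊢
      rw [hφ.2, h.eq b hb, total_eq h.good (t := b) (k := k + 1) ⟨le_rfl, hs (Nat.lt_succ_self _)⟩,
        Finset.sum_range_succ]
      linarith
    · rw [hφ.1 t ⟨ht.1, htb⟩, h.eq t h0, total_eq h.good (t := t) ⟨ht.1, htb⟩]
      linarith

/-- Comparison with the solution of `y' = p + r y` started at `max x 0`, which stays nonnegative and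
so never meets the debit branch. -/
theorem le_growth {k : ℕ} {φ : ℝ → ℝ} (hφ : IsPiece ξ R k φ) {t : ℝ}
    (ht : t ∈ Icc (epoch ξ k) (epoch ξ (k + 1))) :
    φ t ≤ (max x 0 + M.p / M.r) * Real.exp (M.r * t) - M.p / M.r := by
  have hr := M.r_pos
  have hp := M.p_pos
  set c := max x 0 + M.p / M.r with hc
  have hpr : 0 < M.p / M.r := div_pos hp hr
  have hx0 : 0 ≤ max x 0 := le_max_right _ _
  have h0 : 0 ≤ t := (epoch_nonneg h.good k).trans ht.1
  have htot : ∀ t, 0 ≤ total ξ t := fun t => Finset.sum_nonneg fun i _ => h.good.2.1 i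
  have hR : ∀ u, 0 ≤ u → R u ≤ x + ∫ s in (0 : ℝ)..u, M.drift (R s) := fun u hu => by
    have h1 := h.eq u hu
    have h2 := htot u
    have h3 := h.nonneg u
    linarith
  have key := M.comparison (φ := fun t => c * Real.exp (M.r * t) - M.p / M.r) h0
    (h.integrable t h0) (by fun_prop) (x := x) (fun u hu => hR u hu.1) (fun u hu => by
      have hd : ∀ s ∈ uIcc 0 u, HasDerivAt (fun s => c * Real.exp (M.r * s) - M.p / M.r)
          (M.drift (c * Real.exp (M.r * s) - M.p / M.r)) s := fun s hs => by
        rw [uIcc_of_le hu.1] at hs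
        have h1 : 1 ≤ Real.exp (M.r * s) := Real.one_le_exp (mul_nonneg hr.le hs.1)
        have h2 : 0 ≤ c * Real.exp (M.r * s) - M.p / M.r := by nlinarith
        rw [M.drift_of_nonneg h2]
        refine (((((hasDerivAt_id' s).const_mul M.r).exp).const_mul c).sub_const _).congr_deriv ?_
        field_simp
        ring
      rw [intervalIntegral.integral_eq_sub_of_hasDerivAt hd
        ((M.continuous_drift.comp (by fun_prop)).intervalIntegrable _ _)]
      simp only [mul_zero, Real.exp_zero, mul_one]
      have : x ≤ max x 0 := le_max_left _ _
      linarith) t ⟨h0, le_rfl⟩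
  refine le_trans ?_ key
  rcases ht.2.eq_or_lt with htb | htb
  · rw [htb, hφ.2]
    have hb : 0 ≤ epoch ξ (k + 1) := epoch_nonneg h.good _
    have h1 := h.eq _ hb
    have h2 : ξ.2 k ≤ total ξ (epoch ξ (k + 1)) := by
      rw [total_eq h.good (k := k + 1) ⟨le_rfl, epoch_strictMono h.good (Nat.lt_succ_self _)⟩,
        Finset.sum_range_succ]
      have := Finset.sum_nonneg fun i (_ : i ∈ Finset.range k) => h.good.2.1 i
      linarith
    have h3 := h.nonneg (epoch ξ (k + 1))
    linarith
  · rw [hφ.1 t ⟨ht.1, htb⟩]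
    exact hR t h0

/-- At nonnegative levels `v` is at most affine of slope one, and reserves grow at rate `r`; hence
decay at rate `δ - r`. -/
theorem discValue_le (hα : M.δ < M.α) {k : ℕ} {φ : ℝ → ℝ} (hφ : IsPiece ξ R k φ) {t : ℝ}
    (ht : t ∈ Icc (epoch ξ k) (epoch ξ (k + 1))) :
    M.discValue φ t ≤ ENNReal.ofReal (M.p / M.δ + (max x 0 + M.p / M.r)) *
      ENNReal.ofReal (Real.exp (-(M.δ - M.r) * t)) := by
  have hr := M.r_pos
  have hp := M.p_pos
  have hδ := M.δ_pos
  have hx0 : 0 ≤ max x 0 := le_max_right _ _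
  have hpr : 0 < M.p / M.r := div_pos hp hr
  have hpδ : 0 < M.p / M.δ := div_pos hp hδ
  have h0 : 0 ≤ t := (epoch_nonneg h.good k).trans ht.1
  have h1 := h.le_growth hφ ht
  have h2 : 1 ≤ Real.exp (M.r * t) := Real.one_le_exp (mul_nonneg hr.le h0)
  set c := max x 0 + M.p / M.r with hc
  have h3 : 0 ≤ c * Real.exp (M.r * t) - M.p / M.r := by nlinarith
  have h4 := ((M.isSuper_v hα).mono h1).trans (M.v_le_affine hα h3)
  rw [← ENNReal.ofReal_mul (by positivity), discValue]
  refine ENNReal.ofReal_le_ofReal ?_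
  have h5 : Real.exp (-(M.δ - M.r) * t) = Real.exp (-M.δ * t) * Real.exp (M.r * t) := by
    rw [← Real.exp_add]; congr 1; ring
  rw [h5]
  have h6 : M.v (φ t) ≤ (M.p / M.δ + c) * Real.exp (M.r * t) := by nlinarith
  have := mul_le_mul_of_nonneg_left h6 (Real.exp_pos (-M.δ * t)).le
  linarith

end IsControlled

theorem IsReserve.ae_isControlled [IsProbabilityMeasure P] [P.IsComplete] {x : ℝ}
    {D : M.DividendStrategy} {R : ℝ≥0 → Ω → ℝ} (hR : M.IsReserve x D R) :
    ∀ᵐ ω ∂P, M.IsControlled x (M.seqs ω) (D.path ω) fun t => R t.toNNReal ω := by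
  filter_upwards [hR, M.ae_good] with ω hω hgood
  refine ⟨hgood, D.path_mono ω, D.path_nonneg ω, fun t ht => ?_, fun t ht => ?_⟩
  · have := (hω t.toNNReal).1
    rwa [Real.coe_toNNReal _ ht] at this
  · have := (hω t.toNNReal).2
    rw [M.Y_eq_total, Real.coe_toNNReal _ ht] at this
    exact this

theorem measurableSet_untilRuin (R : ℝ≥0 → Ω → ℝ) (ω : Ω) :
    MeasurableSet (M.untilRuin R ω) :=
  (measurableSet_le measurable_const measurable_id).inter
    (measurableSet_le ENNReal.measurable_ofReal measurable_const)

theorem crit_lt_of_lt_ruinTime {R : ℝ≥0 → Ω → ℝ} {ω : Ω} {t : ℝ≥0}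
    (ht : (t : ℝ≥0∞) < M.ruinTime R ω) : M.crit < R t ω := by
  by_contra h
  exact absurd ht (not_lt.2 (iInf₂_le
    (f := fun (t : ℝ≥0) (_ : R t ω ≤ -M.p / M.α) => (t : ℝ≥0∞)) t (not_lt.1 h)))

/-- The dividends paid between two claims are bounded by the loss of value of the reserve. -/
theorem Admissible.ae_discounted_le [IsProbabilityMeasure P] [P.IsComplete] (hα : M.δ < M.α) {x : ℝ}
    {D : M.DividendStrategy} {R : ℝ≥0 → Ω → ℝ} (hR : M.Admissible x D R) :
    ∀ᵐ ω ∂P, ∀ k φ, Measurable φ → IsPiece (M.seqs ω) (fun t => R t.toNNReal ω) k φ →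
      M.discValue φ (epoch (M.seqs ω) (k + 1)) +
        ∫⁻ u in M.untilRuin R ω ∩ Ico (epoch (M.seqs ω) k) (epoch (M.seqs ω) (k + 1)),
          ENNReal.ofReal (Real.exp (-M.δ * u)) ∂(D.dL ω) +
        ∫⁻ u in Ico (epoch (M.seqs ω) k) (epoch (M.seqs ω) (k + 1)), M.discGain φ u ≤
      M.discValue φ (epoch (M.seqs ω) k) +
        ∫⁻ u in Ico (epoch (M.seqs ω) k) (epoch (M.seqs ω) (k + 1)),
          ENNReal.ofReal M.lam * M.discValue φ u := by
  filter_upwards [hR.1.ae_isControlled, hR.2] with ω hω hadm k φ hφm hφ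
  refine (hω.isPath hφ).discounted_le M hα hφm (fun s t _ => D.dL_Ico ω s t)
    (D.path_left_cont ω) (fun w hw hwk u hu => ?_) fun w hw hwk => ?_
  · rw [hφ.1 u ⟨hu.1, hu.2.trans hwk.2⟩]
    refine crit_lt_of_lt_ruinTime (lt_of_lt_of_le ?_ hw.2)
    exact (ENNReal.ofReal_lt_ofReal_iff_of_nonneg
      ((epoch_nonneg hω.good k).trans hu.1)).2 hu.2
  · rw [hφ.1 w hwk, D.dL_singleton]
    refine ENNReal.ofReal_le_ofReal ?_
    have := hadm w.toNNReal hw.2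
    rw [Real.coe_toNNReal _ hw.1] at this
    rw [crit, neg_div, sub_neg_eq_add]
    exact this

end RiskModel

/-! ### Expected losses of value and their telescoping sum -/

namespace RiskModel

variable {Ω : Type*} [MeasurableSpace Ω] {P : Measure Ω} {M : RiskModel P}

theorem measurable_lintegral_epoch {g : ℝ × Seqs → ℝ≥0∞} (hg : Measurable g) (k : ℕ) :
    Measurable fun ω => ∫⁻ s in Ico (epoch (M.seqs ω) k) (epoch (M.seqs ω) (k + 1)),
      g (s, M.hist k ω) := by
  have he : ∀ k, Measurable fun ω => epoch (M.seqs ω) k := fun k =>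
    (measurable_epoch k).comp M.measurable_seqs
  have h1 : ∀ ω, ∫⁻ s in Ico (epoch (M.seqs ω) k) (epoch (M.seqs ω) (k + 1)), g (s, M.hist k ω) =
      ∫⁻ s, {y : Ω × ℝ | y.2 ∈ Ico (epoch (M.seqs y.1) k) (epoch (M.seqs y.1) (k + 1))}.indicator
        (fun y => g (y.2, M.hist k y.1)) (ω, s) := fun ω => by
    rw [← lintegral_indicator measurableSet_Ico]; rfl
  simp only [h1]
  refine Measurable.lintegral_prod_right' (Measurable.indicator ?_ ?_)
  · exact hg.comp (measurable_snd.prodMk ((M.measurable_hist k).comp measurable_fst))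
  · exact (measurableSet_le ((he k).comp measurable_fst) measurable_snd).inter
      (measurableSet_lt measurable_snd ((he (k + 1)).comp measurable_fst))

theorem ofReal_lam_mul_lintegral (hα : M.δ < M.α) (c y : ℝ) (hc : 0 ≤ c) :
    ENNReal.ofReal M.lam * ∫⁻ u, ENNReal.ofReal (c * M.v (y - u)) ∂M.F =
      ENNReal.ofReal (c * (M.lam * M.claimMean M.v y)) := by
  have hv := (M.isSuper_v hα).toIsGrowth
  rw [← ofReal_integral_eq_lintegral_ofReal ((hv.integrable y).const_mul c)
    (Eventually.of_forall fun u => mul_nonneg hc (hv.nonneg _)), integral_const_mul,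
    ← ENNReal.ofReal_mul M.lam_pos.le, claimMean]
  congr 1; ring

theorem returnOf_eq_lintegral_tsum [IsProbabilityMeasure P] [P.IsComplete]
    (D : M.DividendStrategy) (R : ℝ≥0 → Ω → ℝ) : M.returnOf D R = ∫⁻ ω, ∑' k,
    ∫⁻ u in M.untilRuin R ω ∩ Ico (epoch (M.seqs ω) k) (epoch (M.seqs ω) (k + 1)),
      ENNReal.ofReal (Real.exp (-M.δ * u)) ∂(D.dL ω) ∂P := by
  refine lintegral_congr_ae ?_
  filter_upwards [M.ae_good] with ω hω
  have h1 : M.untilRuin R ω = ⋃ k, M.untilRuin R ω ∩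
      Ico (epoch (M.seqs ω) k) (epoch (M.seqs ω) (k + 1)) := by
    rw [← inter_iUnion]
    refine (inter_eq_self_of_subset_left fun s hs => ?_).symm
    exact mem_iUnion.2 (exists_mem_epoch hω hs.1)
  have h2 : Pairwise (Function.onFun Disjoint fun k => M.untilRuin R ω ∩
      Ico (epoch (M.seqs ω) k) (epoch (M.seqs ω) (k + 1))) := fun i j hij =>
    ((epoch_strictMono hω).monotone.pairwise_disjoint_on_Ico_succ hij).mono
      inter_subset_right inter_subset_right
  conv_lhs => rw [h1]
  exact lintegral_iUnion (fun k => (measurableSet_untilRuin R ω).inter measurableSet_Ico) h2 _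

/-- The decrease of the discounted value along a path that is not due to claims. -/
def pieceLoss (M : RiskModel P) (φ : ℝ → ℝ) (a b : ℝ) : ℝ≥0∞ :=
  (M.discValue φ a + ∫⁻ u in Ico a b, ENNReal.ofReal M.lam * M.discValue φ u) -
    (M.discValue φ b + ∫⁻ u in Ico a b, M.discGain φ u)

section

variable (hα : M.δ < M.α) {ρ : ℕ → ℝ × Seqs → ℝ} (hρ : ∀ k, Measurable (ρ k))
include hα hρ

theorem measurable_discValue (k : ℕ) : Measurable fun z : ℝ × Seqs =>
    ENNReal.ofReal (Real.exp (-M.δ * z.1) * M.v (ρ k z)) := by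
  have h1 : Measurable fun z : ℝ × Seqs => M.v (ρ k z) :=
    (M.isSuper_v hα).mono.measurable.comp (hρ k)
  fun_prop

theorem measurable_discGain (k : ℕ) : Measurable fun z : ℝ × Seqs =>
    ENNReal.ofReal (Real.exp (-M.δ * z.1) * (M.lam * M.claimMean M.v (ρ k z))) := by
  have h1 : Measurable fun z : ℝ × Seqs => M.claimMean M.v (ρ k z) :=
    (M.isSuper_v hα).claimMean_mono.measurable.comp (hρ k)
  fun_prop

theorem measurable_discValue_epoch (k j : ℕ) : Measurable fun ω =>
    M.discValue (fun t => ρ k (t, M.hist k ω)) (epoch (M.seqs ω) j) :=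
  (measurable_discValue hα hρ k).comp
    (((measurable_epoch j).comp M.measurable_seqs).prodMk (M.measurable_hist k))

theorem measurable_pieceLoss (k : ℕ) : Measurable fun ω =>
    M.pieceLoss (fun t => ρ k (t, M.hist k ω)) (epoch (M.seqs ω) k) (epoch (M.seqs ω) (k + 1)) := by
  have h1 := measurable_discValue_epoch hα hρ k k
  have h2 := measurable_discValue_epoch hα hρ k (k + 1)
  have h3 : Measurable fun ω => ∫⁻ s in Ico (epoch (M.seqs ω) k) (epoch (M.seqs ω) (k + 1)),
      ENNReal.ofReal M.lam * M.discValue (fun t => ρ k (t, M.hist k ω)) s :=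
    measurable_lintegral_epoch ((measurable_discValue hα hρ k).const_mul (ENNReal.ofReal M.lam)) k
  have h4 : Measurable fun ω => ∫⁻ s in Ico (epoch (M.seqs ω) k) (epoch (M.seqs ω) (k + 1)),
      M.discGain (fun t => ρ k (t, M.hist k ω)) s :=
    measurable_lintegral_epoch (measurable_discGain hα hρ k) k
  exact (h1.add h3).sub (h2.add h4)

end

section

variable [IsProbabilityMeasure P] {R : ℝ≥0 → Ω → ℝ} {ρ : ℕ → ℝ × Seqs → ℝ}
  (hα : M.δ < M.α) (hρ : ∀ k, Measurable (ρ k))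
  (hp : ∀ᵐ ω ∂P, ∀ k, IsPiece (M.seqs ω) (fun t => R t.toNNReal ω) k fun t => ρ k (t, M.hist k ω))
include hα hρ

/-- The compensation formula for a functional that ignores the claim size. -/
theorem lintegral_discValue_right (k : ℕ) :
    ∫⁻ ω, M.discValue (fun t => ρ k (t, M.hist k ω)) (epoch (M.seqs ω) (k + 1)) ∂P =
      ∫⁻ ω, ∫⁻ s in Ico (epoch (M.seqs ω) k) (epoch (M.seqs ω) (k + 1)),
        ENNReal.ofReal M.lam * M.discValue (fun t => ρ k (t, M.hist k ω)) s ∂volume ∂P := by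
  have h := M.lintegral_claim k (fun η s _ => ENNReal.ofReal (Real.exp (-M.δ * s) * M.v (ρ k (s, η))))
    ((measurable_discValue hα hρ k).comp
      ((measurable_fst.comp measurable_snd).prodMk measurable_fst))
  simp only [lintegral_const, measure_univ, mul_one] at h
  refine h.trans (lintegral_congr fun ω => ?_)
  rw [setLIntegral_congr (Ioo_ae_eq_Ico (μ := volume))]
  rfl

include hp

/-- The next piece starts at the end of the present one less the claim. In the compensation formula,
integrating over the claim size produces `claimMean`. -/
theorem lintegral_discValue_succ (k : ℕ) :
    ∫⁻ ω, M.discValue (fun t => ρ (k + 1) (t, M.hist (k + 1) ω)) (epoch (M.seqs ω) (k + 1)) ∂P =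
      ∫⁻ ω, ∫⁻ s in Ico (epoch (M.seqs ω) k) (epoch (M.seqs ω) (k + 1)),
        M.discGain (fun t => ρ k (t, M.hist k ω)) s ∂volume ∂P := by
  have h1 : Measurable fun z : Seqs × ℝ × ℝ => M.v (ρ k (z.2.1, z.1) - z.2.2) :=
    (M.isSuper_v hα).mono.measurable.comp (((hρ k).comp
      ((measurable_fst.comp measurable_snd).prodMk measurable_fst)).sub
        (measurable_snd.comp measurable_snd))
  have h := M.lintegral_claim k
    (fun η s u => ENNReal.ofReal (Real.exp (-M.δ * s) * M.v (ρ k (s, η) - u))) (by fun_prop)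
  have h2 : ∫⁻ ω, M.discValue (fun t => ρ (k + 1) (t, M.hist (k + 1) ω))
      (epoch (M.seqs ω) (k + 1)) ∂P = ∫⁻ ω, ENNReal.ofReal (Real.exp
        (-M.δ * epoch (M.seqs ω) (k + 1)) * M.v (ρ k (epoch (M.seqs ω) (k + 1), M.hist k ω) -
          M.U k ω)) ∂P := by
    refine lintegral_congr_ae ?_
    filter_upwards [hp, M.ae_good] with ω hω hgood
    have h3 := (hω k).2
    have h4 := (hω (k + 1)).1 (epoch (M.seqs ω) (k + 1))
      ⟨le_rfl, epoch_strictMono hgood (Nat.lt_succ_self _)⟩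
    simp only [discValue] at h3 h4 ⊢
    rw [h3, h4]
    simp only [seqs, add_sub_cancel_right]
  rw [h2, h]
  refine lintegral_congr fun ω => ?_
  rw [setLIntegral_congr (Ioo_ae_eq_Ico (μ := volume))]
  refine lintegral_congr fun s => ?_
  rw [ofReal_lam_mul_lintegral hα _ _ (Real.exp_pos _).le]
  rfl

end

section

variable [IsProbabilityMeasure P] [P.IsComplete] {x : ℝ} {D : M.DividendStrategy}
  {R : ℝ≥0 → Ω → ℝ}

theorem IsReserve.exists_pieces (hR : M.IsReserve x D R) :
    ∃ ρ : ℕ → ℝ × Seqs → ℝ, (∀ k, Measurable (ρ k)) ∧ ∀ᵐ ω ∂P, ∀ k,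
      IsPiece (M.seqs ω) (fun t => R t.toNNReal ω) k fun t => ρ k (t, M.hist k ω) := by
  choose ρ hρ h using fun k => hR.exists_reserve_eq k
  refine ⟨ρ, hρ, ?_⟩
  filter_upwards [ae_all_iff.2 h, M.ae_good] with ω hω hgood k
  exact ⟨fun t ht => (hω k t ((epoch_nonneg hgood k).trans ht.1)).1 ht.2,
    (hω k _ (epoch_nonneg hgood _)).2 rfl⟩

variable {ρ : ℕ → ℝ × Seqs → ℝ} (hα : M.δ < M.α)
  (hp : ∀ᵐ ω ∂P, ∀ k, IsPiece (M.seqs ω) (fun t => R t.toNNReal ω) k fun t => ρ k (t, M.hist k ω))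
include hα hp

theorem lintegral_discValue_le (hR : M.IsReserve x D R) {k j : ℕ} (hj : j = k ∨ j = k + 1) :
    ∫⁻ ω, M.discValue (fun t => ρ k (t, M.hist k ω)) (epoch (M.seqs ω) j) ∂P ≤
      ENNReal.ofReal (M.p / M.δ + (max x 0 + M.p / M.r)) *
        (∫⁻ w, ENNReal.ofReal (Real.exp (-(M.δ - M.r) * w)) ∂(expMeasure M.lam)) ^ j := by
  rw [← M.lintegral_exp_epoch, ← lintegral_const_mul _ (by
    have : Measurable fun ω => epoch (M.seqs ω) j := (measurable_epoch j).comp M.measurable_seqs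
    fun_prop)]
  refine lintegral_mono_ae ?_
  filter_upwards [hp, hR.ae_isControlled] with ω hω hc
  refine hc.discValue_le hα (hω k) ?_
  have := (epoch_strictMono hc.good (Nat.lt_succ_self k)).le
  rcases hj with rfl | rfl
  · exact ⟨le_rfl, this⟩
  · exact ⟨this, le_rfl⟩

theorem lintegral_discValue_ne_top (hR : M.IsReserve x D R) {k j : ℕ} (hj : j = k ∨ j = k + 1) :
    ∫⁻ ω, M.discValue (fun t => ρ k (t, M.hist k ω)) (epoch (M.seqs ω) j) ∂P ≠ ∞ :=
  ne_top_of_le_ne_top (ENNReal.mul_ne_top ENNReal.ofReal_ne_top (ENNReal.pow_ne_top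
    (M.laplace_lt_one (sub_pos.2 M.r_lt_δ)).ne_top)) (lintegral_discValue_le hα hp hR hj)

theorem tendsto_lintegral_discValue (hR : M.IsReserve x D R) :
    Tendsto (fun k => ∫⁻ ω, M.discValue (fun t => ρ k (t, M.hist k ω))
      (epoch (M.seqs ω) k) ∂P) atTop (𝓝 0) := by
  have h1 := ENNReal.Tendsto.const_mul (a := ENNReal.ofReal (M.p / M.δ + (max x 0 + M.p / M.r)))
    (ENNReal.tendsto_pow_atTop_nhds_zero_of_lt_one
      (M.laplace_lt_one (sub_pos.2 M.r_lt_δ))) (Or.inr ENNReal.ofReal_ne_top)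
  rw [mul_zero] at h1
  exact tendsto_of_tendsto_of_tendsto_of_le_of_le tendsto_const_nhds h1 (fun _ => zero_le)
    fun k => lintegral_discValue_le hα hp hR (Or.inl rfl)

end

section

variable [IsProbabilityMeasure P] [P.IsComplete] {x : ℝ} {D : M.DividendStrategy}
  {R : ℝ≥0 → Ω → ℝ} {ρ : ℕ → ℝ × Seqs → ℝ} (hα : M.δ < M.α) (hρ : ∀ k, Measurable (ρ k))
  (hp : ∀ᵐ ω ∂P, ∀ k, IsPiece (M.seqs ω) (fun t => R t.toNNReal ω) k fun t => ρ k (t, M.hist k ω))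
  (hR : M.Admissible x D R)
include hα hρ hp hR

/-- In expectation the `lam`-term equals the value just before the claim and cancels it, which is
legitimate because that expectation is finite. The gain term becomes the value just after the claim.
-/
theorem lintegral_pieceLoss (k : ℕ) :
    ∫⁻ ω, M.pieceLoss (fun t => ρ k (t, M.hist k ω)) (epoch (M.seqs ω) k)
        (epoch (M.seqs ω) (k + 1)) ∂P +
      ∫⁻ ω, M.discValue (fun t => ρ (k + 1) (t, M.hist (k + 1) ω)) (epoch (M.seqs ω) (k + 1)) ∂P =
    ∫⁻ ω, M.discValue (fun t => ρ k (t, M.hist k ω)) (epoch (M.seqs ω) k) ∂P := by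
  have h1 := measurable_discValue_epoch hα hρ k k
  have h2 := measurable_discValue_epoch hα hρ k (k + 1)
  have hB := lintegral_discValue_ne_top hα hp hR.1 (k := k) (j := k + 1) (Or.inr rfl)
  have e1 := lintegral_discValue_right (M := M) (P := P) hα hρ k
  have e2 := lintegral_discValue_succ hα hρ hp k
  have h5 : ∫⁻ ω, (M.pieceLoss (fun t => ρ k (t, M.hist k ω)) (epoch (M.seqs ω) k)
        (epoch (M.seqs ω) (k + 1)) + (M.discValue (fun t => ρ k (t, M.hist k ω))
          (epoch (M.seqs ω) (k + 1)) +
        ∫⁻ s in Ico (epoch (M.seqs ω) k) (epoch (M.seqs ω) (k + 1)),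
      M.discGain (fun t => ρ k (t, M.hist k ω)) s)) ∂P =
      ∫⁻ ω, (M.discValue (fun t => ρ k (t, M.hist k ω)) (epoch (M.seqs ω) k) +
        ∫⁻ s in Ico (epoch (M.seqs ω) k) (epoch (M.seqs ω) (k + 1)),
      ENNReal.ofReal M.lam * M.discValue (fun t => ρ k (t, M.hist k ω)) s) ∂P := by
    refine lintegral_congr_ae ?_
    filter_upwards [hp, hR.ae_discounted_le hα] with ω hω hle
    refine tsub_add_cancel_of_le (le_trans ?_ (hle k _ ((hρ k).comp (by fun_prop)) (hω k)))
    rw [add_right_comm]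
    exact le_self_add
  rw [lintegral_add_left (measurable_pieceLoss hα hρ k), lintegral_add_left h2,
    lintegral_add_left h1, ← e1, ← e2] at h5
  refine (ENNReal.add_left_inj hB).1 ?_
  rw [← h5]
  ring

theorem sum_lintegral_pieceLoss (n : ℕ) :
    ∑ k ∈ Finset.range n, ∫⁻ ω, M.pieceLoss (fun t => ρ k (t, M.hist k ω)) (epoch (M.seqs ω) k)
        (epoch (M.seqs ω) (k + 1)) ∂P +
      ∫⁻ ω, M.discValue (fun t => ρ n (t, M.hist n ω)) (epoch (M.seqs ω) n) ∂P =
    ENNReal.ofReal (M.v x) := by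
  induction n with
  | zero =>
    have : ∫⁻ ω, M.discValue (fun t => ρ 0 (t, M.hist 0 ω)) (epoch (M.seqs ω) 0) ∂P =
        ∫⁻ _, ENNReal.ofReal (M.v x) ∂P := by
      refine lintegral_congr_ae ?_
      filter_upwards [hp, hR.1.ae_isControlled] with ω hω hc
      have h0 := (hω 0).1 0 ⟨(epoch_zero _).le, by
        rw [← epoch_zero (M.seqs ω)]; exact epoch_strictMono hc.good one_pos⟩
      have h1 := hc.eq 0 le_rfl
      rw [intervalIntegral.integral_same, total_eq hc.good (k := 0)
        ⟨(epoch_zero _).le, by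
          rw [← epoch_zero (M.seqs ω)]; exact epoch_strictMono hc.good one_pos⟩,
        D.path_of_nonpos ω le_rfl] at h1
      simp only [discValue, epoch_zero, h0, h1]
      simp
    rw [Finset.sum_range_zero, zero_add, this]
    simp
  | succ n ih =>
    rw [Finset.sum_range_succ, add_assoc, lintegral_pieceLoss hα hρ hp hR n, ih]

end

section

variable [IsProbabilityMeasure P] [P.IsComplete] {x : ℝ} {D : M.DividendStrategy}
  {R : ℝ≥0 → Ω → ℝ} (hα : M.δ < M.α) (hR : M.Admissible x D R)
include hα hR

/-- The dividends of each piece are bounded pathwise by `pieceLoss`. Sum and expectation are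
exchanged only for `pieceLoss`, whose measurability is known, and its sums telescope. -/
theorem returnOf_le : M.returnOf D R ≤ ENNReal.ofReal (M.v x) := by
  obtain ⟨ρ, hρ, hp⟩ := hR.1.exists_pieces
  have h1 : M.returnOf D R ≤ ∫⁻ ω, ∑' k, M.pieceLoss (fun t => ρ k (t, M.hist k ω))
      (epoch (M.seqs ω) k) (epoch (M.seqs ω) (k + 1)) ∂P := by
    rw [returnOf_eq_lintegral_tsum]
    -- Finiteness is needed to move these terms across the truncated subtraction in `pieceLoss`.
    have hfin : ∀ᵐ ω ∂P, ∀ k, M.discValue (fun t => ρ k (t, M.hist k ω)) (epoch (M.seqs ω) (k + 1)) +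
        ∫⁻ s in Ico (epoch (M.seqs ω) k) (epoch (M.seqs ω) (k + 1)),
          M.discGain (fun t => ρ k (t, M.hist k ω)) s < ∞ := by
      rw [ae_all_iff]
      intro k
      have h4 : Measurable fun ω => ∫⁻ s in Ico (epoch (M.seqs ω) k) (epoch (M.seqs ω) (k + 1)),
          M.discGain (fun t => ρ k (t, M.hist k ω)) s :=
        measurable_lintegral_epoch (measurable_discGain hα hρ k) k
      have h2 := measurable_discValue_epoch hα hρ k (k + 1)
      refine ae_lt_top (h2.add h4) ?_
      rw [lintegral_add_left h2, ← lintegral_discValue_succ hα hρ hp k]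
      exact ENNReal.add_ne_top.2 ⟨lintegral_discValue_ne_top hα hp hR.1 (Or.inr rfl),
        lintegral_discValue_ne_top hα hp hR.1 (Or.inl rfl)⟩
    refine lintegral_mono_ae ?_
    filter_upwards [hp, hR.ae_discounted_le hα, hfin] with ω hω hle hf
    refine ENNReal.tsum_le_tsum fun k => ENNReal.le_sub_of_add_le_right (hf k).ne ?_
    refine le_trans (le_of_eq ?_) (hle k _ ((hρ k).comp (by fun_prop)) (hω k))
    ring
  refine h1.trans ?_
  rw [lintegral_tsum fun k => (measurable_pieceLoss hα hρ k).aemeasurable]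
  refine ENNReal.tsum_le_of_sum_range_le fun n => ?_
  rw [← sum_lintegral_pieceLoss hα hρ hp hR n]
  exact le_self_add

/-- A strategy without any loss of value attains the upper bound. -/
theorem le_returnOf (h : ∀ᵐ ω ∂P, ∀ k, ∃ φ : ℝ → ℝ,
      IsPiece (M.seqs ω) (fun t => R t.toNNReal ω) k φ ∧
      M.discValue φ (epoch (M.seqs ω) k) +
        ∫⁻ u in Ico (epoch (M.seqs ω) k) (epoch (M.seqs ω) (k + 1)),
          ENNReal.ofReal M.lam * M.discValue φ u ≤
      M.discValue φ (epoch (M.seqs ω) (k + 1)) +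
        ∫⁻ u in M.untilRuin R ω ∩ Ico (epoch (M.seqs ω) k) (epoch (M.seqs ω) (k + 1)),
          ENNReal.ofReal (Real.exp (-M.δ * u)) ∂(D.dL ω) +
        ∫⁻ u in Ico (epoch (M.seqs ω) k) (epoch (M.seqs ω) (k + 1)), M.discGain φ u) :
    ENNReal.ofReal (M.v x) ≤ M.returnOf D R := by
  obtain ⟨ρ, hρ, hp⟩ := hR.1.exists_pieces
  have h1 : ∫⁻ ω, ∑' k, M.pieceLoss (fun t => ρ k (t, M.hist k ω))
      (epoch (M.seqs ω) k) (epoch (M.seqs ω) (k + 1)) ∂P ≤ M.returnOf D R := by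
    rw [returnOf_eq_lintegral_tsum]
    refine lintegral_mono_ae ?_
    filter_upwards [hp, h, M.ae_good] with ω hω hle hgood
    refine ENNReal.tsum_le_tsum fun k => tsub_le_iff_left.2 ?_
    obtain ⟨φ, hφ, hle⟩ := hle k
    -- The given `φ` may differ from the measurable version elsewhere, but both are pieces of the
    -- same reserve and agree on the closed interval.
    have heq : ∀ t ∈ Icc (epoch (M.seqs ω) k) (epoch (M.seqs ω) (k + 1)),
        φ t = ρ k (t, M.hist k ω) := fun t ht => by
      rcases ht.2.eq_or_lt with htb | htb
      · rw [htb]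
        exact hφ.2.trans (hω k).2.symm
      · exact (hφ.1 t ⟨ht.1, htb⟩).trans ((hω k).1 t ⟨ht.1, htb⟩).symm
    have hab := (epoch_strictMono hgood (Nat.lt_succ_self k)).le
    have e1 : ∀ t ∈ Icc (epoch (M.seqs ω) k) (epoch (M.seqs ω) (k + 1)),
        M.discValue φ t = M.discValue (fun t => ρ k (t, M.hist k ω)) t := fun t ht => by
      simp only [discValue, heq t ht]
    have e2 : ∀ t ∈ Icc (epoch (M.seqs ω) k) (epoch (M.seqs ω) (k + 1)),
        M.discGain φ t = M.discGain (fun t => ρ k (t, M.hist k ω)) t := fun t ht => by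
      simp only [discGain, heq t ht]
    rw [e1 _ ⟨le_rfl, hab⟩, e1 _ ⟨hab, le_rfl⟩,
      setLIntegral_congr_fun measurableSet_Ico fun t ht => by rw [e1 t (Ico_subset_Icc_self ht)],
      setLIntegral_congr_fun measurableSet_Ico fun t ht => e2 t (Ico_subset_Icc_self ht)] at hle
    rw [add_right_comm]
    exact hle
  refine le_trans ?_ h1
  rw [lintegral_tsum fun k => (measurable_pieceLoss hα hρ k).aemeasurable]
  -- The value left after `n` claims vanishes in the limit, so no value escapes to infinity.
  have h2 := (tendsto_lintegral_discValue hα hp hR.1).const_add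
    (∑' k, ∫⁻ ω, M.pieceLoss (fun t => ρ k (t, M.hist k ω))
      (epoch (M.seqs ω) k) (epoch (M.seqs ω) (k + 1)) ∂P)
  rw [add_zero] at h2
  refine ge_of_tendsto' h2 fun n => ?_
  rw [← sum_lintegral_pieceLoss hα hρ hp hR n]
  exact add_le_add_left (ENNReal.sum_le_tsum _) _

end

end RiskModel

/-- A Stieltjes measure with a possible atom at the left end of an interval and a density on the
rest of it. -/
theorem Monotone.stieltjesFunction_measure_restrict {ℓ f : ℝ → ℝ} (hℓ : Monotone ℓ)
    (hcont : ∀ t, ContinuousWithinAt ℓ (Iic t) t) {a b c : ℝ} (hab : a < b) (hc : 0 ≤ c)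
    (hf : ∀ u, 0 ≤ f u) (hfi : IntervalIntegrable f volume a b)
    (h : ∀ t ∈ Icc a b, ℓ t = ℓ a + ((if a < t then c else 0) + ∫ u in a..t, f u)) :
    hℓ.stieltjesFunction.measure.restrict (Ico a b) = ENNReal.ofReal c • Measure.dirac a +
      (volume.restrict (Ico a b)).withDensity fun u => ENNReal.ofReal (f u) := by
  have hfin : IsFiniteMeasure (hℓ.stieltjesFunction.measure.restrict (Ico a b)) := ⟨by
    rw [Measure.restrict_apply_univ, hℓ.stieltjesFunction_measure_Ico hcont]
    exact ENNReal.ofReal_lt_top⟩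
  refine Measure.ext_of_Ico _ _ fun s t _ => ?_
  rw [Measure.restrict_apply measurableSet_Ico, Ico_inter_Ico,
    hℓ.stieltjesFunction_measure_Ico hcont, Measure.add_apply, Measure.smul_apply, smul_eq_mul,
    Measure.dirac_apply' _ measurableSet_Ico, withDensity_apply _ measurableSet_Ico,
    Measure.restrict_restrict measurableSet_Ico, Ico_inter_Ico]
  set s' := max s a with hs'
  set t' := min t b with ht'
  have hii : ∀ u v, u ∈ Icc a b → v ∈ Icc a b → IntervalIntegrable f volume u v := fun u v hu hv =>
    hfi.mono_set ((uIcc_of_le hab.le).symm ▸ uIcc_subset_Icc hu hv)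
  rcases le_or_gt t' s' with hts | hst
  · have ha : a ∉ Ico s t := fun ha => by
      rw [hs', max_eq_right ha.1] at hts
      exact absurd hts (not_le.2 (lt_min ha.2 hab))
    rw [Ico_eq_empty (not_lt.2 hts), indicator_of_notMem ha,
      ENNReal.ofReal_of_nonpos (sub_nonpos.2 (hℓ hts))]
    simp
  · have hsI : s' ∈ Icc a b := ⟨le_max_right _ _, hst.le.trans (min_le_right _ _)⟩
    have htI : t' ∈ Icc a b := ⟨hsI.1.trans hst.le, min_le_right _ _⟩
    have haI : a ∈ Icc a b := ⟨le_rfl, hab.le⟩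
    have hint : ∫⁻ u in Ico s' t', ENNReal.ofReal (f u) = ENNReal.ofReal (∫ u in s'..t', f u) := by
      rw [intervalIntegral.integral_of_le hst.le, integral_Ioc_eq_integral_Ioo,
        ← integral_Ico_eq_integral_Ioo, ofReal_integral_eq_lintegral_ofReal
          (((intervalIntegrable_iff_integrableOn_Ico_of_le hst.le).1 (hii _ _ hsI htI)))
          (Eventually.of_forall hf)]
    have hadd := intervalIntegral.integral_add_adjacent_intervals (hii _ _ haI hsI) (hii _ _ hsI htI)
    rw [hint, h _ hsI, h _ htI, if_pos (hsI.1.trans_lt hst), ← hadd]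
    have hnn : 0 ≤ ∫ u in s'..t', f u := intervalIntegral.integral_nonneg hst.le fun u _ => hf u
    rcases hsI.1.eq_or_lt with has | has
    · have ha : a ∈ Ico s t := ⟨by rw [has]; exact le_max_left _ _, by
        rw [has]; exact hst.trans_le (min_le_left _ _)⟩
      rw [indicator_of_mem ha, Pi.one_apply, mul_one, ← ENNReal.ofReal_add hc hnn, if_neg has.not_lt]
      congr 1; ring
    · have ha : a ∉ Ico s t := fun ha => by
        rw [hs', max_eq_right ha.1] at has
        exact lt_irrefl _ has
      rw [indicator_of_notMem ha, mul_zero, zero_add, if_pos has]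
      congr 1; ring

namespace RiskModel

variable {Ω : Type*} [MeasurableSpace Ω] {P : Measure Ω} (M : RiskModel P)

/-! ### The band strategy for given claims -/

/-- The reserve under the band rule immediately after the claim with index `k - 1`. -/
def bandLevel (x : ℝ) (ξ : Seqs) : ℕ → ℝ
  | 0 => x
  | k + 1 => M.bandPath (ξ.1 k) (bandLevel x ξ k) - ξ.2 k

/-- The reserve under the band rule. -/
def bandReserve (x : ℝ) (ξ : Seqs) (t : ℝ) : ℝ :=
  M.bandPath (t - epoch ξ (count ξ t)) (M.bandLevel x ξ (count ξ t))

/-- The dividends paid before time `t` under the band rule. -/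
def bandPaid (x : ℝ) (ξ : Seqs) (t : ℝ) : ℝ :=
  x + (∫ s in (0 : ℝ)..t, M.drift (M.bandReserve x ξ s)) - total ξ t - M.bandReserve x ξ t

section

variable (hα : M.q < M.α) {ξ : Seqs} (hξ : ξ ∈ good) (x : ℝ)
include hξ

theorem bandReserve_eq {k : ℕ} {t : ℝ} (ht : t ∈ Ico (epoch ξ k) (epoch ξ (k + 1))) :
    M.bandReserve x ξ t = M.bandPath (t - epoch ξ k) (M.bandLevel x ξ k) := by
  rw [bandReserve, count_eq hξ ht]

theorem bandReserve_epoch (k : ℕ) : M.bandReserve x ξ (epoch ξ k) = M.bandLevel x ξ k := by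
  rw [M.bandReserve_eq hξ x (k := k) ⟨le_rfl, epoch_strictMono hξ k.lt_succ_self⟩, sub_self,
    M.bandPath_zero]

theorem isPiece_bandReserve (k : ℕ) :
    IsPiece ξ (M.bandReserve x ξ) k fun t => M.bandPath (t - epoch ξ k) (M.bandLevel x ξ k) := by
  refine ⟨fun t ht => (M.bandReserve_eq hξ x ht).symm, ?_⟩
  rw [M.bandReserve_epoch hξ, bandLevel, sub_add_cancel]
  simp only [epoch_succ, add_sub_cancel_left]

theorem drift_bandReserve_ae {k : ℕ} {t : ℝ} (ht : t ∈ Icc (epoch ξ k) (epoch ξ (k + 1))) :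
    ∀ᵐ s, s ∈ uIoc (epoch ξ k) t → M.drift (M.bandPath (s - epoch ξ k) (M.bandLevel x ξ k)) =
      M.drift (M.bandReserve x ξ s) := by
  have : ∀ᵐ s : ℝ, s ≠ epoch ξ (k + 1) := by
    rw [ae_iff]; simp
  filter_upwards [this] with s hsb hst
  rw [uIoc_of_le ht.1] at hst
  rw [M.bandReserve_eq hξ x ⟨hst.1.le, lt_of_le_of_ne (hst.2.trans ht.2) hsb⟩]

theorem bandPaid_zero : M.bandPaid x ξ 0 = 0 := by
  have h := M.bandReserve_epoch hξ x 0
  have h1 := total_eq hξ (k := 0) (t := 0) ⟨(epoch_zero ξ).le, by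
    rw [← epoch_zero ξ]; exact epoch_strictMono hξ one_pos⟩
  rw [epoch_zero, bandLevel] at h
  simp [bandPaid, h, h1]

include hα

theorem intervalIntegrable_bandReserve {t : ℝ} (ht : 0 ≤ t) :
    IntervalIntegrable (fun s => M.drift (M.bandReserve x ξ s)) volume 0 t := by
  have h1 : ∀ k, ∀ t ∈ Icc (epoch ξ k) (epoch ξ (k + 1)),
      IntervalIntegrable (fun s => M.drift (M.bandReserve x ξ s)) volume (epoch ξ k) t :=
    fun k t ht => (M.bandPath_integral hα (M.bandLevel x ξ k) ht.1).1.congr_ae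
      ((ae_restrict_iff' measurableSet_uIoc).2 (M.drift_bandReserve_ae hξ x ht))
  have h2 : ∀ k, IntervalIntegrable (fun s => M.drift (M.bandReserve x ξ s)) volume 0 (epoch ξ k) := by
    intro k
    induction k with
    | zero => rw [epoch_zero]
    | succ k ih => exact ih.trans (h1 k _ ⟨(epoch_strictMono hξ k.lt_succ_self).le, le_rfl⟩)
  obtain ⟨k, hk⟩ := exists_mem_epoch hξ ht
  exact (h2 k).trans (h1 k t (Ico_subset_Icc_self hk))

/-- The reserve equation holds by the very definition of `bandPaid`. What has to be shown is that
the amount so defined is a lump sum at the start of each piece followed by payments at `payRate`. -/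
theorem bandPaid_segment {k : ℕ} {t : ℝ} (ht : t ∈ Icc (epoch ξ k) (epoch ξ (k + 1))) :
    M.bandPaid x ξ t = M.bandPaid x ξ (epoch ξ k) +
      ((if epoch ξ k < t then M.bandLevel x ξ k - M.base (M.bandLevel x ξ k) else 0) +
        ∫ u in epoch ξ k..t, M.payRate (M.bandPath (u - epoch ξ k) (M.bandLevel x ξ k))) := by
  have hs := epoch_strictMono hξ
  have ha := epoch_nonneg hξ k
  have hab : epoch ξ k < epoch ξ (k + 1) := hs k.lt_succ_self
  have h1 := (M.bandPath_integral hα (M.bandLevel x ξ k) ht.1).2.2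
  have h2 := intervalIntegral.integral_add_adjacent_intervals
    (M.intervalIntegrable_bandReserve hα hξ x ha)
    ((M.intervalIntegrable_bandReserve hα hξ x ha).symm.trans
      (M.intervalIntegrable_bandReserve hα hξ x (ha.trans ht.1)))
  rw [intervalIntegral.integral_congr_ae (M.drift_bandReserve_ae hξ x ht)] at h1
  rw [bandPaid, bandPaid, ← h2, M.bandReserve_epoch hξ, total_eq hξ (k := k) ⟨le_rfl, hab⟩]
  rcases ht.2.eq_or_lt with htb | htb
  · have h3 := (M.isPiece_bandReserve hξ x k).2
    simp only [← htb] at h3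
    rw [h3] at h1
    have h4 : total ξ t = ∑ i ∈ Finset.range k, ξ.2 i + ξ.2 k := by
      rw [htb, total_eq hξ (k := k + 1) ⟨le_rfl, hs (Nat.lt_succ_self _)⟩, Finset.sum_range_succ]
    linarith
  · rw [total_eq hξ (k := k) ⟨ht.1, htb⟩, M.bandReserve_eq hξ x ⟨ht.1, htb⟩]
    linarith

theorem bandPaid_mono_segment {k : ℕ} {s t : ℝ} (hs : epoch ξ k ≤ s) (hst : s ≤ t)
    (ht : t ≤ epoch ξ (k + 1)) : M.bandPaid x ξ s ≤ M.bandPaid x ξ t := by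
  have hi := (M.bandPath_integral hα (M.bandLevel x ξ k) (hs.trans hst)).2.1
  rw [M.bandPaid_segment hα hξ x ⟨hs, hst.trans ht⟩, M.bandPaid_segment hα hξ x ⟨hs.trans hst, ht⟩]
  have hb := M.base_le hα (M.bandLevel x ξ k)
  have h1 := intervalIntegral.integral_mono_interval (le_refl (epoch ξ k)) hs hst
    (Eventually.of_forall fun u =>
      M.payRate_nonneg (M.bandPath (u - epoch ξ k) (M.bandLevel x ξ k))) hi
  have h2 : (if epoch ξ k < s then M.bandLevel x ξ k - M.base (M.bandLevel x ξ k) else 0) ≤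
      (if epoch ξ k < t then M.bandLevel x ξ k - M.base (M.bandLevel x ξ k) else 0) := by
    split_ifs with h3 h4 h4
    · exact le_rfl
    · exact absurd (h3.trans_le hst) h4
    · linarith
    · exact le_rfl
  linarith

theorem bandPaid_mono {s t : ℝ} (hs : 0 ≤ s) (hst : s ≤ t) :
    M.bandPaid x ξ s ≤ M.bandPaid x ξ t := by
  have hm : Monotone fun k => M.bandPaid x ξ (epoch ξ k) := monotone_nat_of_le_succ fun k =>
    M.bandPaid_mono_segment hα hξ x le_rfl (epoch_strictMono hξ k.lt_succ_self).le le_rfl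
  obtain ⟨j, hj⟩ := exists_mem_epoch hξ hs
  obtain ⟨k, hk⟩ := exists_mem_epoch hξ (hs.trans hst)
  have hjk : j < k + 1 := (epoch_strictMono hξ).lt_iff_lt.1 (hj.1.trans_lt (hst.trans_lt hk.2))
  rcases (Nat.lt_succ_iff.1 hjk).eq_or_lt with rfl | h
  · exact M.bandPaid_mono_segment hα hξ x hj.1 hst hk.2.le
  · exact (M.bandPaid_mono_segment hα hξ x hj.1 hj.2.le le_rfl).trans
      ((hm (Nat.succ_le_of_lt h)).trans (M.bandPaid_mono_segment hα hξ x le_rfl hk.1 hk.2.le))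

theorem bandPaid_left_cont {t : ℝ} (ht : 0 < t) :
    ContinuousWithinAt (M.bandPaid x ξ) (Iic t) t := by
  -- The segment is open on the left, so that a left neighbourhood of `t` lies inside it even when
  -- `t` is a claim epoch.
  obtain ⟨k, hk⟩ : ∃ k, t ∈ Ioc (epoch ξ k) (epoch ξ (k + 1)) := by
    obtain ⟨k, hk⟩ := exists_mem_epoch hξ ht.le
    rcases hk.1.eq_or_lt with h | h
    · cases k with
      | zero => rw [epoch_zero] at h; exact absurd h ht.ne
      | succ k => exact ⟨k, h ▸ epoch_strictMono hξ k.lt_succ_self, h.ge⟩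
    · exact ⟨k, h, hk.2.le⟩
  have hi := (M.bandPath_integral hα (M.bandLevel x ξ k)
    (epoch_strictMono hξ k.lt_succ_self).le).2.1
  have h1 := intervalIntegral.continuousOn_primitive_interval ((intervalIntegrable_iff'
    (f := fun u => M.payRate (M.bandPath (u - epoch ξ k) (M.bandLevel x ξ k)))).1 hi)
  rw [uIcc_of_le (epoch_strictMono hξ k.lt_succ_self).le] at h1
  have h2 : ContinuousWithinAt (fun t => M.bandPaid x ξ (epoch ξ k) +
      ((M.bandLevel x ξ k - M.base (M.bandLevel x ξ k)) +
        ∫ u in epoch ξ k..t, M.payRate (M.bandPath (u - epoch ξ k) (M.bandLevel x ξ k))))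
      (Ioc (epoch ξ k) t) t :=
    continuousWithinAt_const.add (continuousWithinAt_const.add
      ((h1 t (Ioc_subset_Icc_self hk)).mono fun s hs => ⟨hs.1.le, hs.2.trans hk.2⟩))
  have h3 : ContinuousWithinAt (M.bandPaid x ξ) (Ioc (epoch ξ k) t) t := by
    refine h2.congr (fun s hs => ?_) ?_
    · rw [M.bandPaid_segment hα hξ x ⟨hs.1.le, hs.2.trans hk.2⟩, if_pos hs.1]
    · rw [M.bandPaid_segment hα hξ x (Ioc_subset_Icc_self hk), if_pos hk.1]
  exact h3.mono_of_mem_nhdsWithin (Ioc_mem_nhdsLE hk.1)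

end

/-! ### Dependence of the band strategy on the aggregate claims -/

section

variable (hα : M.q < M.α) (x : ℝ)
include hα

theorem bandReserve_step {ξ : Seqs} (hξ : ξ ∈ good) {k : ℕ} {u s : ℝ} (hu : epoch ξ k ≤ u)
    (hu' : u < epoch ξ (k + 1)) (hus : u ≤ s) (hs : s ≤ epoch ξ (k + 1)) :
    M.bandReserve x ξ s =
      M.bandPath (s - u) (M.bandReserve x ξ u) - (total ξ s - total ξ u) := by
  have h0 : M.bandPath (s - u) (M.bandReserve x ξ u) =
      M.bandPath (s - epoch ξ k) (M.bandLevel x ξ k) := by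
    rw [M.bandReserve_eq hξ x ⟨hu, hu'⟩]
    rcases hu.eq_or_lt with h | h
    · rw [h, sub_self, M.bandPath_zero]
    · rw [← M.bandPath_add hα (sub_pos.2 h) (sub_nonneg.2 hus)]
      congr 1; ring
  rw [h0, total_eq hξ (k := k) (t := u) ⟨hu, hu'⟩]
  rcases hs.eq_or_lt with h | h
  · have h3 := (M.isPiece_bandReserve hξ x k).2
    simp only [← h] at h3
    rw [h3, h, total_eq hξ (k := k + 1) ⟨le_rfl, epoch_strictMono hξ (Nat.lt_succ_self _)⟩,
      Finset.sum_range_succ]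
    ring
  · rw [M.bandReserve_eq hξ x ⟨hu.trans hus, h⟩, total_eq hξ (k := k) ⟨hu.trans hus, h⟩]
    ring

/-- Claims of size zero are invisible in the aggregate claims, so equal totals may come from
different epochs. Both reserves are traced back through the merged epochs, by induction on the sum
of the two indices; an epoch of only one sequence does not alter the band path, by its semigroup
property. -/
theorem bandReserve_congr {ξ ξ' : Seqs} (hξ : ξ ∈ good) (hξ' : ξ' ∈ good) {t : ℝ}
    (h : ∀ s ∈ Icc 0 t, total ξ s = total ξ' s) {s : ℝ} (hs : s ∈ Icc 0 t) :
    M.bandReserve x ξ s = M.bandReserve x ξ' s := by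
  have key : ∀ n : ℕ, ∀ j k : ℕ, j + k = n → ∀ s ∈ Icc 0 t,
      s ∈ Ico (epoch ξ j) (epoch ξ (j + 1)) → s ∈ Ico (epoch ξ' k) (epoch ξ' (k + 1)) →
      M.bandReserve x ξ s = M.bandReserve x ξ' s := by
    intro n
    induction n using Nat.strong_induction_on with
    | _ n ih =>
      intro j k hjk s hs hj hk
      have step : ∀ (i l : ℕ) (u s : ℝ), 0 ≤ u → s ≤ t → epoch ξ i ≤ u → u < epoch ξ (i + 1) → u ≤ s →
          s ≤ epoch ξ (i + 1) → epoch ξ' l ≤ u → u < epoch ξ' (l + 1) → s ≤ epoch ξ' (l + 1) →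
          M.bandReserve x ξ u = M.bandReserve x ξ' u →
          M.bandReserve x ξ s = M.bandReserve x ξ' s := by
        intro i l u s h0 hst h1 h2 h3 h4 h5 h6 h7 h8
        rw [M.bandReserve_step hα x hξ h1 h2 h3 h4, M.bandReserve_step hα x hξ' h5 h6 h3 h7, h8,
          h u ⟨h0, h3.trans hst⟩, h s ⟨h0.trans h3, hst⟩]
      set a := max (epoch ξ j) (epoch ξ' k) with ha
      have ha0 : 0 ≤ a := le_max_of_le_left (epoch_nonneg hξ j)
      have has : a ≤ s := max_le hj.1 hk.1
      refine step j k a s ha0 hs.2 (le_max_left _ _) (has.trans_lt hj.2) has hj.2.le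
        (le_max_right _ _) (has.trans_lt hk.2) hk.2.le ?_
      have hmono := epoch_strictMono hξ
      have hmono' := epoch_strictMono hξ'
      rcases lt_trichotomy (epoch ξ j) (epoch ξ' k) with hlt | heq | hlt
      · have hak : a = epoch ξ' k := max_eq_right hlt.le
        obtain ⟨l, rfl⟩ : ∃ l, k = l + 1 := Nat.exists_eq_succ_of_ne_zero (by
          rintro rfl
          rw [epoch_zero] at hlt
          exact absurd (epoch_nonneg hξ j) (not_le.2 hlt))
        set u := max (epoch ξ j) (epoch ξ' l) with hu
        have hua : u < a := by rw [hak]; exact max_lt hlt (hmono' l.lt_succ_self)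
        have hu0 : 0 ≤ u := le_max_of_le_left (epoch_nonneg hξ j)
        refine step j l u a hu0 (has.trans hs.2) (le_max_left _ _)
          ((hua.trans_le has).trans hj.2) hua.le (has.trans hj.2.le) (le_max_right _ _)
          (hak ▸ hua) hak.le ?_
        exact ih (j + l) (by omega) j l rfl u ⟨hu0, hua.le.trans (has.trans hs.2)⟩
          ⟨le_max_left _ _, (hua.trans_le has).trans hj.2⟩ ⟨le_max_right _ _, hak ▸ hua⟩
      · rcases j with - | i
        · have hk0 : k = 0 := by
            rw [← hmono'.injective.eq_iff (a := k), epoch_zero, ← heq, epoch_zero]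
          rw [ha, ← heq, max_self, M.bandReserve_epoch hξ, heq, M.bandReserve_epoch hξ', hk0]
          rfl
        · obtain ⟨l, rfl⟩ : ∃ l, k = l + 1 := Nat.exists_eq_succ_of_ne_zero (by
            rintro rfl
            rw [epoch_zero, ← epoch_zero ξ] at heq
            exact absurd (hmono.injective heq) (Nat.succ_ne_zero i))
          have haj : a = epoch ξ (i + 1) := max_eq_left heq.ge
          have hak : a = epoch ξ' (l + 1) := max_eq_right heq.le
          set u := max (epoch ξ i) (epoch ξ' l) with hu
          have hua : u < a :=
            max_lt (haj ▸ hmono i.lt_succ_self) (hak ▸ hmono' l.lt_succ_self)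
          have hu0 : 0 ≤ u := le_max_of_le_left (epoch_nonneg hξ i)
          refine step i l u a hu0 (has.trans hs.2) (le_max_left _ _) (haj ▸ hua) hua.le haj.le
            (le_max_right _ _) (hak ▸ hua) hak.le ?_
          exact ih (i + l) (by omega) i l rfl u ⟨hu0, hua.le.trans (has.trans hs.2)⟩
            ⟨le_max_left _ _, haj ▸ hua⟩ ⟨le_max_right _ _, hak ▸ hua⟩
      · have haj : a = epoch ξ j := max_eq_left hlt.le
        obtain ⟨i, rfl⟩ : ∃ i, j = i + 1 := Nat.exists_eq_succ_of_ne_zero (by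
          rintro rfl
          rw [epoch_zero] at hlt
          exact absurd (epoch_nonneg hξ' k) (not_le.2 hlt))
        set u := max (epoch ξ i) (epoch ξ' k) with hu
        have hua : u < a := by rw [haj]; exact max_lt (hmono i.lt_succ_self) hlt
        have hu0 : 0 ≤ u := le_max_of_le_left (epoch_nonneg hξ i)
        refine step i k u a hu0 (has.trans hs.2) (le_max_left _ _) (haj ▸ hua) hua.le haj.le
          (le_max_right _ _) ((hua.trans_le has).trans hk.2) (has.trans hk.2.le) ?_
        exact ih (i + k) (by omega) i k rfl u ⟨hu0, hua.le.trans (has.trans hs.2)⟩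
          ⟨le_max_left _ _, haj ▸ hua⟩ ⟨le_max_right _ _, (hua.trans_le has).trans hk.2⟩
  obtain ⟨j, hj⟩ := exists_mem_epoch hξ hs.1
  obtain ⟨k, hk⟩ := exists_mem_epoch hξ' hs.1
  exact key _ j k rfl s hs hj hk

theorem bandPaid_congr {ξ ξ' : Seqs} (hξ : ξ ∈ good) (hξ' : ξ' ∈ good) {t : ℝ} (ht : 0 ≤ t)
    (h : ∀ s ∈ Icc 0 t, total ξ s = total ξ' s) : M.bandPaid x ξ t = M.bandPaid x ξ' t := by
  rw [bandPaid, bandPaid, h t ⟨ht, le_rfl⟩, M.bandReserve_congr hα x hξ hξ' h ⟨ht, le_rfl⟩,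
    intervalIntegral.integral_congr fun s hs => ?_]
  rw [uIcc_of_le ht] at hs
  simp only [M.bandReserve_congr hα x hξ hξ' h hs]

end

end RiskModel

/-- A left-continuous adapted process is predictable. -/
theorem MeasureTheory.IsStronglyPredictable.of_left_cont {Ω : Type*} {m : MeasurableSpace Ω}
    {𝓕 : Filtration ℝ≥0 m} {L : ℝ≥0 → Ω → ℝ} (hL : ∀ t, Measurable[𝓕 t] (L t))
    (hc : ∀ ω t, ContinuousWithinAt (fun s => L s ω) (Iic t) t) : IsStronglyPredictable 𝓕 L := by
  -- For `t > 0` this is the last multiple of `1/(n + 1)` strictly before `t`, and truncated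
  -- subtraction makes it zero at `t = 0`. Sampling there uses only past information and converges
  -- by left continuity.
  set d : ℕ → ℝ≥0 → ℝ≥0 := fun n t => ((⌈t * (n + 1)⌉₊ - 1 : ℕ) : ℝ≥0) / (n + 1) with hd
  have hpos : ∀ n : ℕ, (0 : ℝ≥0) < n + 1 := fun n => by positivity
  have hdle : ∀ n t, d n t ≤ t := fun n t => by
    rw [hd, div_le_iff₀ (hpos n)]
    rcases Nat.eq_zero_or_pos ⌈t * (n + 1)⌉₊ with h | h
    · simp [h]
    · exact (Nat.lt_ceil.1 (by omega : ⌈t * (n + 1)⌉₊ - 1 < ⌈t * (n + 1)⌉₊)).le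
  have hled : ∀ n t, t ≤ d n t + 1 / (n + 1) := fun n t => by
    rw [hd, ← add_div, le_div_iff₀ (hpos n)]
    refine (Nat.le_ceil _).trans ?_
    have : ⌈t * (n + 1)⌉₊ ≤ ⌈t * (n + 1)⌉₊ - 1 + 1 := by omega
    exact_mod_cast this
  have hdlim : ∀ t, Tendsto (fun n => d n t) atTop (𝓝[≤] t) := fun t => by
    refine tendsto_nhdsWithin_iff.2 ⟨?_, Eventually.of_forall fun n => hdle n t⟩
    have h1 : Tendsto (fun n : ℕ => t - 1 / ((n : ℝ≥0) + 1)) atTop (𝓝 t) := by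
      have := (tendsto_const_nhds (x := t)).sub
        (tendsto_one_div_add_atTop_nhds_zero_nat (𝕜 := ℝ≥0))
      rwa [tsub_zero] at this
    exact tendsto_of_tendsto_of_tendsto_of_le_of_le h1 tendsto_const_nhds
      (fun n => tsub_le_iff_right.2 (hled n t)) fun n => hdle n t
  have hm : ∀ n, Measurable[𝓕.predictable] fun z : ℝ≥0 × Ω => L (d n z.1) z.2 := by
    intro n B hB
    have h1 : (fun z : ℝ≥0 × Ω => L (d n z.1) z.2) ⁻¹' B = ({⊥} ×ˢ (L 0 ⁻¹' B)) ∪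
        ⋃ i : ℕ, Ioc ((i : ℝ≥0) / (n + 1)) ((i + 1) / (n + 1)) ×ˢ (L (i / (n + 1)) ⁻¹' B) := by
      have e : ∀ (t : ℝ≥0) (i : ℕ), t ∈ Ioc ((i : ℝ≥0) / (n + 1)) ((i + 1) / (n + 1)) →
          d n t = i / (n + 1) := fun t i ht => by
        have : ⌈t * (n + 1)⌉₊ = i + 1 := by
          rw [Nat.ceil_eq_iff (Nat.succ_ne_zero i)]
          refine ⟨?_, ?_⟩
          · have := (div_lt_iff₀ (hpos n)).1 ht.1
            simpa using this
          · have := (le_div_iff₀ (hpos n)).1 ht.2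
            exact_mod_cast this
        simp only [hd, this, Nat.add_sub_cancel]
      ext ⟨t, ω⟩
      simp only [mem_preimage, mem_union, mem_prod, mem_singleton_iff, mem_iUnion]
      constructor
      · intro h
        rcases eq_or_ne ⌈t * ((n : ℝ≥0) + 1)⌉₊ 0 with h0 | h0
        · have ht : t = 0 := by
            have := nonpos_iff_eq_zero.1 (Nat.ceil_eq_zero.1 h0)
            exact (mul_eq_zero.1 this).resolve_right (hpos n).ne'
          left
          refine ⟨ht, ?_⟩
          rw [ht, nonpos_iff_eq_zero.1 (hdle n 0)] at h
          exact h
        · obtain ⟨i, hi⟩ := Nat.exists_eq_succ_of_ne_zero h0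
          have hti : t ∈ Ioc ((i : ℝ≥0) / (n + 1)) ((i + 1) / (n + 1)) := by
            have := (Nat.ceil_eq_iff (Nat.succ_ne_zero i)).1 hi
            refine ⟨(div_lt_iff₀ (hpos n)).2 ?_, (le_div_iff₀ (hpos n)).2 ?_⟩
            · simpa using this.1
            · exact_mod_cast this.2
          exact Or.inr ⟨i, hti, by rw [← e t i hti]; exact h⟩
      · rintro (⟨h0, h⟩ | ⟨i, hti, h⟩)
        · have h0 : t = 0 := h0
          rw [h0, nonpos_iff_eq_zero.1 (hdle n 0)]; exact h
        · rw [e t i hti]; exact h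
    rw [h1]
    exact MeasurableSet.union (measurableSet_predictable_singleton_bot_prod (hL 0 hB))
      (MeasurableSet.iUnion fun i => measurableSet_predictable_Ioc_prod _ _ (hL _ hB))
  refine Measurable.stronglyMeasurable (@measurable_of_tendsto_metrizable _ _ 𝓕.predictable
    _ _ _ _ _ _ hm (tendsto_pi_nhds.2 fun z => ?_))
  exact (hc z.2 z.1).tendsto.comp (hdlim z.1)

namespace RiskModel

variable {Ω : Type*} [MeasurableSpace Ω] {P : Measure Ω} (M : RiskModel P)

/-! ### Measurability of the band strategy -/

theorem measurable_count : Measurable fun z : ℝ × Seqs => count z.2 z.1 := by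
  refine measurable_ncard.comp (measurable_set_iff.2 fun i => ?_)
  exact measurableSet_setOfPred.1
    (measurableSet_le ((measurable_epoch (i + 1)).comp measurable_snd) measurable_fst)

theorem measurable_total (t : ℝ) : Measurable fun ξ => total ξ t := by
  have h : Measurable (fun q : ℕ × Seqs => ∑ i ∈ Finset.range q.1, q.2.2 i) :=
    measurable_from_prod_countable_right fun n =>
      Finset.measurable_sum (Finset.range n) fun i _ => by fun_prop
  exact h.comp ((measurable_count.comp (measurable_const.prodMk measurable_id)).prodMk measurable_id)

section

variable (hα : M.q < M.α) (x : ℝ)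
include hα

theorem measurable_bandLevel (k : ℕ) : Measurable fun ξ => M.bandLevel x ξ k := by
  induction k with
  | zero => exact measurable_const
  | succ k ih =>
    exact ((M.measurable_bandPath hα).comp (Measurable.prodMk (by fun_prop) ih)).sub (by fun_prop)

theorem measurable_bandReserve :
    Measurable fun z : ℝ × Seqs => M.bandReserve x z.2 z.1 := by
  have h : Measurable (fun y : ℕ × (ℝ × Seqs) =>
      M.bandPath (y.2.1 - epoch y.2.2 y.1) (M.bandLevel x y.2.2 y.1)) :=
    measurable_from_prod_countable_right fun n => (M.measurable_bandPath hα).comp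
      ((measurable_fst.sub ((measurable_epoch n).comp measurable_snd)).prodMk
        ((M.measurable_bandLevel hα x n).comp measurable_snd))
  exact h.comp (measurable_count.prodMk measurable_id)

theorem measurable_bandPaid {t : ℝ} (ht : 0 ≤ t) : Measurable fun ξ => M.bandPaid x ξ t := by
  have h1 := M.measurable_bandReserve hα x
  have h2 : Measurable fun ξ => M.bandReserve x ξ t :=
    h1.comp (measurable_const.prodMk measurable_id)
  have h3 : Measurable fun ξ => ∫ s in (0 : ℝ)..t, M.drift (M.bandReserve x ξ s) := by
    simp only [intervalIntegral.integral_of_le ht]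
    have h4 : Measurable fun z : Seqs × ℝ => M.drift (M.bandReserve x z.1 z.2) :=
      M.continuous_drift.measurable.comp (h1.comp measurable_swap)
    exact (StronglyMeasurable.integral_prod_right' h4.stronglyMeasurable).measurable
  exact ((measurable_const.add h3).sub (measurable_total t)).sub h2

end

/-- The aggregate claims at countably many times up to `t`. -/
def totals (t : ℝ≥0) (ξ : Seqs) (a : ℚ) : ℝ := total ξ (min t (Real.toNNReal a) : ℝ≥0)

theorem measurable_totals (t : ℝ≥0) : Measurable (totals t) :=
  measurable_pi_lambda _ fun _ => measurable_total _

/-- The totals are right-continuous step functions, so a rational time slightly after `s`, within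
the current steps of both sequences, gives the value at `s`. The final time is covered by the
minimum in `totals`. -/
theorem total_eq_of_totals {t : ℝ≥0} {ξ ξ' : Seqs} (hξ : ξ ∈ good) (hξ' : ξ' ∈ good)
    (h : totals t ξ = totals t ξ') {s : ℝ} (hs : s ∈ Icc 0 (t : ℝ)) : total ξ s = total ξ' s := by
  have key : ∀ a : ℚ, total ξ (min t (Real.toNNReal a) : ℝ≥0) =
      total ξ' (min t (Real.toNNReal a) : ℝ≥0) := fun a => congrFun h a
  rcases hs.2.eq_or_lt with hst | hst
  · obtain ⟨a, ha⟩ := exists_rat_gt (t : ℝ)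
    have := key a
    rwa [min_eq_left (NNReal.le_toNNReal_of_coe_le ha.le), ← hst] at this
  · obtain ⟨j, hj⟩ := exists_mem_epoch hξ hs.1
    obtain ⟨k, hk⟩ := exists_mem_epoch hξ' hs.1
    obtain ⟨a, ha1, ha2⟩ := exists_rat_btwn (lt_min hst (lt_min hj.2 hk.2))
    have ha0 : (0 : ℝ) ≤ a := hs.1.trans ha1.le
    have hat : Real.toNNReal a ≤ t := by
      rw [← NNReal.coe_le_coe, Real.coe_toNNReal _ ha0]
      exact ha2.le.trans (min_le_left _ _)
    have := key a
    rw [min_eq_right hat, Real.coe_toNNReal _ ha0] at this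
    rw [total_eq hξ hj, total_eq hξ' hk, ← total_eq hξ (k := j) (t := a)
      ⟨hj.1.trans ha1.le, ha2.trans_le ((min_le_right _ _).trans (min_le_left _ _))⟩,
      ← total_eq hξ' (k := k) (t := a)
      ⟨hk.1.trans ha1.le, ha2.trans_le ((min_le_right _ _).trans (min_le_right _ _))⟩, this]

/-- An event that only depends on the aggregate claims up to time `t` is determined by them in a
measurable way. -/
theorem exists_measurableSet_totals {t : ℝ≥0} {A : Set Seqs} (hA : MeasurableSet A)
    (h : ∀ ξ ∈ good, ∀ ξ' ∈ good, (∀ s ∈ Icc 0 (t : ℝ), total ξ s = total ξ' s) →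
      ξ ∈ A → ξ' ∈ A) :
    ∃ B : Set (ℚ → ℝ), MeasurableSet B ∧ ∀ ξ ∈ good, (ξ ∈ A ↔ totals t ξ ∈ B) := by
  have : StandardBorelSpace good := measurableSet_good.standardBorel
  set f : good → (ℚ → ℝ) := fun ξ => totals t ξ with hf
  have hfm : Measurable f := (measurable_totals t).comp measurable_subtype_coe
  set S : Set (ℚ → ℝ) := f '' (Subtype.val ⁻¹' A) with hS
  have hpre : f ⁻¹' S = Subtype.val ⁻¹' A := by
    refine Subset.antisymm ?_ (subset_preimage_image _ _)
    rintro ξ ⟨ξ', hξ', he⟩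
    exact h ξ' ξ'.2 ξ ξ.2 (fun s hs => total_eq_of_totals ξ'.2 ξ.2 he hs) hξ'
  have hm : MeasurableSet (f ⁻¹' S) := by
    rw [hpre]; exact measurable_subtype_coe hA
  obtain ⟨B, hB, he⟩ := (hfm.measurableSet_preimage_iff_preimage_val).1 hm
  refine ⟨B, hB, fun ξ hξ => ?_⟩
  have h1 : ξ ∈ A ↔ totals t ξ ∈ S := by
    have := congrArg (fun T : Set good => (⟨ξ, hξ⟩ : good) ∈ T) hpre
    exact (iff_of_eq this).symm
  have h2 : totals t ξ ∈ B ↔ totals t ξ ∈ S := by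
    have := congrArg (fun T : Set (range f) => (⟨f ⟨ξ, hξ⟩, mem_range_self _⟩ : range f) ∈ T) he
    exact iff_of_eq this
  rw [h1, h2]

open Classical in
/-- The dividends paid under the band rule. -/
def bandDividend (x : ℝ) (t : ℝ≥0) (ω : Ω) : ℝ :=
  if M.seqs ω ∈ good then M.bandPaid x (M.seqs ω) t else 0

theorem bandDividend_of_mem (x : ℝ) (t : ℝ≥0) {ω : Ω} (h : M.seqs ω ∈ good) :
    M.bandDividend x t ω = M.bandPaid x (M.seqs ω) t := by simp [bandDividend, h]

theorem bandDividend_of_notMem (x : ℝ) (t : ℝ≥0) {ω : Ω} (h : M.seqs ω ∉ good) :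
    M.bandDividend x t ω = 0 := by simp [bandDividend, h]

theorem bandDividend_left_cont (hα : M.q < M.α) (x : ℝ) (ω : Ω) (t : ℝ≥0) :
    ContinuousWithinAt (fun s => M.bandDividend x s ω) (Iic t) t := by
  by_cases h : M.seqs ω ∈ good
  · simp only [M.bandDividend_of_mem x _ h]
    rcases eq_or_ne t 0 with rfl | ht
    · have : Iic (0 : ℝ≥0) = {0} := by ext s; simp
      rw [this]
      exact continuousWithinAt_singleton
    · exact ContinuousWithinAt.comp (t := Iic (t : ℝ))
        (M.bandPaid_left_cont hα h x (NNReal.coe_pos.2 (pos_iff_ne_zero.2 ht)))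
        NNReal.continuous_coe.continuousWithinAt fun s hs => hs
  · simp only [M.bandDividend_of_notMem x _ h]
    exact continuousWithinAt_const

section

variable [P.IsComplete]

theorem measurableSet_filtration_of_null (t : ℝ≥0) {A : Set Ω} (hA : P A = 0) :
    MeasurableSet[M.filtration t] A :=
  (le_sup_right : _ ≤ (⨆ u : ℝ≥0, ⨆ _ : u ≤ t, (borel ℝ).comap (M.Y u)) ⊔
    MeasurableSpace.generateFrom {A : Set Ω | P A = 0}) A
    (MeasurableSpace.measurableSet_generateFrom hA)

theorem measurable_filtration_Y {s t : ℝ≥0} (hst : s ≤ t) : Measurable[M.filtration t] (M.Y s) := by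
  intro B hB
  refine (le_sup_left : _ ≤ (⨆ u : ℝ≥0, ⨆ _ : u ≤ t, (borel ℝ).comap (M.Y u)) ⊔
    MeasurableSpace.generateFrom {A : Set Ω | P A = 0}) _ ?_
  refine (le_iSup₂ (f := fun (u : ℝ≥0) (_ : u ≤ t) => (borel ℝ).comap (M.Y u)) s hst) _ ?_
  exact ⟨B, hB, rfl⟩

theorem measurableSet_filtration [IsProbabilityMeasure P] {t : ℝ≥0} {A : Set Seqs}
    (hA : MeasurableSet A) (h : ∀ ξ ∈ good, ∀ ξ' ∈ good,
      (∀ s ∈ Icc 0 (t : ℝ), total ξ s = total ξ' s) → ξ ∈ A → ξ' ∈ A) {A' : Set Ω}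
    (hA' : ∀ ω, M.seqs ω ∈ good → (ω ∈ A' ↔ M.seqs ω ∈ A)) :
    MeasurableSet[M.filtration t] A' := by
  obtain ⟨B, hB, hAB⟩ := exists_measurableSet_totals hA h
  set N : Set Ω := {ω | M.seqs ω ∉ good} with hN
  have hN0 : P N = 0 := ae_iff.1 M.ae_good
  have hm : Measurable[M.filtration t] fun ω => totals t (M.seqs ω) :=
    @measurable_pi_lambda _ _ _ (M.filtration t) _ _ fun a => M.measurable_filtration_Y (min_le_left t (Real.toNNReal a))
  have h1 : A' = ((fun ω => totals t (M.seqs ω)) ⁻¹' B ∩ Nᶜ) ∪ (A' ∩ N) := by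
    ext ω
    by_cases hω : M.seqs ω ∈ good
    · simp [hN, hω, hA' ω hω, hAB _ hω]
    · simp [hN, hω]
  rw [h1]
  exact ((hm hB).inter (M.measurableSet_filtration_of_null t hN0).compl).union
    (M.measurableSet_filtration_of_null t (measure_mono_null inter_subset_right hN0))

section

variable (hα : M.q < M.α) (x : ℝ)
include hα

theorem measurable_bandDividend [IsProbabilityMeasure P] (t : ℝ≥0) :
    Measurable[M.filtration t] (M.bandDividend x t) := by
  intro B hB
  refine M.measurableSet_filtration (M.measurable_bandPaid hα x t.2 hB)
    (fun ξ hξ ξ' hξ' h hA => ?_) fun ω hω => ?_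
  · rw [mem_preimage] at hA ⊢
    rwa [← M.bandPaid_congr hα x hξ hξ' t.2 h]
  · simp only [mem_preimage, M.bandDividend_of_mem x t hω]
    rfl

/-- The band strategy. -/
def bandStrategy [IsProbabilityMeasure P] : M.DividendStrategy where
  L := M.bandDividend x
  L_zero ω := by
    by_cases h : M.seqs ω ∈ good
    · rw [M.bandDividend_of_mem x _ h, NNReal.coe_zero, M.bandPaid_zero h]
    · exact M.bandDividend_of_notMem x _ h
  mono ω s t hst := by
    by_cases h : M.seqs ω ∈ good
    · simp only [M.bandDividend_of_mem x _ h]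
      exact M.bandPaid_mono hα h x s.2 hst
    · simp only [M.bandDividend_of_notMem x _ h, le_refl]
  left_cont := M.bandDividend_left_cont hα x
  predictable := .of_left_cont (M.measurable_bandDividend hα x) (M.bandDividend_left_cont hα x)

end

end

end RiskModel

/-! ### The dividend measure of the band strategy -/

namespace RiskModel

variable {Ω : Type*} [MeasurableSpace Ω] {P : Measure Ω} (M : RiskModel P)

section

variable (hα : M.q < M.α) (x : ℝ)
include hα

/-- Ruin is absorbing: at or below `crit` the flow cannot rise above it, and claims only push the
reserve down. -/
theorem bandReserve_le_crit {ξ : Seqs} (hξ : ξ ∈ good) {s t : ℝ} (h0 : 0 ≤ s) (hst : s ≤ t)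
    (hs : M.bandReserve x ξ s ≤ M.crit) : M.bandReserve x ξ t ≤ M.crit := by
  have hmono := epoch_strictMono hξ
  have htot : ∀ u v, 0 ≤ u → u ≤ v → total ξ u ≤ total ξ v := fun u v hu huv => by
    obtain ⟨j, hj⟩ := exists_mem_epoch hξ hu
    obtain ⟨k, hk⟩ := exists_mem_epoch hξ (hu.trans huv)
    rw [total_eq hξ hj, total_eq hξ hk]
    have : j < k + 1 := hmono.lt_iff_lt.1 (hj.1.trans_lt (huv.trans_lt hk.2))
    exact Finset.sum_le_sum_of_subset_of_nonneg (Finset.range_mono (by omega))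
      fun i _ _ => hξ.2.1 i
  have step : ∀ (k : ℕ) (u v : ℝ), epoch ξ k ≤ u → u < epoch ξ (k + 1) → u ≤ v →
      v ≤ epoch ξ (k + 1) → M.bandReserve x ξ u ≤ M.crit → M.bandReserve x ξ v ≤ M.crit := by
    intro k u v h1 h2 h3 h4 h5
    rw [M.bandReserve_step hα x hξ h1 h2 h3 h4, M.bandPath_of_le hα h5 (sub_nonneg.2 h3)]
    have h6 := M.flow_le_crit h5 (v - u)
    have h7 := htot u v ((epoch_nonneg hξ k).trans h1) h3
    linarith
  obtain ⟨j, hj⟩ := exists_mem_epoch hξ h0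
  obtain ⟨k, hk⟩ := exists_mem_epoch hξ (h0.trans hst)
  have hjk : j < k + 1 := hmono.lt_iff_lt.1 (hj.1.trans_lt (hst.trans_lt hk.2))
  rcases (Nat.lt_succ_iff.1 hjk).eq_or_lt with rfl | h
  · exact step j s t hj.1 hj.2 hst hk.2.le hs
  · have h1 := step j s _ hj.1 hj.2 hj.2.le le_rfl hs
    have h2 : ∀ n, j + 1 ≤ n → M.bandReserve x ξ (epoch ξ n) ≤ M.crit := by
      intro n hn
      induction n, hn using Nat.le_induction with
      | base => exact h1
      | succ n _ ih =>
        exact step n _ _ le_rfl (hmono n.lt_succ_self) (hmono n.lt_succ_self).le le_rfl ih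
    exact step k _ t le_rfl (hmono k.lt_succ_self) hk.1 hk.2.le (h2 k h)

end

/-- The reserve process of the band strategy. -/
def bandSurplus (x : ℝ) (t : ℝ≥0) (ω : Ω) : ℝ := M.bandReserve x (M.seqs ω) t

theorem bandSurplus_toNNReal (x : ℝ) {t : ℝ} (ht : 0 ≤ t) (ω : Ω) :
    M.bandSurplus x t.toNNReal ω = M.bandReserve x (M.seqs ω) t := by
  rw [bandSurplus, Real.coe_toNNReal _ ht]

theorem bandSurplus_le_crit (hα : M.q < M.α) (x : ℝ) {ω : Ω} (hω : M.seqs ω ∈ good) {s : ℝ} (h0 : 0 ≤ s)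
    (hs : s ∉ M.untilRuin (M.bandSurplus x) ω) : M.bandReserve x (M.seqs ω) s ≤ M.crit := by
  have h1 : M.ruinTime (M.bandSurplus x) ω < ENNReal.ofReal s := not_le.1 fun h => hs ⟨h0, h⟩
  obtain ⟨t, ht⟩ := iInf_lt_iff.1 h1
  obtain ⟨hR, hts⟩ := iInf_lt_iff.1 ht
  have hts' : (t : ℝ) ≤ s := by
    have : (t : ℝ≥0∞) < ENNReal.ofReal s := hts
    rw [ENNReal.ofReal, ENNReal.coe_lt_coe] at this
    have := NNReal.coe_lt_coe.2 this
    rw [Real.coe_toNNReal _ h0] at this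
    exact this.le
  exact M.bandReserve_le_crit hα x hω t.2 hts' hR

theorem measurable_payRate_bandReserve (hα : M.q < M.α) (x : ℝ) (ξ : Seqs) :
    Measurable fun u => ENNReal.ofReal (M.payRate (M.bandReserve x ξ u)) :=
  ((M.measurable_payRate hα).comp ((M.measurable_bandReserve hα x).comp
    (measurable_id.prodMk measurable_const))).ennreal_ofReal

section

variable [IsProbabilityMeasure P] [P.IsComplete] (hα : M.q < M.α) (x : ℝ) {ω : Ω}
  (hω : M.seqs ω ∈ good)

include hω

theorem bandStrategy_path {t : ℝ} (ht : 0 ≤ t) :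
    (M.bandStrategy hα x).path ω t = M.bandPaid x (M.seqs ω) t := by
  have : (M.bandStrategy hα x).path ω t = M.bandDividend x t.toNNReal ω := rfl
  rw [this, M.bandDividend_of_mem x _ hω, Real.coe_toNNReal _ ht]

theorem bandStrategy_dL_restrict (k : ℕ) :
    ((M.bandStrategy hα x).dL ω).restrict
        (Ico (epoch (M.seqs ω) k) (epoch (M.seqs ω) (k + 1))) =
      ENNReal.ofReal (M.bandLevel x (M.seqs ω) k - M.base (M.bandLevel x (M.seqs ω) k)) •
        Measure.dirac (epoch (M.seqs ω) k) +
      (volume.restrict (Ico (epoch (M.seqs ω) k) (epoch (M.seqs ω) (k + 1)))).withDensity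
        fun u => ENNReal.ofReal (M.payRate (M.bandReserve x (M.seqs ω) u)) := by
  set D := M.bandStrategy hα x with hD
  have hab := epoch_strictMono hω k.lt_succ_self
  have h := (D.path_mono ω).stieltjesFunction_measure_restrict (D.path_left_cont ω) hab
    (sub_nonneg.2 (M.base_le hα _)) (fun u => M.payRate_nonneg _)
    (M.bandPath_integral hα (M.bandLevel x (M.seqs ω) k) hab.le).2.1 fun t ht => by
      have h0 := epoch_nonneg hω k
      rw [M.bandStrategy_path hα x hω (h0.trans ht.1), M.bandStrategy_path hα x hω h0]
      exact M.bandPaid_segment hα hω x ht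
  refine h.trans ?_
  congr 1
  refine withDensity_congr_ae ((ae_restrict_iff' measurableSet_Ico).2
    (Eventually.of_forall fun u hu => ?_))
  simp only [M.bandReserve_eq hω x hu]

theorem setLIntegral_bandStrategy {k : ℕ} {J : Set ℝ} (hJ : MeasurableSet J)
    (hJk : J ⊆ Ico (epoch (M.seqs ω) k) (epoch (M.seqs ω) (k + 1))) {g : ℝ → ℝ≥0∞}
    (hg : Measurable g) :
    ∫⁻ u in J, g u ∂((M.bandStrategy hα x).dL ω) =
      ENNReal.ofReal (M.bandLevel x (M.seqs ω) k - M.base (M.bandLevel x (M.seqs ω) k)) *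
        J.indicator g (epoch (M.seqs ω) k) +
      ∫⁻ u in J, ENNReal.ofReal (M.payRate (M.bandReserve x (M.seqs ω) u)) * g u := by
  have h1 : ∀ μ : Measure ℝ, ∫⁻ u in J, g u ∂μ =
      ∫⁻ u in Ico (epoch (M.seqs ω) k) (epoch (M.seqs ω) (k + 1)), J.indicator g u ∂μ := fun μ => by
    rw [lintegral_indicator hJ, Measure.restrict_restrict hJ, inter_eq_self_of_subset_left hJk]
  have hm := M.measurable_payRate_bandReserve hα x (M.seqs ω)
  rw [h1, M.bandStrategy_dL_restrict hα x hω, lintegral_add_measure, lintegral_smul_measure,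
    lintegral_dirac' _ (hg.indicator hJ), smul_eq_mul,
    lintegral_withDensity_eq_lintegral_mul _ hm (hg.indicator hJ)]
  congr 1
  have h2 : ∀ u, ((fun u => ENNReal.ofReal (M.payRate (M.bandReserve x (M.seqs ω) u))) *
      J.indicator g) u = J.indicator (fun u =>
        ENNReal.ofReal (M.payRate (M.bandReserve x (M.seqs ω) u)) * g u) u := fun u => by
    by_cases hu : u ∈ J <;> simp [hu]
  simp only [h2]
  rw [lintegral_indicator hJ, Measure.restrict_restrict hJ, inter_eq_self_of_subset_left hJk]

theorem bandStrategy_dL_apply {S : Set ℝ} (hS : MeasurableSet S) (hS0 : S ⊆ Ici 0)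
    (hlump : ∀ k, epoch (M.seqs ω) k ∈ S →
      M.base (M.bandLevel x (M.seqs ω) k) = M.bandLevel x (M.seqs ω) k) :
    (M.bandStrategy hα x).dL ω S =
      ∫⁻ u in S, ENNReal.ofReal (M.payRate (M.bandReserve x (M.seqs ω) u)) := by
  set J : ℕ → Set ℝ := fun k => S ∩ Ico (epoch (M.seqs ω) k) (epoch (M.seqs ω) (k + 1)) with hJ
  have hJm : ∀ k, MeasurableSet (J k) := fun k => hS.inter measurableSet_Ico
  have h1 : S = ⋃ k, J k := by
    rw [hJ, ← inter_iUnion]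
    refine (inter_eq_self_of_subset_left fun s hs => ?_).symm
    exact mem_iUnion.2 (exists_mem_epoch hω (hS0 hs))
  have h2 : Pairwise (Function.onFun Disjoint J) := fun i j hij =>
    ((epoch_strictMono hω).monotone.pairwise_disjoint_on_Ico_succ hij).mono
      inter_subset_right inter_subset_right
  rw [h1, measure_iUnion h2 hJm, lintegral_iUnion hJm h2]
  refine tsum_congr fun k => ?_
  have h3 := M.setLIntegral_bandStrategy hα x hω (hJm k) inter_subset_right
    (g := fun _ => 1) measurable_const
  simp only [lintegral_const, Measure.restrict_apply_univ, one_mul, mul_one] at h3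
  rw [h3]
  by_cases hk : epoch (M.seqs ω) k ∈ S
  · rw [hlump k hk, sub_self, ENNReal.ofReal_zero, zero_mul, zero_add]
  · rw [indicator_of_notMem fun h => hk h.1, mul_zero, zero_add]

/-- No measurability of `S` is needed: it is contained in the measurable set of nonnegative times
with zero dividend rate, with the countably many lump sum epochs removed. -/
theorem bandStrategy_dL_eq_zero {S : Set ℝ} (hS0 : S ⊆ Ici 0)
    (hlump : ∀ k, epoch (M.seqs ω) k ∈ S →
      M.base (M.bandLevel x (M.seqs ω) k) = M.bandLevel x (M.seqs ω) k)
    (hpay : ∀ u ∈ S, M.payRate (M.bandReserve x (M.seqs ω) u) = 0) :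
    (M.bandStrategy hα x).dL ω S = 0 := by
  set T : Set ℝ := (Ici 0 ∩ {u | ENNReal.ofReal (M.payRate (M.bandReserve x (M.seqs ω) u)) = 0}) \
    ⋃ k ∈ {k | M.base (M.bandLevel x (M.seqs ω) k) ≠ M.bandLevel x (M.seqs ω) k},
      {epoch (M.seqs ω) k} with hT
  have hST : S ⊆ T := fun u hu => by
    refine ⟨⟨hS0 hu, by simp [hpay u hu]⟩, fun h => ?_⟩
    obtain ⟨k, hk, rfl⟩ := mem_iUnion₂.1 h
    exact hk (hlump k hu)
  have hTm : MeasurableSet T :=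
    (measurableSet_Ici.inter (M.measurable_payRate_bandReserve hα x (M.seqs ω) (measurableSet_singleton 0))).diff
      (MeasurableSet.biUnion (to_countable _) fun k _ => measurableSet_singleton _)
  refine measure_mono_null hST ?_
  rw [M.bandStrategy_dL_apply hα x hω hTm (fun u hu => hu.1.1) fun k hk => ?_]
  · rw [setLIntegral_congr_fun hTm (fun u hu => hu.1.2)]
    simp
  · by_contra h
    exact hk.2 (mem_iUnion₂.2 ⟨k, h, rfl⟩)

theorem bandStrategy_lump {k : ℕ} {t : ℝ}
    (ht : t ∈ Ico (epoch (M.seqs ω) k) (epoch (M.seqs ω) (k + 1))) :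
    Function.rightLim ((M.bandStrategy hα x).path ω) t - (M.bandStrategy hα x).path ω t =
      if t = epoch (M.seqs ω) k then
        M.bandLevel x (M.seqs ω) k - M.base (M.bandLevel x (M.seqs ω) k) else 0 := by
  have h1 := M.setLIntegral_bandStrategy hα x hω (measurableSet_singleton t)
    (singleton_subset_iff.2 ht) (g := fun _ => 1) measurable_const
  simp only [lintegral_const, Measure.restrict_apply_univ, one_mul, mul_one] at h1
  rw [DividendStrategy.dL_singleton, Measure.restrict_singleton, Real.volume_singleton, zero_smul,
    lintegral_zero_measure, add_zero] at h1
  have h2 := sub_nonneg.2 (((M.bandStrategy hα x).path_mono ω).le_rightLim (le_refl t))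
  have h3 := sub_nonneg.2 (M.base_le hα (M.bandLevel x (M.seqs ω) k))
  split_ifs with h
  · rw [h, indicator_of_mem (mem_singleton _), mul_one, ← h] at h1
    exact (ENNReal.ofReal_eq_ofReal_iff h2 h3).1 h1
  · rw [indicator_of_notMem (fun h' => h (mem_singleton_iff.1 h').symm), mul_zero,
      ENNReal.ofReal_eq_zero] at h1
    exact le_antisymm h1 h2

end

end RiskModel

/-! ### Optimality of the band strategy -/

namespace RiskModel

variable {Ω : Type*} [MeasurableSpace Ω] {P : Measure Ω} (M : RiskModel P)
  [IsProbabilityMeasure P] [P.IsComplete] (hα : M.q < M.α) (x : ℝ)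
include hα

theorem isReserve_bandStrategy : M.IsReserve x (M.bandStrategy hα x) (M.bandSurplus x) := by
  filter_upwards [M.ae_good] with ω hω t
  have hc : EqOn (fun s => M.drift (M.bandReserve x (M.seqs ω) s))
      (fun s : ℝ => M.drift (M.bandSurplus x s.toNNReal ω)) (uIcc 0 (t : ℝ)) := fun s hs => by
    rw [uIcc_of_le (NNReal.coe_nonneg t)] at hs
    simp only [M.bandSurplus_toNNReal x hs.1]
  have h1 := M.intervalIntegrable_bandReserve hα hω x (NNReal.coe_nonneg t)
  refine ⟨h1.congr_ae ((ae_restrict_iff' measurableSet_uIoc).2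
    (Eventually.of_forall fun s hs => hc (uIoc_subset_uIcc hs))), ?_⟩
  have h2 : (M.bandStrategy hα x).L t ω = M.bandPaid x (M.seqs ω) t := M.bandDividend_of_mem x t hω
  rw [h2, ← intervalIntegral.integral_congr hc, bandPaid, bandSurplus, M.Y_eq_total]
  ring

/-- Lump sums occur only at claim epochs and at time zero. At other times the reserve is outside
`ℬ`, where `base` is the identity, so one formula covers all times. -/
theorem bandStrategy_lump_eq {ω : Ω} (hω : M.seqs ω ∈ good) (t : ℝ≥0) :
    Function.rightLim ((M.bandStrategy hα x).path ω) t - (M.bandStrategy hα x).path ω t =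
      M.bandSurplus x t ω - M.base (M.bandSurplus x t ω) := by
  obtain ⟨k, hk⟩ := exists_mem_epoch hω (NNReal.coe_nonneg t)
  rw [M.bandStrategy_lump hα x hω hk, bandSurplus, M.bandReserve_eq hω x hk]
  split_ifs with h
  · rw [h, sub_self, M.bandPath_zero]
  · rw [M.base_of_notMem (M.bandPath_notMem_bandB hα
      (sub_pos.2 (lt_of_le_of_ne hk.1 (Ne.symm h))) _), sub_self]

theorem admissible_bandStrategy : M.Admissible x (M.bandStrategy hα x) (M.bandSurplus x) := by
  refine ⟨M.isReserve_bandStrategy hα x, ?_⟩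
  filter_upwards [M.ae_good] with ω hω t _
  rw [M.bandStrategy_lump_eq hα x hω]
  have hc : M.crit = -(M.p / M.α) := neg_div _ _
  rcases le_or_gt (M.bandSurplus x t ω) M.crit with h | h
  · rw [M.base_of_le (M.δ_lt_α hα) h, sub_self]; exact le_max_right _ _
  · have := M.crit_lt_base hα h
    exact le_max_of_le_left (by linarith)

/-- After ruin the reserve stays at or below `crit`, where the band rule pays nothing. So stopping
the count at ruin discards no dividends. -/
theorem bandStrategy_dL_diff_untilRuin {ω : Ω} (hω : M.seqs ω ∈ good) :
    (M.bandStrategy hα x).dL ω (Ici 0 \ M.untilRuin (M.bandSurplus x) ω) = 0 := by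
  refine M.bandStrategy_dL_eq_zero hα x hω sdiff_subset (fun k hk => ?_) fun u hu =>
    M.payRate_of_le (M.bandSurplus_le_crit hα x hω hu.1 hu.2)
  have := M.bandSurplus_le_crit hα x hω hk.1 hk.2
  rw [M.bandReserve_epoch hω] at this
  exact M.base_of_le (M.δ_lt_α hα) this

/-- The balance of value along the band path is an equality from every starting time within a piece,
which is the condition of `le_discounted`. -/
theorem le_returnOf_bandStrategy :
    ENNReal.ofReal (M.v x) ≤ M.returnOf (M.bandStrategy hα x) (M.bandSurplus x) := by
  refine le_returnOf (M.δ_lt_α hα) (M.admissible_bandStrategy hα x) ?_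
  filter_upwards [M.ae_good] with ω hω k
  set a := epoch (M.seqs ω) k with ha
  set b := epoch (M.seqs ω) (k + 1) with hb
  have hab : a < b := epoch_strictMono hω k.lt_succ_self
  have ha0 : 0 ≤ a := epoch_nonneg hω k
  set X := M.bandLevel x (M.seqs ω) k with hX
  have hp := M.isPiece_bandReserve hω x k
  refine ⟨fun t => M.bandPath (t - a) X, ⟨fun t ht => ?_, ?_⟩, ?_⟩
  · exact (hp.1 t ht).trans (M.bandSurplus_toNNReal x (ha0.trans ht.1) ω).symm
  · have := M.bandSurplus_toNNReal x (ha0.trans hab.le) ω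
    exact hp.2.trans (congrArg (· + (M.seqs ω).2 k) this.symm)
  have hm : Measurable fun t => M.bandPath (t - a) X :=
    (M.measurable_bandPath hα).comp (Measurable.prodMk (by fun_prop) measurable_const)
  have hI : ∀ J : Set ℝ, MeasurableSet J → J ⊆ Ico a b →
      M.rewardMeasure ((M.bandStrategy hα x).dL ω) (M.untilRuin (M.bandSurplus x) ω)
        (fun t => M.bandPath (t - a) X) J =
      ENNReal.ofReal (X - M.base X) * J.indicator (fun u => ENNReal.ofReal (Real.exp (-M.q * u))) a +
        (∫⁻ u in J, ENNReal.ofReal (Real.exp (-M.q * u)) *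
          ENNReal.ofReal (M.payRate (M.bandPath (u - a) X))) +
        ∫⁻ u in J, M.pathGain (fun t => M.bandPath (t - a) X) u := by
    intro J hJ hJab
    rw [M.rewardMeasure_apply _ _ _ hJ]
    congr 1
    have h1 : ∫⁻ u in M.untilRuin (M.bandSurplus x) ω ∩ J, ENNReal.ofReal (Real.exp (-M.q * u))
        ∂((M.bandStrategy hα x).dL ω) = ∫⁻ u in J, ENNReal.ofReal (Real.exp (-M.q * u))
        ∂((M.bandStrategy hα x).dL ω) := by
      have hsub : J \ (M.untilRuin (M.bandSurplus x) ω ∩ J) ⊆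
          Ici 0 \ M.untilRuin (M.bandSurplus x) ω := fun u hu =>
        ⟨ha0.trans (hJab hu.1).1, fun h => hu.2 ⟨h, hu.1⟩⟩
      have hempty : (M.untilRuin (M.bandSurplus x) ω ∩ J) \ J = ∅ := by
        ext u; simp +contextual
      exact setLIntegral_congr (ae_eq_set.2 ⟨by rw [hempty, measure_empty],
        measure_mono_null hsub (M.bandStrategy_dL_diff_untilRuin hα x hω)⟩)
    rw [h1, M.setLIntegral_bandStrategy hα x hω hJ hJab (by fun_prop)]
    congr 1
    refine setLIntegral_congr_fun hJ fun u hu => ?_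
    rw [M.bandReserve_eq hω x (hJab hu), mul_comm]
  refine M.le_discounted (M.δ_lt_α hα) hab.le hm ?_ fun s hs => ?_
  · rw [hI _ measurableSet_Ico le_rfl, M.bandPath_pathValue_start hα X hab,
      indicator_of_mem (left_mem_Ico.2 hab), setLIntegral_congr (Ioo_ae_eq_Ico (μ := volume)),
      setLIntegral_congr (Ioo_ae_eq_Ico (μ := volume)), mul_comm (ENNReal.ofReal (X - M.base X))]
  · rw [hI _ measurableSet_Ioo (fun u hu => ⟨hs.1.le.trans hu.1.le, hu.2⟩),
      M.bandPath_pathValue hα X hs.1 hs.2.le,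
      indicator_of_notMem (fun h => absurd h.1 (not_lt.2 hs.1.le)), mul_zero, zero_add]

theorem returnOf_bandStrategy :
    M.returnOf (M.bandStrategy hα x) (M.bandSurplus x) = ENNReal.ofReal (M.v x) :=
  le_antisymm (returnOf_le (M.δ_lt_α hα) (M.admissible_bandStrategy hα x))
    (M.le_returnOf_bandStrategy hα x)

theorem value_eq : M.value x = ENNReal.ofReal (M.v x) := by
  refine le_antisymm (iSup_le fun D => iSup_le fun R => iSup_le fun hR =>
    returnOf_le (M.δ_lt_α hα) hR) ?_
  rw [← M.returnOf_bandStrategy hα x]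
  exact le_iSup_of_le _ (le_iSup_of_le _
    (le_iSup_of_le (M.admissible_bandStrategy hα x) le_rfl))

theorem V_eq : M.V = M.v := funext fun x => by
  rw [V, M.value_eq hα, ENNReal.toReal_ofReal ((M.isSuper_v (M.δ_lt_α hα)).nonneg x)]

theorem setA_eq : M.setA = M.bandA := by rw [setA, M.V_eq hα]; rfl

theorem setB_eq : M.setB = M.bandB := by rw [setB, M.V_eq hα]; rfl

theorem setC_eq : M.setC = M.bandC := by rw [setC, M.setA_eq hα, M.setB_eq hα]; rfl

theorem bandStrategy_dL_bandC {ω : Ω} (hω : M.seqs ω ∈ good) :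
    (M.bandStrategy hα x).dL ω {s | s ∈ M.untilRuin (M.bandSurplus x) ω ∧
      M.bandSurplus x s.toNNReal ω ∈ M.bandC} = 0 := by
  refine M.bandStrategy_dL_eq_zero hα x hω (fun s hs => hs.1.1) (fun k hk => ?_) fun u hu => ?_
  · have := hk.2
    rw [M.bandSurplus_toNNReal x hk.1.1, M.bandReserve_epoch hω] at this
    exact M.base_of_notMem fun h => this.2 (Or.inr h)
  · have := hu.2
    rw [M.bandSurplus_toNNReal x hu.1.1] at this
    rw [payRate, indicator_of_notMem fun h => this.2 (Or.inl h)]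

/-- Negative levels above `crit` lie in `𝒞`, and at or below `crit` neither a lump sum nor a rate is
paid. -/
theorem bandStrategy_dL_neg {ω : Ω} (hω : M.seqs ω ∈ good) :
    (M.bandStrategy hα x).dL ω {s | s ∈ M.untilRuin (M.bandSurplus x) ω ∧
      M.bandSurplus x s.toNNReal ω < 0} = 0 := by
  have hα' := M.δ_lt_α hα
  refine M.bandStrategy_dL_eq_zero hα x hω (fun s hs => hs.1.1) (fun k hk => ?_) fun u hu => ?_
  · have h := hk.2
    rw [M.bandSurplus_toNNReal x hk.1.1, M.bandReserve_epoch hω] at h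
    rcases le_or_gt (M.bandLevel x (M.seqs ω) k) M.crit with hc | hc
    · exact M.base_of_le hα' hc
    · exact M.base_of_notMem fun hB => (M.bandC_of_neg hα' hα ⟨hc, h⟩).2 (Or.inr hB)
  · have h := hu.2
    rw [M.bandSurplus_toNNReal x hu.1.1] at h
    rcases le_or_gt (M.bandReserve x (M.seqs ω) u) M.crit with hc | hc
    · exact M.payRate_of_le hc
    · rw [payRate, indicator_of_notMem fun hA => (M.bandC_of_neg hα' hα ⟨hc, h⟩).2 (Or.inl hA)]

theorem bandStrategy_dL_bandA {ω : Ω} (hω : M.seqs ω ∈ good) :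
    ((M.bandStrategy hα x).dL ω).restrict {s | s ∈ M.untilRuin (M.bandSurplus x) ω ∧
        M.bandSurplus x s.toNNReal ω ∈ M.bandA} =
      (volume.restrict {s | s ∈ M.untilRuin (M.bandSurplus x) ω ∧
        M.bandSurplus x s.toNNReal ω ∈ M.bandA}).withDensity
        fun s => ENNReal.ofReal (M.drift (M.bandSurplus x s.toNNReal ω)) := by
  set S : Set ℝ := {s | s ∈ M.untilRuin (M.bandSurplus x) ω ∧
    M.bandSurplus x s.toNNReal ω ∈ M.bandA} with hS
  have hR : Measurable fun s : ℝ => M.bandSurplus x s.toNNReal ω :=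
    (M.measurable_bandReserve hα x).comp (Measurable.prodMk (by fun_prop) measurable_const)
  have hSm : MeasurableSet S := (measurableSet_untilRuin _ _).inter
    (hR (M.isClosed_bandA (M.δ_lt_α hα)).measurableSet)
  ext B hB
  rw [Measure.restrict_apply hB, withDensity_apply _ hB, Measure.restrict_restrict hB,
    M.bandStrategy_dL_apply hα x hω (hB.inter hSm) (fun s hs => hs.2.1.1) fun k hk => ?_]
  · refine setLIntegral_congr_fun (hB.inter hSm) fun s hs => ?_
    have := hs.2.2
    rw [M.bandSurplus_toNNReal x hs.2.1.1] at this ⊢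
    rw [payRate, indicator_of_mem this]
  · have := hk.2.2
    rw [M.bandSurplus_toNNReal x hk.2.1.1, M.bandReserve_epoch hω] at this
    exact M.base_of_notMem fun h => M.notMem_bandA_of_bandB h this

theorem followsBands_bandStrategy : M.FollowsBands (M.bandStrategy hα x) (M.bandSurplus x) := by
  filter_upwards [M.ae_good] with ω hω
  rw [M.setA_eq hα, M.setB_eq hα, M.setC_eq hα]
  refine ⟨M.bandStrategy_dL_bandA hα x hω, fun t _ htB => ?_, M.bandStrategy_dL_bandC hα x hω⟩
  rw [M.bandStrategy_lump_eq hα x hω, M.base_of_mem htB]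
  rfl

end RiskModel

end

theorem theorem4p6 {Ω : Type*} [MeasurableSpace Ω] (P : Measure Ω) [IsProbabilityMeasure P]
    [P.IsComplete] (M : RiskModel P) (hα : M.lam + M.δ < M.α) :
    (∀ x : ℝ, M.value x ≠ ∞) ∧
    Ioo (-M.p / M.α) 0 ⊆ M.setC ∧
    ∀ x : ℝ, -M.p / M.α ≤ x →
      ∃ (D : M.DividendStrategy) (R : ℝ≥0 → Ω → ℝ), M.Admissible x D R ∧
        M.returnOf D R = M.value x ∧ M.FollowsBands D R ∧
        ∀ᵐ ω ∂P, D.dL ω {s | s ∈ M.untilRuin R ω ∧ R s.toNNReal ω < 0} = 0 := by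
  refine ⟨fun x => ?_, fun x hx => ?_, fun x _ => ⟨M.bandStrategy hα x, M.bandSurplus x,
    M.admissible_bandStrategy hα x, ?_, M.followsBands_bandStrategy hα x, ?_⟩⟩
  · rw [M.value_eq hα]; exact ENNReal.ofReal_ne_top
  · rw [M.setC_eq hα]; exact M.bandC_of_neg (M.δ_lt_α hα) hα hx
  · rw [M.returnOf_bandStrategy hα, M.value_eq hα]
  · filter_upwards [M.ae_good] with ω hω using M.bandStrategy_dL_neg hα x hω
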